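/- **Conventions.** Fix $\hbar\in\mathbb C$ such that $q=e^{\hbar}$ is not a root of unity, and put $q^x=e^{x\hbar}$, $[x]_q=\frac{q^x-q^{-x}}{q-q^{-1}}$ for $x\in\mathbb C$. Let $a_{11}=2$, $a_{12}=a_{21}=-1$, $a_{22}=0$. Let $\alpha,\beta,\gamma\in\mathbb C$ with $\alpha\neq 0,-1$. For elements $X,Y$ of $\mathbb Z_2$-degrees $[X],[Y]$ put $[X,Y]_\xi=XY-(-1)^{[X][Y]}\xi YX$ and $[X,Y]=[X,Y]_1$. **The algebra.** $U_q[\widehat{sl(2|1)}]$ is the associative superalgebra over $\mathbb C$ with generators $X^{\pm,i}_n$, $h^i_m$, $q^{\pm h^i_0}$, $q^{\pm c/2}$, $d$ ($i=1,2$; $n\in\mathbb Z$; $m\in\mathbb Z\setminus\{0\}$), where the $X^{\pm,2}_n$ are odd and all other generators are even, and relations (Drinfeld's realization): $q^{\pm c/2}$ are central and mutually inverse, $q^{\pm h_0^i}$ are mutually inverse and commute with each other, with the $h^j_m$ and with $d$; $[d,h^j_m]=m\,h^j_m$; $[d,X^{\pm,j}_m]=m\,X^{\pm,j}_m$; $$[h^i_m,h^j_n]=\delta_{m+n,0}\frac{[a_{ij}m]_q}{m}\,\frac{q^{mc}-q^{-mc}}{q-q^{-1}},\qquad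 q^{h^i_0}X^{\pm,j}_mq^{-h^i_0}=q^{\pm a_{ij}}X^{\pm,j}_m,$$ $$[h^i_m,X^{\pm,j}_n]=\pm\frac{[a_{ij}m]_q}{m}\,q^{\mp|m|c/2}X^{\pm,j}_{n+m},$$ $$[X^{+,i}_m,X^{-,j}_n]=\frac{\delta_{ij}}{q-q^{-1}}\left(q^{(m-n)c/2}\psi^{+,j}_{m+n}-q^{-(m-n)c/2}\psi^{-,j}_{m+n}\right),\qquad [X^{\pm,2}_m,X^{\pm,2}_n]=0,$$ $$[X^{\pm,i}_{m+1},X^{\pm,j}_n]_{q^{\pm a_{ij}}}+[X^{\pm,j}_{n+1},X^{\pm,i}_m]_{q^{\pm a_{ij}}}=0\quad (a_{ij}\ne0),$$ $$[X^{\pm,1}_{n_1},[X^{\pm,1}_{n_2},X^{\pm,2}_m]_{q^{-1}}]_q+(n_1\leftrightarrow n_2)=0,$$ where $\sum_n\psi^{\pm,i}_nz^{-n}=q^{\pm h^i_0}\exp\big(\pm(q-q^{-1})\sum_{n>0}h^i_{\pm n}z^{\mp n}\big)$. **Bosons and Fock space.** Let $a^i_n$ ($i=1,2$), $b^{12}_n,b^{13}_n,b^{23}_n,c_n$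 ($n\in\mathbb Z$) and $Q_{a^i},Q_{b^{12}},Q_{b^{13}},Q_{b^{23}},Q_c$ satisfy $$[a^i_m,a^j_n]=\delta_{m+n,0}\frac{[a_{ij}m]_q[(\alpha+1)m]_q}{m},\quad [a^i_0,Q_{a^j}]=(\alpha+1)a_{ij},\quad [g_m,g_n]=\epsilon_g\,\delta_{m+n,0}\frac{[m]_q^2}{m},\quad [g_0,Q_g]=\epsilon_g$$ for $g\in\{b^{12},b^{13},b^{23},c\}$, with $\epsilon_{b^{12}}=-1$ and $\epsilon_{b^{13}}=\epsilon_{b^{23}}=\epsilon_c=1$ (for $m,n\neq0$ in the first and third formula); all other commutators vanish. Let $|0\rangle$ be annihilated by all $a^i_n,b^{12}_n,b^{13}_n,b^{23}_n,c_n$ with $n\geq0$. For $m=(m_{12},m_{13},m_{23},m_c)\in\mathbb Z^4$ let $F_m$ be the Fock module freely generated by the creation operators (the oscillators with $n<0$) over $$|m\rangle=\exp\Big(\tfrac{\beta}{\alpha+1}Q_{a^1}+\tfrac{2\gamma}{\alpha+1}Q_{a^2}+m_{12}Q_{b^{12}}+m_{13}Q_{b^{13}}+m_{23}Q_{b^{23}}+m_cQ_c\Big)|0\rangle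 ,$$ and let $F_{(\beta,\gamma)}=\bigoplus_{i,j,l\in\mathbb Z}F_{(i+j,\,j,\,l,\,i+j)}\subset\bigoplus_{m\in\mathbb Z^4}F_m$. For a boson $b$ put $$b(z;\kappa)=-\sum_{n\ne0}\frac{b_n}{[n]_q}q^{-\kappa|n|}z^{-n}+Q_b+b_0\ln z,\qquad b_\pm(z)=\pm(q-q^{-1})\sum_{n>0}b_{\pm n}z^{\mp n}\pm b_0\ln q ,\qquad \ln q=\hbar ,$$ and let $:\ :$ be the normal ordering. Let $X^{\pm,i}_n$ act as the coefficient of $z^{-n-1}$ in, with $k=\alpha$, $$X^{+,1}(z)=-\tfrac{1}{(q-q^{-1})z}:e^{-b^{12}(z;-1)}\big(e^{-c(qz;0)}-e^{-c(q^{-1}z;0)}\big):e^{\sqrt{-1}\pi(c_0+b^{12}_0)},$$ $$X^{+,2}(z)=-:e^{-b^{12}_+(qz)-b^{13}_+(qz)+b^{23}(qz;0)}:e^{\sqrt{-1}\pi(c_0+b^{12}_0+b^{13}_0+b^{23}_0)}+:e^{b^{12}(z;0)+b^{13}(z;0)+c(z;0)}:,$$ $$\begin{aligned}X^{-,1}(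z)=\tfrac{1}{(q-q^{-1})z}:\Big(&e^{a^1_+(q^{\frac{k+1}2}z)+b^{12}(q^{k+2}z;1)+b^{13}_+(q^{k+2}z)-b^{23}_+(q^{k+1}z)+c(q^{k+1}z;0)}\\&-e^{a^1_-(q^{-\frac{k+1}2}z)+b^{12}(q^{-k-2}z;1)+b^{13}_-(q^{-k-2}z)-b^{23}_-(q^{-k-1}z)+c(q^{-k-1}z;0)}\Big):e^{-\sqrt{-1}\pi(c_0+b^{12}_0)}\\&+q^{k+1}:e^{a^1_+(q^{\frac{k+1}2}z)-b^{13}(q^{k+1}z;0)+b^{23}(q^{k+1}z;-1)}:e^{\sqrt{-1}\pi(b^{13}_0+b^{23}_0)},\end{aligned}$$ $$\begin{aligned}X^{-,2}(z)=\tfrac{1}{(q-q^{-1})z}\Big(&q:\big(e^{a^2_+(q^{\frac{k+1}2}z)-b^{23}(q^{k+1}z;0)}-e^{a^2_-(q^{-\frac{k+1}2}z)-b^{23}(q^{-k-1}z;0)}\big):e^{-\sqrt{-1}\pi(c_0+b^{12}_0+b^{13}_0+b^{23}_0)}\\&-:e^{a^2_-(q^{-\frac{k+1}2}z)-b^{12}(q^{-k-1}z;1)-b^{13}(q^{-k-1}z;1)}\big(e^{-c(q^{-k}z;0)}-e^{-c(q^{-k-2}z;0)}\big):\Big).\end{aligned}$$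 Let $q^{\pm c/2}$ act as the scalar $q^{\pm\alpha/2}$, let $q^{\pm h_0^i}$ act through $h^1_0=a^1_0+2b^{12}_0+b^{13}_0-b^{23}_0$ and $h^2_0=a^2_0-b^{12}_0-b^{13}_0$, and let, for $m\ne0$, $$h^1_m=a^1_mq^{-\frac{|m|}2}+b^{12}_mq^{-(\frac k2+1)|m|}(q^{|m|}+q^{-|m|})+b^{13}_mq^{-(\frac k2+2)|m|}-b^{23}_mq^{-(\frac k2+1)|m|},$$ $$h^2_m=a^2_mq^{-\frac{|m|}2}-b^{12}_mq^{-(\frac k2+1)|m|}-b^{13}_mq^{-(\frac k2+1)|m|}.$$ Let $d$ act as $-N+\frac{1}{\alpha+1}\left(a^1_0a^2_0+(a^2_0)^2+a^1_0+3a^2_0\right)+\frac12\left((b^{12}_0)^2-b^{13}_0(b^{13}_0+1)-b^{23}_0(b^{23}_0+1)-(c_0)^2\right)$, where $N$ is the oscillator degree (each creation operator with index $-n$ has degree $n$). Finally let $\eta_n$, $\xi_n$ be the modes of $\eta(z)=\sum_n\eta_nz^{-n-1}=:e^{c(z;0)}:$ and $\xi(z)=\sum_n\xi_nz^{-n}=:e^{-c(z;0)}:$.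 **Proposition (Fock–Wakimoto module).** The restricted Fock space $$\mathcal F_{(\beta,\gamma)}:=\operatorname{Ker}\big(\eta_0|_{F_{(\beta,\gamma)}}\big)$$ equals $\eta_0\xi_0F_{(\beta,\gamma)}$, and it is a $U_q[\widehat{sl(2|1)}]$-module under the above action (called the Fock–Wakimoto module). That is, the above operators preserve $\mathcal F_{(\beta,\gamma)}$, and there is a unique representation of $U_q[\widehat{sl(2|1)}]$ on $\mathcal F_{(\beta,\gamma)}$ in which each generator acts by its operator. It is a module over the superalgebra: the parity operator $(-1)^{b^{13}_0+b^{23}_0}$ preserves $\mathcal F_{(\beta,\gamma)}$, where it anticommutes with the $X^{\pm,2}_n$ and commutes with all other generators. -/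

import Mathlib

open scoped BigOperators

noncomputable section

namespace QSl21

/-! ## `q`-numbers, Cartan matrix, formal exponentials -/

/-- `q ^ x = e ^ (x ħ)`, where `q = e ^ ħ`. -/
def qpow (ħ x : ℂ) : ℂ := Complex.exp (x * ħ)

/-- `[x]_q = (q ^ x - q ^ (-x)) / (q - q ^ (-1))`. -/
def qnum (ħ x : ℂ) : ℂ := (qpow ħ x - qpow ħ (-x)) / (qpow ħ 1 - qpow ħ (-1))

/-- `a_{ij}` for `i, j = 1, 2`; the index `0 : Fin 2` stands for `1`, and `1 : Fin 2` for `2`. -/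
def cartan : Fin 2 → Fin 2 → ℤ := ![![2, -1], ![-1, 0]]

/-- The sign in `X^{±,i}`, `q^{± h}`, `ψ^{±,i}`, and so on. -/
inductive Sgn
  | plus
  | minus

/-- `±1` as an integer. -/
def Sgn.val : Sgn → ℤ
  | .plus => 1
  | .minus => -1

/-- The coefficient of `w ^ m` in `exp (∑_{n ≥ 1} p n * w ^ n)`, in any `ℂ`-algebra. The powers
`k > m` do not contribute. -/
def expCoeff {A : Type*} [Ring A] [Algebra ℂ A] (p : ℕ+ → A) (m : ℕ) : A :=
  ∑ k ∈ Finset.range (m + 1), ((k.factorial : ℂ)⁻¹) •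
    PowerSeries.coeff m
      ((PowerSeries.mk fun n : ℕ => if hn : 0 < n then p ⟨n, hn⟩ else 0) ^ k)

/-- `[x, y]_ξ = x y - (-1)^{[x][y]} ξ y x` for elements `x`, `y` of parities `p`, `r`. -/
def qbracket {A : Type*} [Ring A] [Algebra ℂ A] (p r : ℕ) (ξ : ℂ) (x y : A) : A :=
  x * y - ((-1 : ℂ) ^ (p * r) * ξ) • (y * x)

/-! ## The quantum affine superalgebra `U_q[sl(2|1)^]` in Drinfeld's generators -/

/-- Drinfeld generators: `X^{±,i}_n` (`n ∈ ℤ`), `h^i_n` (`n ≠ 0`), `q^{± h^i_0}`, `q^{± c/2}`,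
`d`. -/
inductive Gen
  | X (s : Sgn) (i : Fin 2) (n : ℤ)
  | h (i : Fin 2) (n : ℤ) (hn : n ≠ 0)
  | K (i : Fin 2) (s : Sgn)
  | C (s : Sgn)
  | d

/-- The parity attached to the node `i`: even for `i = 1`, odd for `i = 2`. -/
def nodeParity (i : Fin 2) : ℕ := i.val

/-- The `ℤ/2`-degree of a generator: `X^{±,2}_n` is odd, all the others are even. -/
def Gen.parity : Gen → ℕ
  | .X _ i _ => nodeParity i
  | _ => 0

/-- Words in the generators. -/
abbrev Words : Type := FreeAlgebra ℂ Gen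

namespace Words

/-- `X^{s,i}_n`. -/
def X (s : Sgn) (i : Fin 2) (n : ℤ) : Words := FreeAlgebra.ι ℂ (Gen.X s i n)

/-- `h^i_n` for `n ≠ 0` (and `0` for `n = 0`, a value that is never used). -/
def h (i : Fin 2) (n : ℤ) : Words :=
  if hn : n ≠ 0 then FreeAlgebra.ι ℂ (Gen.h i n hn) else 0

/-- `q^{± h^i_0}`. -/
def K (i : Fin 2) (s : Sgn) : Words := FreeAlgebra.ι ℂ (Gen.K i s)

/-- `d`. -/
def d : Words := FreeAlgebra.ι ℂ Gen.d

/-- `q^{n c/2}` for `n ∈ ℤ`. -/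
def C (n : ℤ) : Words :=
  if 0 ≤ n then FreeAlgebra.ι ℂ (Gen.C .plus) ^ n.toNat
  else FreeAlgebra.ι ℂ (Gen.C .minus) ^ (-n).toNat

/-- `ψ^{s,i}_n`, defined by
`∑_n ψ^{±,i}_n z^{-n} = q^{± h^i_0} exp (± (q - q⁻¹) ∑_{n > 0} h^i_{± n} z^{∓ n})`. -/
def psi (ħ : ℂ) (s : Sgn) (i : Fin 2) (n : ℤ) : Words :=
  if 0 ≤ s.val * n then
    K i s * expCoeff
      (fun r : ℕ+ => ((s.val : ℂ) * (qpow ħ 1 - qpow ħ (-1))) • h i (s.val * (r : ℤ)))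
      (s.val * n).toNat
  else 0

/-- `[X^{s,1}_{n₁}, [X^{s,1}_{n₂}, X^{s,2}_m]_{q⁻¹}]_q`. -/
def serre (ħ : ℂ) (s : Sgn) (n₁ n₂ m : ℤ) : Words :=
  qbracket 0 1 (qpow ħ 1) (X s 0 n₁) (qbracket 0 1 (qpow ħ (-1)) (X s 0 n₂) (X s 1 m))

end Words

open Words in
/-- The defining relations. -/
inductive Rel (ħ : ℂ) : Words → Words → Prop
  | C_central (s : Sgn) (g : Gen) :
      Rel ħ (FreeAlgebra.ι ℂ (Gen.C s) * FreeAlgebra.ι ℂ g)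
        (FreeAlgebra.ι ℂ g * FreeAlgebra.ι ℂ (Gen.C s))
  | C_inv : Rel ħ (FreeAlgebra.ι ℂ (Gen.C .plus) * FreeAlgebra.ι ℂ (Gen.C .minus)) 1
  | K_inv (i : Fin 2) : Rel ħ (K i .plus * K i .minus) 1
  | K_inv' (i : Fin 2) : Rel ħ (K i .minus * K i .plus) 1
  | K_K (i j : Fin 2) (s t : Sgn) : Rel ħ (K i s * K j t) (K j t * K i s)
  | K_h (i j : Fin 2) (s : Sgn) (m : ℤ) (hm : m ≠ 0) : Rel ħ (K i s * h j m) (h j m * K i s)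
  | d_K (i : Fin 2) (s : Sgn) : Rel ħ (d * K i s) (K i s * d)
  | d_h (j : Fin 2) (m : ℤ) (hm : m ≠ 0) : Rel ħ (d * h j m - h j m * d) ((m : ℂ) • h j m)
  | d_X (s : Sgn) (j : Fin 2) (m : ℤ) : Rel ħ (d * X s j m - X s j m * d) ((m : ℂ) • X s j m)
  /-- `[h^i_m, h^j_n] = δ_{m+n,0} [a_{ij} m]_q [m c]_q / m`. -/
  | h_h (i j : Fin 2) (m n : ℤ) (hm : m ≠ 0) (hn : n ≠ 0) :
      Rel ħ (h i m * h j n - h j n * h i m)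
        (if m + n = 0 then
          (qnum ħ (cartan i j * m) / m) •
            ((qpow ħ 1 - qpow ħ (-1))⁻¹ • (C (2 * m) - C (-(2 * m))))
        else 0)
  | K_X (i : Fin 2) (s : Sgn) (j : Fin 2) (m : ℤ) :
      Rel ħ (K i .plus * X s j m * K i .minus) (qpow ħ (s.val * cartan i j) • X s j m)
  /-- `[h^i_m, X^{±,j}_n] = ± [a_{ij} m]_q / m * q^{∓ |m| c/2} X^{±,j}_{n+m}`. -/
  | h_X (i : Fin 2) (m : ℤ) (hm : m ≠ 0) (s : Sgn) (j : Fin 2) (n : ℤ) :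
      Rel ħ (h i m * X s j n - X s j n * h i m)
        ((s.val * (qnum ħ (cartan i j * m) / m)) • (C (-(s.val * |m|)) * X s j (n + m)))
  | X_X (i j : Fin 2) (m n : ℤ) :
      Rel ħ (qbracket (nodeParity i) (nodeParity j) 1 (X .plus i m) (X .minus j n))
        (if i = j then
          (qpow ħ 1 - qpow ħ (-1))⁻¹ •
            (C (m - n) * psi ħ .plus j (m + n) - C (-(m - n)) * psi ħ .minus j (m + n))
        else 0)
  | X2_X2 (s : Sgn) (m n : ℤ) : Rel ħ (qbracket 1 1 1 (X s 1 m) (X s 1 n)) 0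
  | exch (s : Sgn) (i j : Fin 2) (m n : ℤ) (hij : cartan i j ≠ 0) :
      Rel ħ
        (qbracket (nodeParity i) (nodeParity j) (qpow ħ (s.val * cartan i j))
            (X s i (m + 1)) (X s j n) +
          qbracket (nodeParity j) (nodeParity i) (qpow ħ (s.val * cartan i j))
            (X s j (n + 1)) (X s i m)) 0
  | serre_rel (s : Sgn) (n₁ n₂ m : ℤ) : Rel ħ (serre ħ s n₁ n₂ m + serre ħ s n₂ n₁ m) 0

/-- The algebra `U_q[sl(2|1)^]`, `q = e ^ ħ`. -/
abbrev Uq (ħ : ℂ) : Type := RingQuot (Rel ħ)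

/-- The image of a generator in `U_q[sl(2|1)^]`. -/
def Uq.gen (ħ : ℂ) (g : Gen) : Uq ħ := RingQuot.mkAlgHom ℂ (Rel ħ) (FreeAlgebra.ι ℂ g)

/-! ## The bosons and the Fock space -/

/-- The parameters: `q = e ^ ħ`, the level `k = α`, and the weight parameters `β`, `γ`. -/
structure Params where
  /-- `q = e ^ ħ` -/
  ħ : ℂ
  /-- the level -/
  α : ℂ
  /-- the parameter of the momentum of `a^1` -/
  β : ℂ
  /-- the parameter of the momentum of `a^2` -/
  γ : ℂ

/-- The bosons `b^{12}`, `b^{13}`, `b^{23}`, `c`, whose momenta vary in the Fock space. -/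
inductive Ghost
  | b12
  | b13
  | b23
  | c
  deriving DecidableEq

instance : Fintype Ghost where
  elems := {.b12, .b13, .b23, .c}
  complete g := by cases g <;> simp

/-- All six bosons `a^1`, `a^2`, `b^{12}`, `b^{13}`, `b^{23}`, `c`. -/
inductive Boson
  | a (i : Fin 2)
  | b (g : Ghost)
  deriving DecidableEq

instance : Fintype Boson where
  elems := {.a 0, .a 1, .b .b12, .b .b13, .b .b23, .b .c}
  complete B := by
    rcases B with i | g
    · fin_cases i <;> simp
    · cases g <;> simp

/-- `[g_0, Q_g]`: it is `-1` for `b^{12}`, and `1` for `b^{13}`, `b^{23}`, `c`. -/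
def Ghost.sign : Ghost → ℤ
  | .b12 => -1
  | _ => 1

/-- The number `[B_m, B'_{-m}]`, for `m ≠ 0`. -/
def comm (P : Params) (m : ℤ) : Boson → Boson → ℂ
  | .a i, .a j => qnum P.ħ (cartan i j * m) * qnum P.ħ ((P.α + 1) * m) / m
  | .b g, .b g' => if g = g' then g.sign * qnum P.ħ m ^ 2 / m else 0
  | _, _ => 0

/-- Polynomials in the creation operators: the variable `(B, n)` stands for `B_{-n}`, `n ≥ 1`. -/
abbrev Poly : Type := MvPolynomial (Boson × ℕ+) ℂ

/-- The direct sum of the Fock modules over the vectors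
`|m⟩ = exp (β/(α+1) Q_{a^1} + 2γ/(α+1) Q_{a^2} + ∑_g m_g Q_g) |0⟩`, `m ∈ ℤ^4`.
The element `Finsupp.single m f` is `f |m⟩`. -/
abbrev Fock : Type := (Ghost → ℤ) →₀ Poly

/-- The operator `f |m⟩ ↦ (T m f) |m + s⟩`. -/
def sectorwise (s : Ghost → ℤ) (T : (Ghost → ℤ) → Poly →ₗ[ℂ] Poly) : Module.End ℂ Fock :=
  Finsupp.lsum ℂ fun m => Finsupp.lsingle (m + s) ∘ₗ T m

/-- The operator that multiplies `f |m⟩` by the number `e m`. -/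
def diagonal (e : (Ghost → ℤ) → ℂ) : Module.End ℂ Fock :=
  sectorwise 0 fun m => e m • LinearMap.id

/-- The momenta `β/(α+1)` of `a^1` and `2γ/(α+1)` of `a^2`. -/
def aMomentum (P : Params) : Fin 2 → ℂ := ![P.β / (P.α + 1), 2 * P.γ / (P.α + 1)]

/-- The eigenvalue of the zero mode `B_0` on `|m⟩`; for `B = a^i` this uses
`[a^i_0, Q_{a^j}] = (α+1) a_{ij}`. -/
def zeroMode (P : Params) (m : Ghost → ℤ) : Boson → ℂ
  | .a i => ∑ j, (P.α + 1) * cartan i j * aMomentum P j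
  | .b g => g.sign * m g

/-- The oscillator `B_n`: `B_{-n}` (`n > 0`) multiplies by its variable, `B_n` (`n > 0`) is the
derivation with `B'_{-n} ↦ [B_n, B'_{-n}]`, and `B_0` is diagonal. -/
def osc (P : Params) (B : Boson) : ℤ → Module.End ℂ Fock
  | Int.ofNat 0 => diagonal fun m => zeroMode P m B
  | Int.ofNat (k + 1) => sectorwise 0 fun _ =>
      ∑ B' : Boson, comm P (k + 1) B B' • (MvPolynomial.pderiv (B', k.succPNat)).toLinearMap
  | Int.negSucc k => sectorwise 0 fun _ =>
      LinearMap.mulLeft ℂ (MvPolynomial.X (B, k.succPNat))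

/-! ## Normally ordered exponentials -/

/-- The formal field
`∑_{B, n ≥ 1} (cre B n * B_{-n} z^n + ann B n * B_n z^{-n}) + ∑_g charge g * (Q_g + g_0 ln z)
  + ∑_B const B * B_0 ln q`. -/
structure Field where
  /-- coefficients of `B_{-n} z^n` -/
  cre : Boson → ℕ+ → ℂ
  /-- coefficients of `B_n z^{-n}` -/
  ann : Boson → ℕ+ → ℂ
  /-- coefficients of `Q_g + g_0 ln z` -/
  charge : Ghost → ℤ
  /-- coefficients of `B_0 ln q` -/
  const : Boson → ℂ

instance : Add Field :=
  ⟨fun E F => ⟨E.cre + F.cre, E.ann + F.ann, E.charge + F.charge, E.const + F.const⟩⟩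

instance : Neg Field :=
  ⟨fun E => ⟨-E.cre, -E.ann, -E.charge, -E.const⟩⟩

instance : Sub Field := ⟨fun E F => E + -F⟩

/-- The field `g(q^x z; κ)`, where
`g(z; κ) = - ∑_{n ≠ 0} g_n / [n]_q * q^{-κ|n|} z^{-n} + Q_g + g_0 ln z`. -/
def full (ħ : ℂ) (g : Ghost) (x κ : ℂ) : Field where
  cre B n := if B = .b g then -(qpow ħ (-κ * n) / qnum ħ (-n)) * qpow ħ (x * n) else 0
  ann B n := if B = .b g then -(qpow ħ (-κ * n) / qnum ħ n) * qpow ħ (-x * n) else 0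
  charge := Pi.single g 1
  const B := if B = .b g then x else 0

/-- The field `B_+(q^x z)`, where `B_+(z) = (q - q⁻¹) ∑_{n > 0} B_n z^{-n} + B_0 ln q`. -/
def plus (ħ : ℂ) (B : Boson) (x : ℂ) : Field where
  cre _ _ := 0
  ann B' n := if B' = B then (qpow ħ 1 - qpow ħ (-1)) * qpow ħ (-x * n) else 0
  charge := 0
  const B' := if B' = B then 1 else 0

/-- The field `B_-(q^x z)`, where `B_-(z) = -(q - q⁻¹) ∑_{n > 0} B_{-n} z^n - B_0 ln q`. -/
def minus (ħ : ℂ) (B : Boson) (x : ℂ) : Field where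
  cre B' n := if B' = B then -(qpow ħ 1 - qpow ħ (-1)) * qpow ħ (x * n) else 0
  ann _ _ := 0
  charge := 0
  const B' := if B' = B then -1 else 0

/-- The coefficient of `z^j` in `exp (∑_{B, n ≥ 1} cre B n * B_{-n} z^n)`. -/
def creCoeff (E : Field) (j : ℤ) : Poly :=
  if 0 ≤ j then
    expCoeff (fun n : ℕ+ => ∑ B : Boson, E.cre B n • (MvPolynomial.X (B, n) : Poly)) j.toNat
  else 0

/-- The operator `exp (∑_{B, n ≥ 1} ann B n * B_n w^n)` on polynomials in the creation operators,
`w = z⁻¹`. Since the `B_n` are derivations that send each variable to a constant, this is the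
translation `B'_{-n} ↦ B'_{-n} + ∑_B ann B n * [B_n, B'_{-n}] * w^n`. -/
def annExp (P : Params) (E : Field) : Poly →ₐ[ℂ] Polynomial Poly :=
  MvPolynomial.aeval fun v : Boson × ℕ+ =>
    Polynomial.C (MvPolynomial.X v) +
      Polynomial.monomial (v.2 : ℕ)
        (MvPolynomial.C (∑ B : Boson, E.ann B v.2 * comm P (v.2 : ℤ) B v.1) : Poly)

/-- The integer `e` with `z^{∑_g charge g * g_0} |m⟩ = z^e |m⟩`. -/
def zExponent (E : Field) (m : Ghost → ℤ) : ℤ := ∑ g, E.charge g * (g.sign * m g)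

/-- The coefficient of `z^N` in `:exp E(z):`. The normal ordering puts the creation operators to
the left of the annihilation operators, and the `Q_g` to the left of the zero modes. -/
def expMode (P : Params) (E : Field) (N : ℤ) : Module.End ℂ Fock :=
  sectorwise E.charge fun m =>
    qpow P.ħ (∑ B, E.const B * zeroMode P m B) •
      (Polynomial.lsum fun r : ℕ =>
          LinearMap.mulLeft ℂ (creCoeff E (N - zExponent E m + r))) ∘ₗ
        (annExp P E).toLinearMap

/-- The operator `exp (√-1 π ∑_g ε g * g_0)`. -/
def phase (ε : Ghost → ℤ) : Module.End ℂ Fock :=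
  diagonal fun m => Complex.exp (Complex.I * Real.pi * ∑ g, (ε g * (g.sign * m g) : ℂ))

/-! ## The free boson realization at level `k = α` -/

/-- `c_0 + b^{12}_0`. -/
def phaseA : Ghost → ℤ
  | .c => 1
  | .b12 => 1
  | _ => 0

/-- `c_0 + b^{12}_0 + b^{13}_0 + b^{23}_0`. -/
def phaseB : Ghost → ℤ := fun _ => 1

/-- `b^{13}_0 + b^{23}_0`. -/
def phaseC : Ghost → ℤ
  | .b13 => 1
  | .b23 => 1
  | _ => 0

/-- `X^{±,i}_n`, the coefficient of `z^{-n-1}` in the current `X^{±,i}(z)`. A prefactor `1/z` of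
an exponential shifts the coefficient that is taken to that of `z^{-n}`. -/
def current (P : Params) : Sgn → Fin 2 → ℤ → Module.End ℂ Fock
  | .plus, 0, n =>
      -(qpow P.ħ 1 - qpow P.ħ (-1))⁻¹ •
        ((expMode P (-full P.ħ .b12 0 (-1) - full P.ħ .c 1 0) (-n) -
          expMode P (-full P.ħ .b12 0 (-1) - full P.ħ .c (-1) 0) (-n)) * phase phaseA)
  | .plus, 1, n =>
      -(expMode P (-plus P.ħ (.b .b12) 1 - plus P.ħ (.b .b13) 1 + full P.ħ .b23 1 0) (-n - 1) *
          phase phaseB) +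
        expMode P (full P.ħ .b12 0 0 + full P.ħ .b13 0 0 + full P.ħ .c 0 0) (-n - 1)
  | .minus, 0, n =>
      (qpow P.ħ 1 - qpow P.ħ (-1))⁻¹ •
        ((expMode P
            (plus P.ħ (.a 0) ((P.α + 1) / 2) + full P.ħ .b12 (P.α + 2) 1 +
              plus P.ħ (.b .b13) (P.α + 2) - plus P.ħ (.b .b23) (P.α + 1) +
              full P.ħ .c (P.α + 1) 0) (-n) -
          expMode P
            (minus P.ħ (.a 0) (-((P.α + 1) / 2)) + full P.ħ .b12 (-P.α - 2) 1 +
              minus P.ħ (.b .b13) (-P.α - 2) - minus P.ħ (.b .b23) (-P.α - 1) +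
              full P.ħ .c (-P.α - 1) 0) (-n)) * phase (-phaseA)) +
        qpow P.ħ (P.α + 1) •
          (expMode P
            (plus P.ħ (.a 0) ((P.α + 1) / 2) - full P.ħ .b13 (P.α + 1) 0 +
              full P.ħ .b23 (P.α + 1) (-1)) (-n - 1) * phase phaseC)
  | .minus, 1, n =>
      (qpow P.ħ 1 - qpow P.ħ (-1))⁻¹ •
        (qpow P.ħ 1 •
            ((expMode P (plus P.ħ (.a 1) ((P.α + 1) / 2) - full P.ħ .b23 (P.α + 1) 0) (-n) -
              expMode P
                (minus P.ħ (.a 1) (-((P.α + 1) / 2)) - full P.ħ .b23 (-P.α - 1) 0) (-n)) *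
              phase (-phaseB)) -
          (expMode P
              (minus P.ħ (.a 1) (-((P.α + 1) / 2)) - full P.ħ .b12 (-P.α - 1) 1 -
                full P.ħ .b13 (-P.α - 1) 1 - full P.ħ .c (-P.α) 0) (-n) -
            expMode P
              (minus P.ħ (.a 1) (-((P.α + 1) / 2)) - full P.ħ .b12 (-P.α - 1) 1 -
                full P.ħ .b13 (-P.α - 1) 1 - full P.ħ .c (-P.α - 2) 0) (-n)))

/-- `h^i_m` for `m ≠ 0`. -/
def hMode (P : Params) (i : Fin 2) (m : ℤ) : Module.End ℂ Fock :=
  let t : ℂ := (|m| : ℤ)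
  if i = 0 then
    qpow P.ħ (-(t / 2)) • osc P (.a 0) m +
      (qpow P.ħ (-(P.α / 2 + 1) * t) * (qpow P.ħ t + qpow P.ħ (-t))) • osc P (.b .b12) m +
      qpow P.ħ (-(P.α / 2 + 2) * t) • osc P (.b .b13) m -
      qpow P.ħ (-(P.α / 2 + 1) * t) • osc P (.b .b23) m
  else
    qpow P.ħ (-(t / 2)) • osc P (.a 1) m -
      qpow P.ħ (-(P.α / 2 + 1) * t) • osc P (.b .b12) m -
      qpow P.ħ (-(P.α / 2 + 1) * t) • osc P (.b .b13) m

/-- The eigenvalue on `|m⟩` of `h^1_0 = a^1_0 + 2 b^{12}_0 + b^{13}_0 - b^{23}_0`, respectively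
`h^2_0 = a^2_0 - b^{12}_0 - b^{13}_0`. -/
def hZero (P : Params) (m : Ghost → ℤ) (i : Fin 2) : ℂ :=
  if i = 0 then
    zeroMode P m (.a 0) + 2 * zeroMode P m (.b .b12) + zeroMode P m (.b .b13) -
      zeroMode P m (.b .b23)
  else
    zeroMode P m (.a 1) - zeroMode P m (.b .b12) - zeroMode P m (.b .b13)

/-- The eigenvalue on `|m⟩` of the zero mode part of `d`,
`(a^1_0 a^2_0 + (a^2_0)² + a^1_0 + 3 a^2_0) / (α+1)
  + ((b^{12}_0)² - b^{13}_0 (b^{13}_0 + 1) - b^{23}_0 (b^{23}_0 + 1) - (c_0)²) / 2`. -/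
def dZero (P : Params) (m : Ghost → ℤ) : ℂ :=
  (P.α + 1)⁻¹ *
      (zeroMode P m (.a 0) * zeroMode P m (.a 1) + zeroMode P m (.a 1) ^ 2 +
        zeroMode P m (.a 0) + 3 * zeroMode P m (.a 1)) +
    2⁻¹ *
      (zeroMode P m (.b .b12) ^ 2 - zeroMode P m (.b .b13) * (zeroMode P m (.b .b13) + 1) -
        zeroMode P m (.b .b23) * (zeroMode P m (.b .b23) + 1) - zeroMode P m (.b .c) ^ 2)

/-- The derivation operator `d`. Its oscillator part is the derivation with
`B_{-n} ↦ -n B_{-n}`; where no `[(α+1)n]_q` vanishes, this is the quadratic expression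
`∑_{n > 0} n² / ([n]_q [(α+1)n]_q) *
    (a^1_{-n} a^2_n + a^2_{-n} a^1_n + (q^n + q^{-n}) a^2_{-n} a^2_n)
  + ∑_{n > 0} n² / [n]_q² *
    (b^{12}_{-n} b^{12}_n - b^{13}_{-n} b^{13}_n - b^{23}_{-n} b^{23}_n - c_{-n} c_n)`. -/
def dOp (P : Params) : Module.End ℂ Fock :=
  sectorwise 0 fun m =>
    (MvPolynomial.mkDerivation ℂ fun v : Boson × ℕ+ =>
        -((v.2 : ℕ) : ℂ) • (MvPolynomial.X v : Poly)).toLinearMap +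
      dZero P m • LinearMap.id

/-- The operator that realizes a generator. -/
def realize (P : Params) : Gen → Module.End ℂ Fock
  | .X s i n => current P s i n
  | .h i n _ => hMode P i n
  | .K i s => diagonal fun m => qpow P.ħ (s.val * hZero P m i)
  | .C s => qpow P.ħ (s.val * (P.α / 2)) • 1
  | .d => dOp P

/-! ## The ghost system and the Fock-Wakimoto space -/

/-- `η_n`, where `η(z) = ∑ η_n z^{-n-1} = :e^{c(z;0)}:`. -/
def eta (P : Params) (n : ℤ) : Module.End ℂ Fock := expMode P (full P.ħ .c 0 0) (-n - 1)

/-- `ξ_n`, where `ξ(z) = ∑ ξ_n z^{-n} = :e^{-c(z;0)}:`. -/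
def xi (P : Params) (n : ℤ) : Module.End ℂ Fock := expMode P (-full P.ħ .c 0 0) (-n)

/-- The momenta that occur in `F_{(β,γ)}`: `(i+j, j, l, i+j)` with `i, j, l ∈ ℤ`. -/
def momenta : Set (Ghost → ℤ) :=
  {m | ∃ i j l : ℤ, m .b12 = i + j ∧ m .b13 = j ∧ m .b23 = l ∧ m .c = i + j}

/-- The Fock space `F_{(β,γ)}`. -/
def fockSpace : Submodule ℂ Fock := Finsupp.supported Poly ℂ momenta

/-- The restricted Fock space `𝓕_{(β,γ)}`: the kernel of `η_0` on `F_{(β,γ)}`. -/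
def fockWakimoto (P : Params) : Submodule ℂ Fock := fockSpace ⊓ LinearMap.ker (eta P 0)

/-- The parity operator: `(-1)^{b^{13}_0 + b^{23}_0}`. -/
def parityOp : Module.End ℂ Fock := diagonal fun m => (-1) ^ (m .b13 + m .b23)

end QSl21

end

/-! The proof is an operator product calculation. A product `:exp E(z): :exp F(w):` is a rational
function of `w / z`, expanded in powers of `w / z`, times `:exp (E(z) + F(w)):`
(`operatorProduct`). Multiplied by its denominator, the product in the other order gives the same
normally ordered product, so that the commutator of two exponentials with a simple pole at
`z = p w` is a delta function times the residue, which is again an exponential (`delta_formula`,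
`Local.commutator`). For the fields in the currents, all exponents of `q` are of the form
`(a + b α) / 2` with integers `a`, `b`. The poles, the zeros, the signs and the residues are hence
combinatorial data that do not depend on the parameters; they are encoded in `SymField` and
`Term`, and statements about them are decidable. As `q` is not a
root of unity, the denominators `[n]_q` and `q - q⁻¹` in the fields do not vanish.

The relations follow like this.

* The singular parts of `X^{+,i}(z) X^{-,j}(w)` cancel, except for two residues for `i = j`, which
  are the exponentials `ψ^{±,i}` (`current_commutator`). That the coefficients of these
  exponentials are the polynomials in `h^i_m` of Drinfeld's relations is `psiField_mode`.
* The quadratic relations say that `(z - ξ w) e(z) f(w) = (ξ z - w) f(w) e(z)`. They hold for all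
  pairs of terms, except for four terms of `X^{-,1}` and `X^{-,2}`, whose products have an extra
  pole; its residues cancel in the sum, and the corresponding linear factor can be divided out
  (`PolesCancel.qExchange`).
* For the Serre relation, let `S(z₁, z₂, w)` be the left-hand side. The quadratic relations show
  that `(z₁ - t w)(z₂ - t w)` and `(w - t z₁)(w - t z₂)` kill `S`. The mixed products
  `(w - t z₁)(z₂ - t w)` and `(w - t z₂)(z₁ - t w)` then turn `S` into distributions supported on
  a line, which vanish if they have a vanishing coefficient in every degree. This is the case if
  certain products of two of the fields have no poles (`Hexagon.mixed_eq_zero`). The four products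
  of linear factors generate the unit ideal, so that `S = 0` (`serre_of_wheelBounded`). The
  currents are split into groups of terms to which this applies (`serre_plus`, `serre_minus`).
* The commutators with `h^i_m` and `d` are those of a Heisenberg algebra and of a degree operator
  with exponentials (`hMode_commutator_current`, `dOp_current`).

Finally, `η_0` commutes or anticommutes with the currents, since the delta functions in the
commutators with `η(z)` have residues that cancel once their positions do not matter, that is, for
the zero mode (`eta_current`). So the kernel of `η_0` is stable, and it equals the image of
`η_0 ξ_0` since `η_0 ξ_0 + ξ_0 η_0 = 1` and `η_0 ^ 2 = 0` (`fockWakimoto_eq`). The momenta and the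
parity are controlled by the charges of the terms (`diagonal_realize`). -/

open scoped BigOperators

noncomputable section

set_option linter.unusedSectionVars false

namespace QSl21

/-! ### Exponentials of power series without constant term -/

section ExpSeries

open PowerSeries

/-- The power series `∑_{n ≥ 1} p n * X ^ n`. -/
def posSeries {A : Type*} [Ring A] (p : ℕ+ → A) : PowerSeries A :=
  PowerSeries.mk fun n : ℕ => if hn : 0 < n then p ⟨n, hn⟩ else 0

theorem coeff_posSeries_succ {A : Type*} [Ring A] (p : ℕ+ → A) (n : ℕ) :
    coeff (n + 1) (posSeries p) = p n.succPNat := by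
  simp [posSeries, Nat.succPNat]

theorem constantCoeff_posSeries {A : Type*} [Ring A] (p : ℕ+ → A) :
    constantCoeff (posSeries p) = 0 := by
  rw [← coeff_zero_eq_constantCoeff_apply]; simp [posSeries]

theorem expCoeff_map {A B : Type*} [Ring A] [Algebra ℂ A] [Ring B] [Algebra ℂ B]
    (φ : A →ₐ[ℂ] B) (p : ℕ+ → A) (m : ℕ) :
    φ (expCoeff p m) = expCoeff (fun n => φ (p n)) m := by
  have h : (posSeries fun n => φ (p n)) = PowerSeries.map (φ : A →+* B) (posSeries p) := by
    ext n
    simp only [posSeries, coeff_map, coeff_mk]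
    split_ifs <;> simp
  change φ (∑ k ∈ Finset.range (m + 1), ((k.factorial : ℂ)⁻¹) • coeff m (posSeries p ^ k)) =
    ∑ k ∈ Finset.range (m + 1), ((k.factorial : ℂ)⁻¹) •
      coeff m ((posSeries fun n => φ (p n)) ^ k)
  simp only [h, ← map_pow, coeff_map, map_sum, map_smul]
  rfl

section Comm

variable {A : Type*} [CommRing A]

theorem coeff_posSeries_pow_of_lt (p : ℕ+ → A) {m k : ℕ} (h : m < k) :
    coeff m (posSeries p ^ k) = 0 := by
  have : (X : PowerSeries A) ^ k ∣ posSeries p ^ k :=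
    pow_dvd_pow_of_dvd (X_dvd_iff.2 (constantCoeff_posSeries p)) k
  exact (X_pow_dvd_iff.1 this) m h

theorem posSeries_add (p r : ℕ+ → A) : posSeries (p + r) = posSeries p + posSeries r := by
  ext n
  simp only [posSeries, coeff_mk, map_add]
  split_ifs
  · rfl
  · simp

variable [Algebra ℂ A]

/-- The truncated exponential series has the right coefficients once it is long enough. -/
theorem expCoeff_eq_coeff (p : ℕ+ → A) {m K : ℕ} (h : m < K) :
    expCoeff p m =
      coeff m (∑ k ∈ Finset.range K, ((k.factorial : ℂ)⁻¹) • posSeries p ^ k) := by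
  rw [map_sum]
  change ∑ k ∈ Finset.range (m + 1), ((k.factorial : ℂ)⁻¹) • coeff m (posSeries p ^ k) = _
  refine Finset.sum_subset (Finset.range_mono h) fun k _ hk => ?_
  rw [coeff_posSeries_pow_of_lt p (by simpa using hk), smul_zero]

theorem derivative_truncExp (f : PowerSeries A) (K : ℕ) :
    d⁄dX A (∑ k ∈ Finset.range (K + 1), ((k.factorial : ℂ)⁻¹) • f ^ k) =
      d⁄dX A f * ∑ k ∈ Finset.range K, ((k.factorial : ℂ)⁻¹) • f ^ k := by
  have key : ∀ (c : ℂ) (g : PowerSeries A), d⁄dX A (c • g) = c • d⁄dX A g := fun c g => by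
    rw [← algebraMap_smul A c g, Derivation.map_smul, algebraMap_smul]
  rw [Finset.sum_range_succ']
  simp only [map_add, map_sum, key, Finset.mul_sum, pow_zero, Derivation.map_one_eq_zero,
    smul_zero, add_zero]
  refine Finset.sum_congr rfl fun k _ => ?_
  rw [Derivation.leibniz_pow, Nat.add_sub_cancel, Nat.factorial_succ]
  have : ((k + 1 : ℕ) : ℂ) ≠ 0 := Nat.cast_ne_zero.2 (Nat.succ_ne_zero k)
  rw [← Nat.cast_smul_eq_nsmul ℂ, smul_smul, smul_eq_mul, mul_comm (f ^ k), mul_smul_comm]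
  congr 1
  push_cast at this ⊢
  field_simp

/-- The series `exp (∑_{n ≥ 1} p n * X ^ n)`. -/
def expSeries (p : ℕ+ → A) : PowerSeries A := PowerSeries.mk (expCoeff p)

theorem expCoeff_zero {B : Type*} [Ring B] [Algebra ℂ B] (p : ℕ+ → B) : expCoeff p 0 = 1 := by
  simp [expCoeff]

theorem derivative_expSeries (p : ℕ+ → A) :
    d⁄dX A (expSeries p) = d⁄dX A (posSeries p) * expSeries p := by
  ext m
  rw [coeff_derivative, expSeries, coeff_mk, expCoeff_eq_coeff p (Nat.lt_succ_self (m + 1)),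
    ← coeff_derivative, derivative_truncExp, coeff_mul, coeff_mul]
  refine Finset.sum_congr rfl fun ij hij => ?_
  rw [coeff_mk, expCoeff_eq_coeff p (K := m + 1)]
  have := Finset.HasAntidiagonal.mem_antidiagonal.1 hij
  omega

/-- A power series over a `ℂ`-algebra is determined by its constant coefficient and its logarithmic
derivative. -/
theorem eq_of_derivative_eq_mul {g G H : PowerSeries A} (h0 : constantCoeff G = constantCoeff H)
    (hG : d⁄dX A G = g * G) (hH : d⁄dX A H = g * H) : G = H := by
  ext m
  induction m using Nat.strong_induction_on with
  | _ m ih =>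
    rcases m with _ | m
    · simpa using h0
    · have e1 := congrArg (coeff m) hG
      have e2 := congrArg (coeff m) hH
      rw [coeff_derivative, coeff_mul] at e1 e2
      have e3 : coeff (m + 1) G * ((m : A) + 1) = coeff (m + 1) H * ((m : A) + 1) := by
        rw [e1, e2]
        refine Finset.sum_congr rfl fun ij hij => ?_
        rw [ih ij.2 (by have := Finset.HasAntidiagonal.mem_antidiagonal.1 hij; omega)]
      have hm : IsUnit ((m : A) + 1) := by
        have h1 : IsUnit ((m : ℂ) + 1) :=
          isUnit_iff_ne_zero.2 (by exact_mod_cast Nat.succ_ne_zero m)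
        simpa using h1.map (algebraMap ℂ A)
      exact hm.mul_right_cancel e3

theorem constantCoeff_expSeries (p : ℕ+ → A) : constantCoeff (expSeries p) = 1 := by
  rw [← coeff_zero_eq_constantCoeff_apply, expSeries, coeff_mk, expCoeff_zero]

theorem expSeries_add (p r : ℕ+ → A) : expSeries (p + r) = expSeries p * expSeries r := by
  refine eq_of_derivative_eq_mul (g := d⁄dX A (posSeries p) + d⁄dX A (posSeries r)) ?_ ?_ ?_
  · simp [constantCoeff_expSeries]
  · rw [derivative_expSeries, posSeries_add, map_add]
  · rw [Derivation.leibniz, derivative_expSeries, derivative_expSeries]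
    simp only [smul_eq_mul]; ring

theorem expSeries_zero : expSeries (0 : ℕ+ → A) = 1 := by
  refine eq_of_derivative_eq_mul (g := 0) ?_ ?_ ?_
  · simp [constantCoeff_expSeries]
  · rw [derivative_expSeries]
    have : posSeries (0 : ℕ+ → A) = 0 := by
      ext n
      simp only [posSeries, coeff_mk, map_zero]
      split_ifs <;> rfl
    rw [this, map_zero]
  · simp

theorem expCoeff_add (p r : ℕ+ → A) (m : ℕ) :
    expCoeff (p + r) m =
      ∑ ij ∈ Finset.HasAntidiagonal.antidiagonal m, expCoeff p ij.1 * expCoeff r ij.2 := by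
  have := congrArg (coeff m) (expSeries_add p r)
  rw [coeff_mul] at this
  simpa only [expSeries, coeff_mk] using this

/-- Rescaling the variable. -/
theorem expCoeff_scale (y : A) (p : ℕ+ → A) (m : ℕ) :
    expCoeff (fun n => y ^ (n : ℕ) * p n) m = y ^ m * expCoeff p m := by
  have h : posSeries (fun n => y ^ (n : ℕ) * p n) = rescale y (posSeries p) := by
    ext n
    simp only [posSeries, coeff_mk, coeff_rescale]
    split_ifs <;> simp
  change ∑ k ∈ Finset.range (m + 1), ((k.factorial : ℂ)⁻¹) •
      coeff m (posSeries (fun n => y ^ (n : ℕ) * p n) ^ k) =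
    y ^ m * ∑ k ∈ Finset.range (m + 1), ((k.factorial : ℂ)⁻¹) • coeff m (posSeries p ^ k)
  simp only [h, ← map_pow, coeff_rescale, Finset.mul_sum, mul_smul_comm]

/-- `exp (- ∑ x ^ n / n * X ^ n) = 1 - x * X`. -/
theorem expSeries_neg_log (x : ℂ) :
    expSeries (fun n : ℕ+ => -(x ^ (n : ℕ) / (n : ℕ))) = 1 - PowerSeries.C x * X := by
  refine eq_of_derivative_eq_mul
    (g := d⁄dX ℂ (posSeries fun n : ℕ+ => -(x ^ (n : ℕ) / (n : ℕ)))) ?_ ?_ ?_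
  · simp [constantCoeff_expSeries]
  · rw [derivative_expSeries]
  · have key : d⁄dX ℂ (posSeries fun n : ℕ+ => -(x ^ (n : ℕ) / (n : ℕ))) =
        PowerSeries.mk fun n => -x ^ (n + 1) := by
      ext n
      rw [coeff_derivative, coeff_posSeries_succ, coeff_mk]
      have : ((n : ℂ) + 1) ≠ 0 := by exact_mod_cast Nat.succ_ne_zero n
      simp only [Nat.succPNat_coe, Nat.succ_eq_add_one]
      push_cast
      field_simp
    rw [key]
    ext n
    rcases n with _ | n
    · simp [mul_sub, ← mul_assoc]
    · rw [mul_sub, mul_one, mul_comm (PowerSeries.C x), ← mul_assoc]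
      simp [pow_succ, coeff_mul_C, coeff_succ_mul_X]

end Comm

open scoped IsMulCommutative in
/-- The recursion `(m + 1) e_{m+1} = ∑ r (r + 1) p_{r+1} e_{m-r}` for the coefficients of the
exponential, for commuting elements of a noncommutative algebra. -/
theorem expCoeff_succ {A : Type*} [Ring A] [Algebra ℂ A] (p : ℕ+ → A)
    (hp : ∀ i j, Commute (p i) (p j)) (m : ℕ) :
    ((m : ℂ) + 1) • expCoeff p (m + 1) =
      ∑ ij ∈ Finset.HasAntidiagonal.antidiagonal m,
        ((ij.1 : ℂ) + 1) • (p ij.1.succPNat * expCoeff p ij.2) := by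
  let S := Algebra.adjoin ℂ (Set.range p)
  have : IsMulCommutative S := Algebra.isMulCommutative_adjoin ℂ (by
    rintro _ ⟨i, rfl⟩ _ ⟨j, rfl⟩; exact hp i j)
  let p' : ℕ+ → S := fun i => ⟨p i, Algebra.subset_adjoin ⟨i, rfl⟩⟩
  have hval : ∀ m, expCoeff p m = S.val (expCoeff p' m) := fun m => (expCoeff_map S.val p' m).symm
  have h := congrArg (coeff m) (derivative_expSeries p')
  rw [coeff_derivative, coeff_mul, expSeries, coeff_mk] at h
  have h2 := congrArg S.val h
  rw [hval]
  rw [map_mul, map_sum] at h2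
  have e : ((m : ℂ) + 1) • S.val (expCoeff p' (m + 1)) =
      S.val (expCoeff p' (m + 1)) * S.val ((m : S) + 1) := by
    rw [map_add, map_natCast, map_one, Algebra.smul_def, map_add, map_natCast, map_one]
    exact (((Nat.cast_commute m _).add_left (Commute.one_left _))).eq
  rw [e, h2]
  refine Finset.sum_congr rfl fun ij _ => ?_
  rw [map_mul, coeff_derivative, coeff_posSeries_succ, coeff_mk, map_mul, map_add, map_natCast,
    map_one, ← hval, Algebra.smul_def, map_add, map_natCast, map_one]
  have : S.val (p' ij.1.succPNat) = p ij.1.succPNat := rfl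
  rw [this, ← mul_assoc]
  congr 1
  exact ((Nat.cast_commute ij.1 _).add_left (Commute.one_left _)).eq.symm

end ExpSeries

end QSl21

namespace QSl21

/-! ### The group of fields and the contraction pairing -/

theorem Field.ext' {E F : Field} (h1 : E.cre = F.cre) (h2 : E.ann = F.ann)
    (h3 : E.charge = F.charge) (h4 : E.const = F.const) : E = F := by
  cases E; cases F; simp_all

instance : Zero Field := ⟨⟨0, 0, 0, 0⟩⟩

@[simp] theorem Field.add_cre (E F : Field) : (E + F).cre = E.cre + F.cre := rfl
@[simp] theorem Field.add_ann (E F : Field) : (E + F).ann = E.ann + F.ann := rfl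
@[simp] theorem Field.add_charge (E F : Field) : (E + F).charge = E.charge + F.charge := rfl
@[simp] theorem Field.add_const (E F : Field) : (E + F).const = E.const + F.const := rfl
@[simp] theorem Field.neg_cre (E : Field) : (-E).cre = -E.cre := rfl
@[simp] theorem Field.neg_ann (E : Field) : (-E).ann = -E.ann := rfl
@[simp] theorem Field.neg_charge (E : Field) : (-E).charge = -E.charge := rfl
@[simp] theorem Field.neg_const (E : Field) : (-E).const = -E.const := rfl

instance : AddCommGroup Field where
  add_assoc E F G := Field.ext' (add_assoc ..) (add_assoc ..) (add_assoc ..) (add_assoc ..)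
  zero_add E := Field.ext' (zero_add _) (zero_add _) (zero_add _) (zero_add _)
  add_zero E := Field.ext' (add_zero _) (add_zero _) (add_zero _) (add_zero _)
  add_comm E F := Field.ext' (add_comm ..) (add_comm ..) (add_comm ..) (add_comm ..)
  neg_add_cancel E := Field.ext' (neg_add_cancel _) (neg_add_cancel _) (neg_add_cancel _)
    (neg_add_cancel _)
  sub_eq_add_neg _ _ := rfl
  nsmul := nsmulRec
  zsmul := zsmulRec

@[simp] theorem Field.sub_cre (E F : Field) : (E - F).cre = E.cre - F.cre :=
  (sub_eq_add_neg _ _).symm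
@[simp] theorem Field.sub_ann (E F : Field) : (E - F).ann = E.ann - F.ann :=
  (sub_eq_add_neg _ _).symm
@[simp] theorem Field.sub_const (E F : Field) : (E - F).const = E.const - F.const :=
  (sub_eq_add_neg _ _).symm

/-- The amount by which the annihilation part of `:exp E(z):` translates the variable `v`. -/
def shiftCoeff (P : Params) (E : Field) (v : Boson × ℕ+) : ℂ :=
  ∑ B : Boson, E.ann B v.2 * comm P (v.2 : ℤ) B v.1

/-- The contraction of `E(z)` and `F(w)`: the coefficient of `(w / z) ^ n` in the commutator of the
annihilation part of `E(z)` with the creation part of `F(w)`. -/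
def ctr (P : Params) (E F : Field) (n : ℕ+) : ℂ :=
  ∑ B : Boson, F.cre B n * shiftCoeff P E (B, n)

theorem shiftCoeff_add (P : Params) (E F : Field) (v : Boson × ℕ+) :
    shiftCoeff P (E + F) v = shiftCoeff P E v + shiftCoeff P F v := by
  simp [shiftCoeff, add_mul, Finset.sum_add_distrib]

/-! ### Normally ordered exponentials within one sector -/

open Polynomial in
theorem annExp_X (P : Params) (E : Field) (v : Boson × ℕ+) :
    annExp P E (MvPolynomial.X v) =
      C (MvPolynomial.X v) + monomial (v.2 : ℕ) (MvPolynomial.C (shiftCoeff P E v)) := by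
  simp [annExp, shiftCoeff]

theorem creCoeff_neg (E : Field) {j : ℤ} (hj : j < 0) : creCoeff E j = 0 :=
  if_neg (not_le.2 hj)

theorem creCoeff_natCast (E : Field) (m : ℕ) :
    creCoeff E m =
      expCoeff (fun n : ℕ+ => ∑ B : Boson, E.cre B n • (MvPolynomial.X (B, n) : Poly)) m := by
  simp [creCoeff]

open Polynomial in
/-- Moving annihilation operators through creation operators produces the exponential of the
contraction. -/
theorem annExp_creCoeff (P : Params) (E F : Field) (j : ℤ) (K : ℕ) (hK : j < K) :
    annExp P E (creCoeff F j) =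
      ∑ k ∈ Finset.range K, monomial k (expCoeff (ctr P E F) k • creCoeff F (j - k)) := by
  rcases lt_or_ge j 0 with hj | hj
  · rw [creCoeff_neg F hj, map_zero]
    refine (Finset.sum_eq_zero fun k _ => ?_).symm
    rw [creCoeff_neg F (by omega), smul_zero, map_zero]
  obtain ⟨m, rfl⟩ := Int.eq_ofNat_of_zero_le hj
  have e : (fun n : ℕ+ => annExp P E (∑ B : Boson, F.cre B n • (MvPolynomial.X (B, n) : Poly))) =
      (fun n : ℕ+ => (X : Poly[X]) ^ (n : ℕ) * Algebra.ofId ℂ Poly[X] (ctr P E F n)) +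
      fun n : ℕ+ => CAlgHom (R := ℂ) (∑ B : Boson, F.cre B n • (MvPolynomial.X (B, n) : Poly)) := by
    ext1 n
    simp only [Pi.add_apply, map_sum, map_smul, annExp_X, smul_add, Finset.sum_add_distrib]
    rw [add_comm]
    congr 1
    simp only [ctr, map_sum, Finset.mul_sum]
    refine Finset.sum_congr rfl fun B _ => ?_
    rw [Algebra.ofId_apply, mul_comm (X ^ (n : ℕ)), ← Algebra.smul_def, mul_smul,
      ← C_mul_X_pow_eq_monomial]
    congr 1
    rw [Algebra.smul_def (shiftCoeff P E (B, n))]; rfl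
  rw [creCoeff_natCast, expCoeff_map, e, expCoeff_add,
    Finset.Nat.sum_antidiagonal_eq_sum_range_succ_mk]
  have hmK : m + 1 ≤ K := by exact_mod_cast hK
  rw [← Finset.sum_subset (Finset.range_mono hmK) fun k _ hk => ?_]
  · refine Finset.sum_congr rfl fun k hk => ?_
    have hk' : k ≤ m := by simpa [Nat.lt_succ_iff] using hk
    rw [expCoeff_scale, ← expCoeff_map, ← expCoeff_map, ← Nat.cast_sub hk', creCoeff_natCast,
      mul_assoc, Algebra.ofId_apply, ← Algebra.smul_def, mul_smul_comm, CAlgHom_apply,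
      mul_comm, C_mul_X_pow_eq_monomial, smul_monomial]
  · have hk' : m < k := by simpa using hk
    rw [creCoeff_neg F (by omega), smul_zero, map_zero]

/-- The coefficient of `z ^ N` in `:exp E(z):` on polynomials, without the zero modes. -/
def polyMode (P : Params) (E : Field) (N : ℤ) : Poly →ₗ[ℂ] Poly :=
  (Polynomial.lsum fun r : ℕ => LinearMap.mulLeft ℂ (creCoeff E (N + r))) ∘ₗ
    (annExp P E).toLinearMap

/-- The coefficient of `z ^ N * w ^ M` in `:exp (E(z) + F(w)):` on polynomials, without the zero
modes. -/
def polyMode₂ (P : Params) (E F : Field) (N M : ℤ) : Poly →ₗ[ℂ] Poly :=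
  (Polynomial.lsum fun s : ℕ =>
      LinearMap.mulLeft ℂ (creCoeff F (M + s)) ∘ₗ polyMode P E N) ∘ₗ
    (annExp P F).toLinearMap

theorem lsum_eq_sum_range {R V W : Type*} [CommSemiring R] [Semiring V] [Module R V]
    [AddCommMonoid W] [Module R W] (L : ℕ → V →ₗ[R] W) (p : Polynomial V) {D : ℕ}
    (hD : p.natDegree < D) :
    Polynomial.lsum L p = ∑ r ∈ Finset.range D, L r (p.coeff r) := by
  rw [Polynomial.lsum_apply, Polynomial.sum_over_range' _ _ _ hD]
  simp

theorem polyMode_eq_sum (P : Params) (E : Field) (N : ℤ) (f : Poly) {D : ℕ}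
    (hD : (annExp P E f).natDegree < D) :
    polyMode P E N f =
      ∑ r ∈ Finset.range D, creCoeff E (N + r) * (annExp P E f).coeff r := by
  simp only [polyMode, LinearMap.comp_apply]
  exact lsum_eq_sum_range _ _ hD

theorem polyMode₂_eq_sum (P : Params) (E F : Field) (N M : ℤ) (f : Poly) {D : ℕ}
    (hD : (annExp P F f).natDegree < D) :
    polyMode₂ P E F N M f =
      ∑ s ∈ Finset.range D, creCoeff F (M + s) * polyMode P E N ((annExp P F f).coeff s) := by
  simp only [polyMode₂, LinearMap.comp_apply]
  exact lsum_eq_sum_range _ _ hD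

theorem polyMode_eq_zero (P : Params) (E : Field) (N : ℤ) (f : Poly)
    (h : N + (annExp P E f).natDegree < 0) : polyMode P E N f = 0 := by
  rw [polyMode_eq_sum P E N f (Nat.lt_succ_self _)]
  refine Finset.sum_eq_zero fun r hr => ?_
  have := Finset.mem_range.1 hr
  rw [creCoeff_neg E (by omega), zero_mul]

theorem polyMode₂_eq_zero_right (P : Params) (E F : Field) (N M : ℤ) (f : Poly)
    (h : M + (annExp P F f).natDegree < 0) : polyMode₂ P E F N M f = 0 := by
  rw [polyMode₂_eq_sum P E F N M f (Nat.lt_succ_self _)]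
  refine Finset.sum_eq_zero fun r hr => ?_
  have := Finset.mem_range.1 hr
  rw [creCoeff_neg F (by omega), zero_mul]

open Polynomial in
theorem lsum_creCoeff_monomial_mul (c : ℤ → Poly) (N : ℤ) (k : ℕ) (g : Poly) (p : Poly[X]) :
    Polynomial.lsum (fun r : ℕ => LinearMap.mulLeft ℂ (c (N + r))) (monomial k g * p) =
      g * Polynomial.lsum (fun r : ℕ => LinearMap.mulLeft ℂ (c (N + k + r))) p := by
  induction p using Polynomial.induction_on' with
  | add p q hp hq => rw [mul_add, map_add, map_add, hp, hq, mul_add]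
  | monomial n a =>
    rw [monomial_mul_monomial]
    simp only [lsum_apply]
    rw [sum_monomial_index _ _ (by simp), sum_monomial_index _ _ (by simp)]
    simp only [LinearMap.mulLeft_apply]
    rw [show N + ((k + n : ℕ) : ℤ) = N + k + n by push_cast; ring]
    ring

/-- The operator product of two normally ordered exponentials on polynomials: the product is the
exponential of the contraction, expanded in powers of `w / z`, times the normally ordered
product. -/
theorem polyMode_polyMode (P : Params) (E F : Field) (N M : ℤ) (f : Poly) (K : ℕ)
    (hK : M + (annExp P F f).natDegree < K) :
    polyMode P E N (polyMode P F M f) =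
      ∑ k ∈ Finset.range K, expCoeff (ctr P E F) k • polyMode₂ P E F (N + k) (M - k) f := by
  simp only [polyMode₂_eq_sum P E F _ _ f (Nat.lt_succ_self _), Finset.smul_sum]
  rw [Finset.sum_comm, polyMode_eq_sum P F M f (Nat.lt_succ_self _), map_sum]
  refine Finset.sum_congr rfl fun s hs => ?_
  have hs' := Finset.mem_range.1 hs
  simp only [polyMode, LinearMap.comp_apply, AlgHom.toLinearMap_apply, map_mul]
  rw [annExp_creCoeff P E F (M + s) K (by omega), Finset.sum_mul, map_sum]
  refine Finset.sum_congr rfl fun k _ => ?_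
  rw [lsum_creCoeff_monomial_mul, smul_mul_assoc, show M + (s : ℤ) - k = M - k + s by ring]

open Polynomial in
/-- The product of the annihilation parts of two fields is symmetric. -/
theorem coeff_annExp_comm (P : Params) (E F : Field) (r s : ℕ) (f : Poly) :
    (annExp P E ((annExp P F f).coeff s)).coeff r =
      (annExp P F ((annExp P E f).coeff r)).coeff s := by
  induction f using MvPolynomial.induction_on generalizing r s with
  | C a =>
    have h (G : Field) : annExp P G (MvPolynomial.C a) = C (MvPolynomial.C a) := by
      rw [← MvPolynomial.algebraMap_eq, AlgHom.commutes]; rfl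
    rw [h, h, coeff_C, coeff_C]
    split_ifs <;> simp_all [coeff_C]
  | add p q hp hq => simp only [map_add, coeff_add, hp, hq]
  | mul_X p v hp =>
    have key (G : Field) (t : ℕ) (g : Poly) : (annExp P G (g * MvPolynomial.X v)).coeff t =
        (annExp P G g).coeff t * MvPolynomial.X v +
          if (v.2 : ℕ) ≤ t then
            (annExp P G g).coeff (t - v.2) * MvPolynomial.C (shiftCoeff P G v) else 0 := by
      rw [map_mul, annExp_X, mul_add, coeff_add, coeff_mul_C, ← C_mul_X_pow_eq_monomial,
        ← mul_assoc, coeff_mul_X_pow', coeff_mul_C]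
    have key2 (G : Field) (t : ℕ) (g : Poly) (c : ℂ) : (annExp P G (g * MvPolynomial.C c)).coeff t =
        (annExp P G g).coeff t * MvPolynomial.C c := by
      rw [map_mul, ← MvPolynomial.algebraMap_eq, AlgHom.commutes]
      exact coeff_mul_C _ _ _
    have key3 (G : Field) (t : ℕ) (b : Prop) [Decidable b] (g : Poly) :
        (annExp P G (if b then g else 0)).coeff t = if b then (annExp P G g).coeff t else 0 := by
      split_ifs <;> simp
    simp only [key, map_add, coeff_add, key2, key3, hp]
    split_ifs <;> ring

theorem annExp_natDegree_bound (P : Params) (E F : Field) (f : Poly) :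
    ∃ D : ℕ, ∀ s, (annExp P E ((annExp P F f).coeff s)).natDegree < D := by
  refine ⟨(Finset.range ((annExp P F f).natDegree + 1)).sup
    (fun s => (annExp P E ((annExp P F f).coeff s)).natDegree) + 1, fun s => ?_⟩
  rw [Nat.lt_succ_iff]
  by_cases hs : s ∈ Finset.range ((annExp P F f).natDegree + 1)
  · exact Finset.le_sup (f := fun s => (annExp P E ((annExp P F f).coeff s)).natDegree) hs
  · rw [Polynomial.coeff_eq_zero_of_natDegree_lt (by simpa using hs)]
    simp

/-- The normally ordered product as a double sum, over any large enough range. -/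
theorem polyMode₂_eq_sum_sum (P : Params) (E F : Field) (f : Poly) :
    ∃ D₀ : ℕ, ∀ D ≥ D₀, ∀ N M : ℤ, polyMode₂ P E F N M f =
      ∑ s ∈ Finset.range D, ∑ r ∈ Finset.range D, creCoeff F (M + s) * (creCoeff E (N + r) *
        (annExp P E ((annExp P F f).coeff s)).coeff r) := by
  obtain ⟨D₁, hD₁⟩ := annExp_natDegree_bound P E F f
  refine ⟨max D₁ ((annExp P F f).natDegree + 1), fun D hD N M => ?_⟩
  rw [polyMode₂_eq_sum P E F N M f (D := D) (by omega)]
  refine Finset.sum_congr rfl fun s _ => ?_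
  rw [polyMode_eq_sum P E N _ (lt_of_lt_of_le (hD₁ s) ((le_max_left _ _).trans hD)),
    Finset.mul_sum]

theorem polyMode₂_comm (P : Params) (E F : Field) (N M : ℤ) :
    polyMode₂ P E F N M = polyMode₂ P F E M N := by
  refine LinearMap.ext fun f => ?_
  obtain ⟨D₁, h₁⟩ := polyMode₂_eq_sum_sum P E F f
  obtain ⟨D₂, h₂⟩ := polyMode₂_eq_sum_sum P F E f
  rw [h₁ (max D₁ D₂) (le_max_left _ _), h₂ (max D₁ D₂) (le_max_right _ _), Finset.sum_comm]
  refine Finset.sum_congr rfl fun r _ => Finset.sum_congr rfl fun s _ => ?_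
  rw [coeff_annExp_comm P E F]
  ring

open Polynomial in
theorem annExp_add (P : Params) (E F : Field) (f : Poly) {D : ℕ}
    (hD : (annExp P F f).natDegree < D) :
    annExp P (E + F) f =
      ∑ s ∈ Finset.range D, monomial s 1 * annExp P E ((annExp P F f).coeff s) := by
  have h : (annExp P (E + F) : Poly →+* Poly[X]) =
      (eval₂RingHom (annExp P E : Poly →+* Poly[X]) X).comp (annExp P F : Poly →+* Poly[X]) := by
    refine MvPolynomial.ringHom_ext (fun c => ?_) fun v => ?_
    · have h (G : Field) : annExp P G (MvPolynomial.C c) = C (MvPolynomial.C c) := by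
        rw [← MvPolynomial.algebraMap_eq, AlgHom.commutes]; rfl
      simp [h]
    · have h : annExp P E (MvPolynomial.C (shiftCoeff P F v)) =
          C (MvPolynomial.C (shiftCoeff P F v)) := by
        rw [← MvPolynomial.algebraMap_eq, AlgHom.commutes]; rfl
      simp only [RingHom.coe_coe, RingHom.comp_apply, annExp_X, map_add, coe_eval₂RingHom,
        eval₂_C, eval₂_monomial, shiftCoeff_add, h]
      rw [C_mul_X_pow_eq_monomial]
      ring
  have h2 := congrArg (fun φ => φ f) h
  simp only [RingHom.coe_coe, RingHom.comp_apply, coe_eval₂RingHom] at h2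
  rw [h2, eval₂_eq_sum_range' _ hD]
  refine Finset.sum_congr rfl fun s _ => ?_
  rw [monomial_one_right_eq_X_pow, mul_comm, RingHom.coe_coe]

theorem creCoeff_add (E F : Field) (j : ℤ) (S : Finset ℤ) (hS : Finset.Icc 0 j ⊆ S) :
    creCoeff (E + F) j = ∑ i ∈ S, creCoeff E i * creCoeff F (j - i) := by
  rw [← Finset.sum_subset hS fun i _ hi => ?_]
  · rcases lt_or_ge j 0 with hj | hj
    · rw [creCoeff_neg _ hj, Finset.Icc_eq_empty (by omega), Finset.sum_empty]
    obtain ⟨m, rfl⟩ := Int.eq_ofNat_of_zero_le hj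
    have e : (fun n : ℕ+ => ∑ B : Boson, (E + F).cre B n • (MvPolynomial.X (B, n) : Poly)) =
        (fun n : ℕ+ => ∑ B : Boson, E.cre B n • (MvPolynomial.X (B, n) : Poly)) +
        fun n : ℕ+ => ∑ B : Boson, F.cre B n • (MvPolynomial.X (B, n) : Poly) := by
      ext1 n
      simp [add_smul, Finset.sum_add_distrib]
    rw [creCoeff_natCast, e, expCoeff_add, Finset.Nat.sum_antidiagonal_eq_sum_range_succ_mk]
    refine Finset.sum_bij (fun i _ => (i : ℤ)) (fun i hi => ?_) (fun _ _ _ _ h => by simpa using h)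
      (fun b hb => ?_) fun i hi => ?_
    · have := Finset.mem_range.1 hi
      simp only [Finset.mem_Icc]; omega
    · have := Finset.mem_Icc.1 hb
      exact ⟨b.toNat, by simp only [Finset.mem_range]; omega, by omega⟩
    · have := Finset.mem_range.1 hi
      rw [← Nat.cast_sub (by omega), creCoeff_natCast, creCoeff_natCast]
  · simp only [Finset.mem_Icc, not_and_or, not_le] at hi
    rcases hi with hi | hi
    · rw [creCoeff_neg E hi, zero_mul]
    · rw [creCoeff_neg F (by omega), mul_zero]

/-- Setting the two variables of the normally ordered product equal. -/
theorem polyMode_add (P : Params) (E F : Field) (T : ℤ) (f : Poly) :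
    ∃ D₀ : ℕ, ∀ D : ℕ, D₀ ≤ D → polyMode P (E + F) T f =
      ∑ N ∈ Finset.Icc (-(D : ℤ)) D, polyMode₂ P E F N (T - N) f := by
  obtain ⟨D₁, h₁⟩ := polyMode₂_eq_sum_sum P E F f
  obtain ⟨D₂, h₂⟩ := annExp_natDegree_bound P E F f
  set D₃ := max (max D₁ D₂) ((annExp P F f).natDegree + 1) with hD₃
  refine ⟨T.toNat + 2 * D₃, fun D hD => ?_⟩
  simp only [h₁ D₃ (by omega)]
  rw [Finset.sum_comm, polyMode, LinearMap.comp_apply, AlgHom.toLinearMap_apply,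
    annExp_add P E F f (D := D₃) (by omega), map_sum]
  refine Finset.sum_congr rfl fun s hs => ?_
  have hs' := Finset.mem_range.1 hs
  rw [lsum_creCoeff_monomial_mul, one_mul,
    lsum_eq_sum_range _ _ (lt_of_lt_of_le (h₂ s) (show D₂ ≤ D₃ by omega)), Finset.sum_comm]
  refine Finset.sum_congr rfl fun r hr => ?_
  have hr' := Finset.mem_range.1 hr
  rw [LinearMap.mulLeft_apply, creCoeff_add E F (T + s + r)
    ((Finset.Icc (-(D : ℤ)) D).map (addRightEmbedding (r : ℤ))), Finset.sum_map, Finset.sum_mul]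
  · refine Finset.sum_congr rfl fun N _ => ?_
    rw [addRightEmbedding_apply, show T + s + r - (N + r) = T - N + s by ring]
    ring
  · intro i hi
    have := Finset.mem_Icc.1 hi
    simp only [Finset.mem_map, Finset.mem_Icc, addRightEmbedding_apply]
    exact ⟨i - r, by omega, by omega⟩

/-! ### Rescaling the variable of a field -/

theorem qpow_add (ħ x y : ℂ) : qpow ħ (x + y) = qpow ħ x * qpow ħ y := by
  simp [qpow, add_mul, Complex.exp_add]

theorem qpow_zero (ħ : ℂ) : qpow ħ 0 = 1 := by simp [qpow]

theorem qpow_neg (ħ x : ℂ) : qpow ħ (-x) = (qpow ħ x)⁻¹ := by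
  simp [qpow, Complex.exp_neg]

theorem qpow_ne_zero (ħ x : ℂ) : qpow ħ x ≠ 0 := Complex.exp_ne_zero _

theorem qpow_mul_natCast (ħ x : ℂ) (n : ℕ) : qpow ħ (x * n) = qpow ħ x ^ n := by
  rw [qpow, qpow, ← Complex.exp_nat_mul]; ring_nf

theorem qpow_mul_intCast (ħ x : ℂ) (n : ℤ) : qpow ħ (x * n) = qpow ħ x ^ n := by
  rw [qpow, qpow, ← Complex.exp_int_mul]; ring_nf

/-- The field `E(q^x z)`. -/
def Field.rescale (ħ x : ℂ) (E : Field) : Field where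
  cre B n := E.cre B n * qpow ħ x ^ (n : ℕ)
  ann B n := E.ann B n * (qpow ħ x)⁻¹ ^ (n : ℕ)
  charge := E.charge
  const B := E.const B + match B with
    | .a _ => 0
    | .b g => x * E.charge g

theorem creCoeff_rescale (ħ x : ℂ) (E : Field) (j : ℤ) :
    creCoeff (E.rescale ħ x) j = qpow ħ x ^ j • creCoeff E j := by
  rcases lt_or_ge j 0 with hj | hj
  · rw [creCoeff_neg _ hj, creCoeff_neg _ hj, smul_zero]
  obtain ⟨m, rfl⟩ := Int.eq_ofNat_of_zero_le hj
  rw [creCoeff_natCast, creCoeff_natCast, zpow_natCast, Algebra.smul_def, map_pow,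
    ← expCoeff_scale]
  congr 1
  ext1 n
  simp only [Field.rescale, mul_comm (E.cre _ n), mul_smul, ← Finset.smul_sum]
  rw [Algebra.smul_def, map_pow]

open Polynomial in
theorem coeff_annExp_rescale (P : Params) (x : ℂ) (E : Field) (f : Poly) (r : ℕ) :
    (annExp P (E.rescale P.ħ x) f).coeff r = (qpow P.ħ x)⁻¹ ^ r • (annExp P E f).coeff r := by
  set y := (qpow P.ħ x)⁻¹ with hy
  have h : (annExp P (E.rescale P.ħ x) : Poly →+* Poly[X]) =
      (compRingHom (C (MvPolynomial.C y) * X)).comp (annExp P E : Poly →+* Poly[X]) := by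
    refine MvPolynomial.ringHom_ext (fun c => ?_) fun v => ?_
    · have h (G : Field) : annExp P G (MvPolynomial.C c) = C (MvPolynomial.C c) := by
        rw [← MvPolynomial.algebraMap_eq, AlgHom.commutes]; rfl
      simp [h]
    · have hs : shiftCoeff P (E.rescale P.ħ x) v = y ^ (v.2 : ℕ) * shiftCoeff P E v := by
        simp only [shiftCoeff, Field.rescale, Finset.mul_sum]
        exact Finset.sum_congr rfl fun B _ => by ring
      simp only [RingHom.coe_coe, RingHom.comp_apply, annExp_X, hs, coe_compRingHom_apply,
        add_comp, C_comp, ← C_mul_X_pow_eq_monomial, map_mul, map_pow, mul_comp, X_pow_comp]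
      ring
  have h2 := congrArg (fun φ => (φ f).coeff r) h
  simp only [RingHom.coe_coe, RingHom.comp_apply, coe_compRingHom_apply] at h2
  rw [h2, comp_C_mul_X_coeff, mul_comm, Algebra.smul_def, map_pow]
  rfl

theorem polyMode_rescale (P : Params) (x : ℂ) (E : Field) (N : ℤ) (f : Poly) :
    polyMode P (E.rescale P.ħ x) N f = qpow P.ħ x ^ N • polyMode P E N f := by
  have h0 := qpow_ne_zero P.ħ x
  set D := max (annExp P (E.rescale P.ħ x) f).natDegree (annExp P E f).natDegree + 1
  rw [polyMode_eq_sum P _ N f (D := D) (by omega), polyMode_eq_sum P E N f (D := D) (by omega),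
    Finset.smul_sum]
  refine Finset.sum_congr rfl fun r _ => ?_
  rw [coeff_annExp_rescale, creCoeff_rescale, smul_mul_smul_comm]
  congr 1
  rw [zpow_add₀ h0, zpow_natCast, mul_assoc, ← mul_pow, mul_inv_cancel₀ h0, one_pow, mul_one]

theorem polyMode₂_rescale (P : Params) (x : ℂ) (E F : Field) (N M : ℤ) (f : Poly) :
    polyMode₂ P (E.rescale P.ħ x) F N M f = qpow P.ħ x ^ N • polyMode₂ P E F N M f := by
  rw [polyMode₂_eq_sum P _ F N M f (Nat.lt_succ_self _),
    polyMode₂_eq_sum P _ F N M f (Nat.lt_succ_self _), Finset.smul_sum]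
  refine Finset.sum_congr rfl fun r _ => ?_
  rw [polyMode_rescale, mul_smul_comm]

end QSl21

namespace QSl21

/-! ### Formal distributions as modules over Laurent polynomials -/

/-- Formal distributions: the family `K` stands for `∑ γ, K γ * z ^ γ`. -/
def Dist (Γ V : Type*) : Type _ := Γ → V

section Dist

variable {Γ V : Type*} [AddCommGroup Γ] [AddCommGroup V] [Module ℂ V]

instance : AddCommGroup (Dist Γ V) := inferInstanceAs (AddCommGroup (Γ → V))
instance : Module ℂ (Dist Γ V) := inferInstanceAs (Module ℂ (Γ → V))

theorem Dist.ext {K L : Dist Γ V} (h : ∀ γ, K γ = L γ) : K = L := funext h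
@[simp] theorem Dist.add_apply (K L : Dist Γ V) (γ : Γ) : (K + L) γ = K γ + L γ := rfl
@[simp] theorem Dist.sub_apply (K L : Dist Γ V) (γ : Γ) : (K - L) γ = K γ - L γ := rfl
@[simp] theorem Dist.neg_apply (K : Dist Γ V) (γ : Γ) : (-K) γ = -K γ := rfl
@[simp] theorem Dist.zero_apply (γ : Γ) : (0 : Dist Γ V) γ = 0 := rfl
@[simp] theorem Dist.smul_apply (c : ℂ) (K : Dist Γ V) (γ : Γ) : (c • K) γ = c • K γ := rfl

/-- Multiplication by the monomials. -/
def Dist.shift : Multiplicative Γ →* Module.End ℂ (Dist Γ V) where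
  toFun δ :=
    { toFun := fun K γ => K (γ - δ.toAdd)
      map_add' := fun _ _ => rfl
      map_smul' := fun _ _ => rfl }
  map_one' := by
    refine LinearMap.ext fun K => Dist.ext fun γ => ?_
    change K (γ - 0) = K γ
    rw [sub_zero]
  map_mul' δ ε := by
    refine LinearMap.ext fun K => Dist.ext fun γ => ?_
    change K (γ - (δ.toAdd + ε.toAdd)) = K (γ - δ.toAdd - ε.toAdd)
    rw [sub_add_eq_sub_sub]

instance : Module (AddMonoidAlgebra ℂ Γ) (Dist Γ V) :=
  Module.compHom (Dist Γ V)
    (AddMonoidAlgebra.lift ℂ (Module.End ℂ (Dist Γ V)) Γ Dist.shift).toRingHom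

@[simp] theorem Dist.single_smul_apply (δ : Γ) (c : ℂ) (K : Dist Γ V) (γ : Γ) :
    (AddMonoidAlgebra.single δ c • K) γ = c • K (γ - δ) := by
  change (AddMonoidAlgebra.lift ℂ (Module.End ℂ (Dist Γ V)) Γ Dist.shift
    (AddMonoidAlgebra.single δ c) K) γ = _
  rw [AddMonoidAlgebra.lift_single]
  rfl

end Dist

/-! ### Distributions in two variables -/

section TwoVariables

variable {V : Type*} [AddCommGroup V] [Module ℂ V]

/-- Laurent polynomials in `z` and `w`. -/
abbrev L₂ : Type := AddMonoidAlgebra ℂ (ℤ × ℤ)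

/-- Distributions `∑ K (N, M) z ^ N w ^ M`. -/
abbrev Dist₂ (V : Type*) : Type _ := Dist (ℤ × ℤ) V

/-- The scalar `c` as a Laurent polynomial. -/
def L₂.c (c : ℂ) : L₂ := AddMonoidAlgebra.single 0 c
/-- The variable `z`. -/
def L₂.z : L₂ := AddMonoidAlgebra.single (1, 0) 1
/-- The variable `w`. -/
def L₂.w : L₂ := AddMonoidAlgebra.single (0, 1) 1

open L₂

theorem L₂.c_mul (a b : ℂ) : c (a * b) = c a * c b := by
  simp [c, AddMonoidAlgebra.single_mul_single]
theorem L₂.c_one : c 1 = 1 := rfl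

@[simp] theorem c_smul_apply (a : ℂ) (K : Dist₂ V) (x : ℤ × ℤ) : (c a • K) x = a • K x := by
  simp [c]
@[simp] theorem z_smul_apply (K : Dist₂ V) (x : ℤ × ℤ) : (z • K) x = K (x.1 - 1, x.2) := by
  simp [z, Prod.sub_def]
@[simp] theorem w_smul_apply (K : Dist₂ V) (x : ℤ × ℤ) : (w • K) x = K (x.1, x.2 - 1) := by
  simp [w, Prod.sub_def]

/-- The linear form `z - p w`. -/
def lin (p : ℂ) : L₂ := z - c p * w

theorem lin_smul_apply (p : ℂ) (K : Dist₂ V) (x : ℤ × ℤ) :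
    (lin p • K) x = K (x.1 - 1, x.2) - p • K (x.1, x.2 - 1) := by
  simp [lin, sub_smul, mul_smul]

/-- The exponents of `z` in `K` are bounded below. -/
def BddZ (K : Dist₂ V) : Prop := ∃ a : ℤ, ∀ N M : ℤ, N < a → K (N, M) = 0
/-- The exponents of `w` in `K` are bounded below. -/
def BddW (K : Dist₂ V) : Prop := ∃ a : ℤ, ∀ N M : ℤ, M < a → K (N, M) = 0

theorem BddZ.add {K L : Dist₂ V} (hK : BddZ K) (hL : BddZ L) : BddZ (K + L) := by
  obtain ⟨a, ha⟩ := hK; obtain ⟨b, hb⟩ := hL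
  exact ⟨min a b, fun N M h => by
    rw [Dist.add_apply, ha N M (by omega), hb N M (by omega), add_zero]⟩

theorem BddW.add {K L : Dist₂ V} (hK : BddW K) (hL : BddW L) : BddW (K + L) := by
  obtain ⟨a, ha⟩ := hK; obtain ⟨b, hb⟩ := hL
  exact ⟨min a b, fun N M h => by
    rw [Dist.add_apply, ha N M (by omega), hb N M (by omega), add_zero]⟩

theorem BddZ.single_smul {K : Dist₂ V} (hK : BddZ K) (δ : ℤ × ℤ) (x : ℂ) :
    BddZ ((AddMonoidAlgebra.single δ x : L₂) • K) := by
  obtain ⟨a, ha⟩ := hK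
  exact ⟨a + δ.1, fun N M h => by
    rw [Dist.single_smul_apply, show ((N, M) : ℤ × ℤ) - δ = (N - δ.1, M - δ.2) from rfl,
      ha _ _ (by omega), smul_zero]⟩

theorem BddW.single_smul {K : Dist₂ V} (hK : BddW K) (δ : ℤ × ℤ) (x : ℂ) :
    BddW ((AddMonoidAlgebra.single δ x : L₂) • K) := by
  obtain ⟨a, ha⟩ := hK
  exact ⟨a + δ.2, fun N M h => by
    rw [Dist.single_smul_apply, show ((N, M) : ℤ × ℤ) - δ = (N - δ.1, M - δ.2) from rfl,
      ha _ _ (by omega), smul_zero]⟩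

theorem BddZ.smul {K : Dist₂ V} (hK : BddZ K) (p : L₂) : BddZ (p • K) := by
  induction p using AddMonoidAlgebra.induction_linear with
  | zero => rw [zero_smul]; exact ⟨0, fun _ _ _ => rfl⟩
  | add f g hf hg => rw [add_smul]; exact hf.add hg
  | single δ x => exact hK.single_smul δ x

theorem BddW.smul {K : Dist₂ V} (hK : BddW K) (p : L₂) : BddW (p • K) := by
  induction p using AddMonoidAlgebra.induction_linear with
  | zero => rw [zero_smul]; exact ⟨0, fun _ _ _ => rfl⟩
  | add f g hf hg => rw [add_smul]; exact hf.add hg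
  | single δ x => exact hK.single_smul δ x

theorem BddZ.neg {K : Dist₂ V} (hK : BddZ K) : BddZ (-K) := by
  rw [← neg_one_smul L₂]; exact hK.smul _
theorem BddW.neg {K : Dist₂ V} (hK : BddW K) : BddW (-K) := by
  rw [← neg_one_smul L₂]; exact hK.smul _
theorem BddW.sub {K L : Dist₂ V} (hK : BddW K) (hL : BddW L) : BddW (K - L) := by
  rw [sub_eq_add_neg]; exact hK.add hL.neg

/-- Division by `z - p w` is unique among distributions with exponents of `w` bounded below. -/
theorem BddW.eq_zero_of_lin_smul {K : Dist₂ V} (hK : BddW K) {p : ℂ} (h : lin p • K = 0) :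
    K = 0 := by
  obtain ⟨a, ha⟩ := hK
  have key : ∀ n : ℕ, ∀ N : ℤ, K (N, a - 1 + n) = 0 := by
    intro n
    induction n with
    | zero => intro N; exact ha _ _ (by push_cast; omega)
    | succ n ih =>
      intro N
      have e := congrFun h (N + 1, a - 1 + (n + 1 : ℕ))
      rw [lin_smul_apply] at e
      simp only [Dist.zero_apply, add_sub_cancel_right] at e
      rw [show a - 1 + ((n + 1 : ℕ) : ℤ) - 1 = a - 1 + n by push_cast; ring, ih, smul_zero,
        sub_zero] at e
      exact e
  refine Dist.ext fun ⟨N, M⟩ => ?_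
  rcases lt_or_ge M a with hM | hM
  · exact ha N M hM
  · have := key (M - (a - 1)).toNat N
    rwa [show a - 1 + ((M - (a - 1)).toNat : ℤ) = M by omega] at this

theorem BddW.lin_smul_cancel {K L : Dist₂ V} (hK : BddW K) (hL : BddW L) {p : ℂ}
    (h : lin p • K = lin p • L) : K = L :=
  sub_eq_zero.1 ((hK.sub hL).eq_zero_of_lin_smul (by rw [smul_sub, h, sub_self]))

/-- Evaluation at `z = p w`: the coefficient of `w ^ T`. -/
def evalAt (p : ℂ) (B : Dist₂ V) (T : ℤ) : V := ∑ᶠ k : ℤ, p ^ k • B (k, T - k)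

theorem evalAt_eq_sum (p : ℂ) (B : Dist₂ V) {T : ℤ} {S : Finset ℤ}
    (hS : ∀ k ∉ S, B (k, T - k) = 0) : evalAt p B T = ∑ k ∈ S, p ^ k • B (k, T - k) := by
  refine finsum_eq_sum_of_support_subset _ fun k hk => ?_
  by_contra h
  exact hk (by simp only [hS k (by simpa using h), smul_zero])

theorem exists_evalAt_eq_sum {B : Dist₂ V} (hz : BddZ B) (hw : BddW B) (T : ℤ) :
    ∃ n₀ : ℕ, ∀ n : ℕ, n₀ ≤ n → ∀ k ∉ Finset.Icc (-(n : ℤ)) n, B (k, T - k) = 0 := by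
  obtain ⟨a, ha⟩ := hz; obtain ⟨b, hb⟩ := hw
  refine ⟨(-a).toNat + (T - b).toNat, fun n hn k hk => ?_⟩
  rw [Finset.mem_Icc, not_and_or, not_le, not_le] at hk
  rcases hk with hk | hk
  · exact ha _ _ (by omega)
  · exact hb _ _ (by omega)

theorem evalAt_add (p : ℂ) {B C : Dist₂ V} (hz : BddZ B) (hw : BddW B) (hz' : BddZ C)
    (hw' : BddW C) (T : ℤ) : evalAt p (B + C) T = evalAt p B T + evalAt p C T := by
  obtain ⟨n, hn⟩ := exists_evalAt_eq_sum hz hw T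
  obtain ⟨n', hn'⟩ := exists_evalAt_eq_sum hz' hw' T
  have h1 := hn (max n n') (le_max_left _ _)
  have h2 := hn' (max n n') (le_max_right _ _)
  rw [evalAt_eq_sum p _ h1, evalAt_eq_sum p _ h2, evalAt_eq_sum p _ (fun k hk => by
    rw [Dist.add_apply, h1 k hk, h2 k hk, add_zero]), ← Finset.sum_add_distrib]
  simp only [Dist.add_apply, smul_add]

theorem evalAt_c_smul (p a : ℂ) (B : Dist₂ V) (T : ℤ) :
    evalAt p (c a • B) T = a • evalAt p B T := by
  simp only [evalAt, c_smul_apply, smul_finsum, smul_comm a]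

theorem evalAt_neg (p : ℂ) (B : Dist₂ V) (T : ℤ) : evalAt p (-B) T = -evalAt p B T := by
  simp only [evalAt, Dist.neg_apply, smul_neg, finsum_neg_distrib]

theorem evalAt_sub (p : ℂ) {B C : Dist₂ V} (hz : BddZ B) (hw : BddW B) (hz' : BddZ C)
    (hw' : BddW C) (T : ℤ) : evalAt p (B - C) T = evalAt p B T - evalAt p C T := by
  rw [sub_eq_add_neg, evalAt_add p hz hw hz'.neg hw'.neg, evalAt_neg, sub_eq_add_neg]

theorem evalAt_w_smul (p : ℂ) (B : Dist₂ V) (T : ℤ) :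
    evalAt p (w • B) T = evalAt p B (T - 1) := by
  simp only [evalAt, w_smul_apply, sub_right_comm]

theorem evalAt_z_smul {p : ℂ} (hp : p ≠ 0) (B : Dist₂ V) (T : ℤ) :
    evalAt p (z • B) T = p • evalAt p B (T - 1) := by
  rw [evalAt, evalAt, smul_finsum, ← finsum_comp_equiv (Equiv.addRight (1 : ℤ))]
  refine finsum_congr fun k => ?_
  simp only [Equiv.coe_addRight, z_smul_apply, add_sub_cancel_right, smul_smul]
  rw [zpow_add_one₀ hp, mul_comm, show T - (k + 1) = T - 1 - k by ring]

theorem evalAt_lin_smul {p : ℂ} (hp : p ≠ 0) (x : ℂ) {B : Dist₂ V} (hz : BddZ B) (hw : BddW B)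
    (T : ℤ) : evalAt p (lin x • B) T = (p - x) • evalAt p B (T - 1) := by
  rw [lin, sub_smul, mul_smul, evalAt_sub p (hz.smul _) (hw.smul _) ((hz.smul _).smul _)
    ((hw.smul _).smul _), evalAt_z_smul hp, evalAt_c_smul, evalAt_w_smul, sub_smul]

/-- If `(z - p w) K = B`, the partial evaluations of `B` at `z = p w` telescope. -/
theorem lin_smul_telescope {p : ℂ} (hp : p ≠ 0) {K B : Dist₂ V} (h : lin p • K = B) (T a : ℤ)
    (n : ℕ) :
    ∑ k ∈ Finset.Ioc a (a + n), p ^ k • B (k, T - k) =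
      p ^ (a + 1) • K (a, T - 1 - a) - p ^ (a + n + 1) • K (a + n, T - 1 - (a + n)) := by
  induction n with
  | zero => simp
  | succ n ih =>
    have e : Finset.Ioc a (a + (n + 1 : ℕ)) = insert (a + n + 1) (Finset.Ioc a (a + n)) := by
      ext k; simp only [Finset.mem_Ioc, Finset.mem_insert]; push_cast; omega
    rw [e, Finset.sum_insert (by simp), ih, ← h, lin_smul_apply]
    push_cast
    simp only [smul_sub, smul_smul]
    rw [show a + (n : ℤ) + 1 - 1 = a + n by ring, show T - (a + n + 1) = T - 1 - (a + n) by ring,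
      show a + ((n : ℤ) + 1) = a + n + 1 by ring,
      show T - 1 - (a + n + 1) = T - 1 - (a + n) - 1 by ring,
      zpow_add_one₀ hp (a + n + 1)]
    abel

/-- The two expansions of `B / (z - p w)` differ by the delta distribution at `z = p w`. -/
theorem delta_formula {p : ℂ} (hp : p ≠ 0) {K L B : Dist₂ V} (hK : BddW K) (hL : BddZ L)
    (h1 : lin p • K = B) (h2 : lin p • L = B) (N M : ℤ) :
    K (N, M) - L (N, M) = p ^ (-N - 1) • evalAt p B (N + M + 1) := by
  have hBw : BddW B := h1 ▸ hK.smul _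
  have hBz : BddZ B := h2 ▸ hL.smul _
  obtain ⟨a, ha⟩ := hK; obtain ⟨b, hb⟩ := hL
  obtain ⟨a', ha'⟩ := hBw; obtain ⟨b', hb'⟩ := hBz
  set T := N + M + 1 with hT
  set n₁ : ℕ := (N - b).toNat + (N - b').toNat + 1
  set n₂ : ℕ := (T - a - N).toNat + (T - a' - N).toNat + 1
  have e1 := lin_smul_telescope hp h1 T N n₂
  have e2 := lin_smul_telescope hp h2 T (N - n₁) n₁
  rw [ha (N + n₂) _ (by omega), smul_zero, sub_zero, show T - 1 - N = M by omega] at e1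
  rw [hb (N - n₁) _ (by omega), smul_zero, zero_sub, sub_add_cancel,
    show T - 1 - N = M by omega] at e2
  have e3 : evalAt p B T = ∑ k ∈ Finset.Ioc (N - n₁) N ∪ Finset.Ioc N (N + n₂),
      p ^ k • B (k, T - k) := by
    refine evalAt_eq_sum p B fun k hk => ?_
    simp only [Finset.mem_union, Finset.mem_Ioc, not_or, not_and_or, not_lt, not_le] at hk
    rcases lt_or_ge k b' with hk' | hk'
    · exact hb' _ _ hk'
    · exact ha' _ _ (by omega)
  rw [Finset.sum_union (Finset.disjoint_left.2 fun k h1 h2 => by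
    simp only [Finset.mem_Ioc] at h1 h2; omega), e1, e2] at e3
  rw [e3, smul_add, smul_neg, smul_smul, smul_smul, ← zpow_add₀ hp,
    show -N - 1 + (N + 1) = 0 by ring, zpow_zero, one_smul, one_smul, neg_add_eq_sub]

/-- `B / (z - p w)` has exponents of `w` bounded below if `B` vanishes at `z = p w`. -/
theorem BddZ.bddW_of_evalAt_eq_zero {p : ℂ} (hp : p ≠ 0) {L B : Dist₂ V} (hL : BddZ L)
    (h : lin p • L = B) (hB : BddW B) (h0 : ∀ T, evalAt p B T = 0) : BddW L := by
  have hBz : BddZ B := h ▸ hL.smul _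
  obtain ⟨b, hb⟩ := hL
  obtain ⟨a', ha'⟩ := hB; obtain ⟨b', hb'⟩ := hBz
  refine ⟨a', fun N M hM => ?_⟩
  set T := N + M + 1 with hT
  set n₁ : ℕ := (N - b).toNat + (N - b').toNat + 1
  have e2 := lin_smul_telescope hp h T (N - n₁) n₁
  rw [hb (N - n₁) _ (by omega), smul_zero, zero_sub, sub_add_cancel,
    show T - 1 - N = M by omega] at e2
  have e3 : evalAt p B T = ∑ k ∈ Finset.Ioc (N - n₁) N, p ^ k • B (k, T - k) := by
    refine evalAt_eq_sum p B fun k hk => ?_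
    simp only [Finset.mem_Ioc, not_and_or, not_lt, not_le] at hk
    rcases lt_or_ge k b' with hk' | hk'
    · exact hb' _ _ hk'
    · exact ha' _ _ (by omega)
  rw [h0, e2, zero_eq_neg] at e3
  exact (smul_eq_zero.1 e3).resolve_left (zpow_ne_zero _ hp)

end TwoVariables

end QSl21

namespace QSl21

/-- A fixed choice among the equal instances that are found for the Fock space. -/
instance Fock.instAddCommGroup : AddCommGroup Fock := inferInstance

/-- A fixed choice among the equal instances that are found for the Fock space. -/
instance Fock.instModule : @Module ℂ Fock _ Fock.instAddCommGroup.toAddCommMonoid :=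
  inferInstanceAs (Module ℂ ((Ghost → ℤ) →₀ Poly))

/-! ### Operator products on the Fock space -/

/-- The constant `∑_B const B * B_0` on the sector `m`. -/
def constTerm (P : Params) (E : Field) (m : Ghost → ℤ) : ℂ := ∑ B, E.const B * zeroMode P m B

/-- The number by which the zero modes of `E` shift when they pass `exp F`. -/
def zeroPair (E F : Field) : ℂ := ∑ g : Ghost, E.const (.b g) * (g.sign * F.charge g : ℤ)

theorem sectorwise_single (s : Ghost → ℤ) (T : (Ghost → ℤ) → Poly →ₗ[ℂ] Poly) (m : Ghost → ℤ)
    (f : Poly) : sectorwise s T (Finsupp.single m f) = Finsupp.single (m + s) (T m f) := by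
  simp [sectorwise]

theorem expMode_single (P : Params) (E : Field) (N : ℤ) (m : Ghost → ℤ) (f : Poly) :
    expMode P E N (Finsupp.single m f) = Finsupp.single (m + E.charge)
      (qpow P.ħ (constTerm P E m) • polyMode P E (N - zExponent E m) f) := by
  rw [expMode, sectorwise_single]
  rfl

/-- The coefficient of `z ^ N * w ^ M` in `:exp (E(z) + F(w)):`. -/
def normalProd (P : Params) (E F : Field) (N M : ℤ) : Module.End ℂ Fock :=
  sectorwise (E.charge + F.charge) fun m =>
    qpow P.ħ (constTerm P E m + constTerm P F m) •
      polyMode₂ P E F (N - zExponent E m) (M - zExponent F m)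

theorem normalProd_single (P : Params) (E F : Field) (N M : ℤ) (m : Ghost → ℤ) (f : Poly) :
    normalProd P E F N M (Finsupp.single m f) = Finsupp.single (m + (E.charge + F.charge))
      (qpow P.ħ (constTerm P E m + constTerm P F m) •
        polyMode₂ P E F (N - zExponent E m) (M - zExponent F m) f) := by
  rw [normalProd, sectorwise_single]
  rfl

theorem zExponent_add_momentum (E : Field) (m s : Ghost → ℤ) :
    zExponent E (m + s) = zExponent E m + zExponent E s := by
  simp [zExponent, mul_add, Finset.sum_add_distrib]

theorem zExponent_add (E F : Field) (m : Ghost → ℤ) :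
    zExponent (E + F) m = zExponent E m + zExponent F m := by
  simp [zExponent, add_mul, Finset.sum_add_distrib]

theorem sum_boson {A : Type*} [AddCommMonoid A] (f : Boson → A) :
    ∑ B, f B = f (.a 0) + f (.a 1) + ∑ g, f (.b g) := by
  change ∑ B ∈ {.a 0, .a 1, .b .b12, .b .b13, .b .b23, .b .c}, f B =
    _ + ∑ g ∈ {.b12, .b13, .b23, .c}, f (.b g)
  rw [Finset.sum_insert (by decide), Finset.sum_insert (by decide), Finset.sum_insert (by decide),
    Finset.sum_insert (by decide), Finset.sum_insert (by decide), Finset.sum_singleton,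
    Finset.sum_insert (by decide), Finset.sum_insert (by decide), Finset.sum_insert (by decide),
    Finset.sum_singleton, add_assoc]

theorem sum_ghost {A : Type*} [AddCommMonoid A] (f : Ghost → A) :
    ∑ g, f g = f .b12 + f .b13 + f .b23 + f .c := by
  change ∑ g ∈ {.b12, .b13, .b23, .c}, f g = _
  rw [Finset.sum_insert (by decide), Finset.sum_insert (by decide), Finset.sum_insert (by decide),
    Finset.sum_singleton]
  simp only [add_assoc]

theorem constTerm_add_momentum (P : Params) (E F : Field) (m : Ghost → ℤ) :
    constTerm P E (m + F.charge) = constTerm P E m + zeroPair E F := by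
  simp only [constTerm, zeroPair, sum_boson, zeroMode, Pi.add_apply]
  rw [add_assoc _ (∑ g, _) (∑ g, _), ← Finset.sum_add_distrib]
  congr 1
  refine Finset.sum_congr rfl fun g _ => ?_
  push_cast
  ring

theorem constTerm_add (P : Params) (E F : Field) (m : Ghost → ℤ) :
    constTerm P (E + F) m = constTerm P E m + constTerm P F m := by
  simp [constTerm, add_mul, Finset.sum_add_distrib]

/-- Elements of the Fock space behave well under linear conditions once the vectors `f |m⟩` do. -/
theorem Fock.exists_bound {Q : Fock → ℤ → Prop} (hmono : ∀ v a b, b ≤ a → Q v a → Q v b)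
    (h0 : Q 0 0) (hadd : ∀ v w a, Q v a → Q w a → Q (v + w) a)
    (hs : ∀ m f, ∃ a, Q (Finsupp.single m f) a) (v : Fock) : ∃ a, Q v a := by
  induction v using Finsupp.induction_linear with
  | zero => exact ⟨0, h0⟩
  | add v w hv hw =>
    obtain ⟨a, ha⟩ := hv; obtain ⟨b, hb⟩ := hw
    exact ⟨min a b, hadd v w _ (hmono v a _ (min_le_left _ _) ha)
      (hmono w b _ (min_le_right _ _) hb)⟩
  | single m f => exact hs m f

theorem expMode_bdd (P : Params) (E : Field) (v : Fock) :
    ∃ a : ℤ, ∀ N < a, expMode P E N v = 0 := by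
  refine Fock.exists_bound (Q := fun v a => ∀ N < a, expMode P E N v = 0)
    (fun v a b hab h N hN => h N (by omega)) (fun N _ => map_zero _)
    (fun v w a h1 h2 N hN => by rw [map_add, h1 N hN, h2 N hN, add_zero]) (fun m f => ?_) v
  refine ⟨zExponent E m - (annExp P E f).natDegree, fun N hN => ?_⟩
  rw [expMode_single, polyMode_eq_zero _ _ _ _ (by omega), smul_zero, Finsupp.single_zero]

theorem normalProd_comm (P : Params) (E F : Field) (N M : ℤ) :
    normalProd P E F N M = normalProd P F E M N := by
  refine Finsupp.lhom_ext fun m f => ?_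
  rw [normalProd_single, normalProd_single, polyMode₂_comm, add_comm E.charge,
    add_comm (constTerm P E m)]

/-- The distribution `:exp (E(z) + F(w)): v`. -/
def normalDist (P : Params) (E F : Field) (v : Fock) : Dist₂ Fock :=
  fun x => normalProd P E F x.1 x.2 v

theorem normalDist_bddW (P : Params) (E F : Field) (v : Fock) : BddW (normalDist P E F v) := by
  refine Fock.exists_bound (Q := fun v a => ∀ N M : ℤ, M < a → normalDist P E F v (N, M) = 0)
    (fun v a b hab h N M hN => h N M (by omega)) (fun N M _ => map_zero _)
    (fun v w a h1 h2 N M hN => ?_) (fun m f => ?_) v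
  · have := h1 N M hN
    have := h2 N M hN
    simp_all [normalDist]
  · refine ⟨zExponent F m - (annExp P F f).natDegree, fun N M hM => ?_⟩
    rw [normalDist, normalProd_single, polyMode₂_eq_zero_right _ _ _ _ _ _ (by simp only; omega),
      smul_zero, Finsupp.single_zero]

theorem normalDist_bddZ (P : Params) (E F : Field) (v : Fock) : BddZ (normalDist P E F v) := by
  obtain ⟨a, ha⟩ := normalDist_bddW P F E v
  exact ⟨a, fun N M h => by
    have := ha M N h
    rwa [normalDist, normalProd_comm] at this⟩

/-- The distribution `e(z) f(w) v`. -/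
def prodDist {V : Type*} [AddCommGroup V] [Module ℂ V] (e f : ℤ → Module.End ℂ V) (v : V) :
    Dist₂ V := fun x => e x.1 (f x.2 v)

/-- The product of two exponentials, expanded in `w / z`. -/
theorem expMode_expMode (P : Params) (E F : Field) (v : Fock) :
    ∃ a : ℤ, ∀ (N M : ℤ) (K : ℕ), M < a + K → expMode P E N (expMode P F M v) =
      qpow P.ħ (zeroPair E F) • ∑ k ∈ Finset.range K, expCoeff (ctr P E F) k •
        normalProd P E F (N - zExponent E F.charge + k) (M - k) v := by
  refine Fock.exists_bound (Q := fun v a => ∀ (N M : ℤ) (K : ℕ), M < a + K →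
    expMode P E N (expMode P F M v) =
      qpow P.ħ (zeroPair E F) • ∑ k ∈ Finset.range K, expCoeff (ctr P E F) k •
        normalProd P E F (N - zExponent E F.charge + k) (M - k) v)
    (fun v a b hab h N M K hN => h N M K (by omega)) (fun N M _ _ => by simp)
    (fun v w a h1 h2 N M K hN => ?_) (fun m f => ?_) v
  · simp only [map_add, h1 N M K hN, h2 N M K hN, smul_add, Finset.sum_add_distrib]
  · refine ⟨zExponent F m - (annExp P F f).natDegree, fun N M K hM => ?_⟩
    rw [expMode_single, expMode_single]
    simp only [normalProd_single, Finsupp.smul_single, ← Finsupp.single_finsetSum]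
    rw [add_assoc m, add_comm F.charge]
    congr 1
    rw [map_smul, polyMode_polyMode P E F _ _ f K (by omega), Finset.smul_sum, Finset.smul_sum,
      Finset.smul_sum]
    refine Finset.sum_congr rfl fun k _ => ?_
    rw [constTerm_add_momentum, zExponent_add_momentum, qpow_add, qpow_add]
    simp only [smul_smul]
    rw [show N - (zExponent E m + zExponent E F.charge) + k =
      N - zExponent E F.charge + k - zExponent E m by ring,
      show M - zExponent F m - k = M - k - zExponent F m by ring]
    congr 1
    ring

end QSl21

namespace QSl21

section Series

variable {V : Type*} [AddCommGroup V] [Module ℂ V]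

open L₂

/-- The product of a power series in `w / z` with a distribution whose exponents of `w` are bounded
below. -/
def seriesMul (f : PowerSeries ℂ) (B : Dist₂ V) : Dist₂ V :=
  fun x => ∑ᶠ k : ℕ, PowerSeries.coeff k f • B (x.1 + k, x.2 - k)

theorem seriesMul_eq_sum (f : PowerSeries ℂ) {B : Dist₂ V} {a : ℤ}
    (ha : ∀ N M : ℤ, M < a → B (N, M) = 0) (N M : ℤ) {K : ℕ} (hK : M < a + K) :
    seriesMul f B (N, M) = ∑ k ∈ Finset.range K, PowerSeries.coeff k f • B (N + k, M - k) := by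
  refine finsum_eq_sum_of_support_subset _ fun k hk => ?_
  by_contra h
  have h' : K ≤ k := by simpa using h
  exact hk (by simp only [ha (N + k) (M - k) (by omega), smul_zero])

theorem seriesMul_one (B : Dist₂ V) : seriesMul 1 B = B := by
  refine Dist.ext fun ⟨N, M⟩ => ?_
  rw [seriesMul, finsum_eq_single _ 0 fun k hk => by
    rw [PowerSeries.coeff_one, if_neg hk, zero_smul]]
  simp

theorem lin_smul_seriesMul (d : ℂ) (f : PowerSeries ℂ) {B : Dist₂ V} (hB : BddW B) :
    lin d • seriesMul f B =
      z • seriesMul ((1 - PowerSeries.C d * PowerSeries.X) * f) B := by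
  obtain ⟨a, ha⟩ := hB
  refine Dist.ext fun ⟨N, M⟩ => ?_
  set K := (M - a).toNat + 1
  rw [lin_smul_apply, z_smul_apply, seriesMul_eq_sum f ha _ _ (K := K + 1) (by simp only; omega),
    seriesMul_eq_sum f ha _ _ (K := K) (by simp only; omega),
    seriesMul_eq_sum _ ha _ _ (K := K + 1) (by simp only; omega)]
  have hc : ∀ k : ℕ, PowerSeries.coeff k ((1 - PowerSeries.C d * PowerSeries.X) * f) =
      PowerSeries.coeff k f - d * PowerSeries.coeff k (PowerSeries.X * f) := fun k => by
    rw [sub_mul, one_mul, mul_assoc, map_sub, PowerSeries.coeff_C_mul]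
  simp only [hc, sub_smul, Finset.sum_sub_distrib]
  congr 1
  rw [Finset.sum_range_succ' _ K, Finset.smul_sum]
  simp only [PowerSeries.coeff_succ_X_mul, PowerSeries.coeff_zero_X_mul, mul_zero, zero_smul,
    add_zero, smul_smul]
  refine Finset.sum_congr rfl fun k _ => ?_
  congr 2
  ext <;> push_cast <;> ring

/-- The product of the linear forms `z - p w`, `p ∈ l`. -/
def lins (l : List ℂ) : L₂ := (l.map lin).prod

theorem lins_smul_seriesMul (l : List ℂ) (f : PowerSeries ℂ) {B : Dist₂ V} (hB : BddW B) :
    lins l • seriesMul f B = z ^ l.length •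
      seriesMul ((l.map fun d => 1 - PowerSeries.C d * PowerSeries.X).prod * f) B := by
  induction l with
  | nil => simp [lins]
  | cons d l ih =>
    have ih' : (List.map lin l).prod • seriesMul f B = _ := ih
    rw [lins, List.map_cons, List.prod_cons, mul_smul, ih', smul_comm, lin_smul_seriesMul d _ hB,
      smul_smul, List.length_cons, pow_succ, List.map_cons, List.prod_cons, mul_assoc]

end Series

/-- The sequence `p ^ n / n`, the coefficients of `- log (1 - p X)`. -/
def logSeq (p : ℂ) (n : ℕ+) : ℂ := p ^ (n : ℕ) / (n : ℕ)

theorem expSeries_neg_logSeq (p : ℂ) :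
    expSeries (-logSeq p) = 1 - PowerSeries.C p * PowerSeries.X := expSeries_neg_log p

theorem expSeries_add_neg_sum (f : ℕ+ → ℂ) (l : List ℂ) :
    expSeries (f - (l.map logSeq).sum) =
      (l.map fun d => 1 - PowerSeries.C d * PowerSeries.X).prod * expSeries f := by
  induction l with
  | nil => simp
  | cons d l ih =>
    rw [List.map_cons, List.sum_cons, List.map_cons, List.prod_cons, mul_assoc, ← ih,
      ← expSeries_neg_logSeq, ← expSeries_add]
    congr 1
    abel

theorem L₂.z_pow (n : ℕ) : L₂.z ^ n = AddMonoidAlgebra.single ((n : ℤ), 0) 1 := by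
  simp [L₂.z, AddMonoidAlgebra.single_pow]

/-- The operator product of two fields whose contraction is the logarithm of a rational function:
if the contraction is `∑_{d ∈ ds} d ^ n / n - ∑_{n ∈ ns} n ^ n / n`, then
`∏_{d ∈ ds} (z - d w) exp E(z) exp F(w)` is a constant times
`∏_{n ∈ ns} (z - n w) :exp (E(z) + F(w)):`. -/
theorem operatorProduct (P : Params) {E F : Field} {ds ns : List ℂ}
    (hctr : ctr P E F = (ds.map logSeq).sum - (ns.map logSeq).sum)
    (hz : zExponent E F.charge = ns.length - ds.length) (v : Fock) :
    lins ds • prodDist (expMode P E) (expMode P F) v =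
      L₂.c (qpow P.ħ (zeroPair E F)) • lins ns • normalDist P E F v := by
  set ε := zExponent E F.charge
  set B := (AddMonoidAlgebra.single (ε, 0) 1 : L₂) • normalDist P E F v with hBdef
  have hB : BddW B := (normalDist_bddW P E F v).smul _
  have h1 : prodDist (expMode P E) (expMode P F) v =
      L₂.c (qpow P.ħ (zeroPair E F)) • seriesMul (expSeries (ctr P E F)) B := by
    obtain ⟨a, ha⟩ := expMode_expMode P E F v
    obtain ⟨b, hb⟩ := hB
    refine Dist.ext fun ⟨N, M⟩ => ?_
    set K := (M - a).toNat + (M - b).toNat + 1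
    rw [prodDist, ha N M K (by omega), c_smul_apply,
      seriesMul_eq_sum _ hb _ _ (K := K) (by omega)]
    congr 1
    refine Finset.sum_congr rfl fun k _ => ?_
    rw [expSeries, PowerSeries.coeff_mk, hBdef, Dist.single_smul_apply, one_smul, normalDist,
      Prod.mk_sub_mk, sub_zero, sub_add_eq_add_sub]
  have h2 : (ds.map fun d => 1 - PowerSeries.C d * PowerSeries.X).prod * expSeries (ctr P E F) =
      (ns.map fun d => 1 - PowerSeries.C d * PowerSeries.X).prod := by
    rw [← expSeries_add_neg_sum, hctr, sub_sub_cancel_left, ← zero_sub, expSeries_add_neg_sum,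
      expSeries_zero, mul_one]
  have h3 := lins_smul_seriesMul ns 1 hB
  rw [seriesMul_one, mul_one] at h3
  rw [h1, smul_comm, lins_smul_seriesMul ds _ hB, h2]
  congr 1
  have h4 := congrArg (fun K => (AddMonoidAlgebra.single (-ε, 0) 1 : L₂) • K) h3
  simp only [hBdef, L₂.z_pow, smul_smul] at h4 ⊢
  rw [mul_comm (lins ns), ← mul_assoc, AddMonoidAlgebra.single_mul_single,
    AddMonoidAlgebra.single_mul_single] at h4
  simp only [Prod.mk_add_mk, add_zero, neg_add_cancel, mul_one] at h4
  rw [show (AddMonoidAlgebra.single ((0 : ℤ), (0 : ℤ)) (1 : ℂ) : L₂) = 1 from rfl, one_mul] at h4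
  rw [h4]
  congr 2
  simp [hz]

/-! ### Evaluation of a normally ordered product -/

theorem zExponent_rescale (ħ x : ℂ) (E : Field) (m : Ghost → ℤ) :
    zExponent (E.rescale ħ x) m = zExponent E m := rfl

theorem constTerm_rescale (P : Params) (x : ℂ) (E : Field) (m : Ghost → ℤ) :
    constTerm P (E.rescale P.ħ x) m = constTerm P E m + x * zExponent E m := by
  have h : ∀ g, (E.rescale P.ħ x).const (.b g) * zeroMode P m (.b g) =
      E.const (.b g) * zeroMode P m (.b g) + x * (E.charge g * (g.sign * m g) : ℤ) := fun g => by
    simp only [Field.rescale, zeroMode]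
    push_cast
    ring
  have h' : ∀ i, (E.rescale P.ħ x).const (.a i) = E.const (.a i) := fun i => by
    simp only [Field.rescale, add_zero]
  simp only [constTerm, zExponent, sum_boson, h, h', Finset.sum_add_distrib]
  push_cast
  rw [Finset.mul_sum]
  simp only [add_assoc]

theorem evalAt_normalDist_single (P : Params) (x : ℂ) (E F : Field) (m : Ghost → ℤ) (f : Poly)
    (T : ℤ) :
    evalAt (qpow P.ħ x) (normalDist P E F (Finsupp.single m f)) T =
      expMode P (E.rescale P.ħ x + F) T (Finsupp.single m f) := by
  obtain ⟨D₀, hD₀⟩ := polyMode_add P (E.rescale P.ħ x) F (T - zExponent E m - zExponent F m) f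
  obtain ⟨n, hn⟩ := exists_evalAt_eq_sum (normalDist_bddZ P E F (Finsupp.single m f))
    (normalDist_bddW P E F (Finsupp.single m f)) T
  have hq := qpow_ne_zero P.ħ x
  obtain ⟨D, hD1, hD2⟩ : ∃ D : ℕ, D₀ ≤ D ∧ n + (zExponent E m).natAbs ≤ D :=
    ⟨D₀ + n + (zExponent E m).natAbs, by omega, by omega⟩
  have hS : ∀ k ∉ (Finset.Icc (-(D : ℤ)) D).map (addRightEmbedding (zExponent E m)),
      normalDist P E F (Finsupp.single m f) (k, T - k) = 0 := by
    intro k hk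
    refine hn n le_rfl k fun h => hk ?_
    rw [Finset.mem_Icc] at h
    rw [Finset.mem_map]
    refine ⟨k - zExponent E m, ?_, ?_⟩
    · rw [Finset.mem_Icc]
      generalize zExponent E m = e at *
      omega
    · exact sub_add_cancel _ _
  rw [evalAt_eq_sum _ _ hS, expMode_single, zExponent_add, zExponent_rescale, ← sub_sub,
    hD₀ D hD1, Finset.sum_map, Finset.smul_sum, Finsupp.single_finsetSum]
  refine Finset.sum_congr rfl fun k _ => ?_
  simp only [normalDist, normalProd_single, Finsupp.smul_single, addRightEmbedding_apply,
    polyMode₂_rescale, smul_smul, constTerm_add, constTerm_rescale, qpow_add]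
  rw [add_sub_cancel_right, show T - (k + zExponent E m) - zExponent F m =
    T - zExponent E m - zExponent F m - k by ring, qpow_mul_intCast, zpow_add₀ hq]
  congr 2
  ring

/-- At `z = q^x w`, the normally ordered product becomes a single normally ordered exponential. -/
theorem evalAt_normalDist (P : Params) (x : ℂ) (E F : Field) (v : Fock) (T : ℤ) :
    evalAt (qpow P.ħ x) (normalDist P E F v) T = expMode P (E.rescale P.ħ x + F) T v := by
  induction v using Finsupp.induction_linear with
  | zero => simp [evalAt, normalDist]
  | add v w hv hw =>
    rw [map_add, ← hv, ← hw, ← evalAt_add _ (normalDist_bddZ _ _ _ _) (normalDist_bddW _ _ _ _)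
      (normalDist_bddZ _ _ _ _) (normalDist_bddW _ _ _ _)]
    congr 1
    refine Dist.ext fun x => ?_
    simp [normalDist]
  | single m f => exact evalAt_normalDist_single P x E F m f T

end QSl21

namespace QSl21

/-! ### Fields with symbolic exponents -/

/-- `q` is not a root of unity. -/
def Params.Generic (P : Params) : Prop := ∀ n : ℕ, 0 < n → Complex.exp P.ħ ^ n ≠ 1

theorem Params.Generic.ħ_ne_zero {P : Params} (hP : P.Generic) : P.ħ ≠ 0 := fun h =>
  hP 1 one_pos (by simp [h])

theorem Params.Generic.sub_ne_zero {P : Params} (hP : P.Generic) (n : ℕ+) :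
    qpow P.ħ n - qpow P.ħ (-n) ≠ 0 := by
  intro h
  have h1 := sub_eq_zero.1 h
  refine hP (2 * n) (by have := n.pos; omega) ?_
  rw [← Complex.exp_nat_mul]
  have h2 : qpow P.ħ n * qpow P.ħ n = 1 := by
    nth_rewrite 2 [h1]
    rw [← qpow_add, add_neg_cancel, qpow_zero]
  rw [← qpow_add] at h2
  rw [← h2, qpow]
  congr 1
  push_cast
  ring

theorem Params.Generic.one_sub_ne_zero {P : Params} (hP : P.Generic) :
    qpow P.ħ 1 - qpow P.ħ (-1) ≠ 0 := by simpa using hP.sub_ne_zero 1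

theorem Params.Generic.qnum_ne_zero {P : Params} (hP : P.Generic) (n : ℕ+) :
    qnum P.ħ n ≠ 0 := div_ne_zero (hP.sub_ne_zero n) hP.one_sub_ne_zero

/-- The pair `(a, b)` stands for the exponent `(a + b α) / 2`. -/
abbrev Exponent : Type := ℤ × ℤ

/-- The value of a symbolic exponent. -/
def Exponent.val (P : Params) (e : Exponent) : ℂ := (e.1 + e.2 * P.α) / 2

/-- `q ^ e` for a symbolic exponent `e`. -/
def pw (P : Params) (e : Exponent) : ℂ := qpow P.ħ (Exponent.val P e)

theorem Exponent.val_add (P : Params) (e f : Exponent) : val P (e + f) = val P e + val P f := by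
  simp only [val, Prod.fst_add, Prod.snd_add]
  push_cast
  ring

theorem Exponent.val_neg (P : Params) (e : Exponent) : val P (-e) = -val P e := by
  simp only [val, Prod.fst_neg, Prod.snd_neg]
  push_cast
  ring

/-- `Exponent.val` as a homomorphism. -/
def Exponent.valHom (P : Params) : Exponent →+ ℂ := AddMonoidHom.mk' (val P) (val_add P)

theorem Exponent.val_zsmul (P : Params) (n : ℤ) (e : Exponent) : val P (n • e) = n * val P e := by
  rw [← zsmul_eq_mul]; exact map_zsmul (valHom P) n e

theorem pw_add (P : Params) (e f : Exponent) : pw P (e + f) = pw P e * pw P f := by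
  rw [pw, Exponent.val_add, qpow_add, pw, pw]

theorem pw_zero (P : Params) : pw P 0 = 1 := by simp [pw, Exponent.val, qpow_zero]

theorem pw_ne_zero (P : Params) (e : Exponent) : pw P e ≠ 0 := qpow_ne_zero _ _

theorem pw_neg (P : Params) (e : Exponent) : pw P (-e) = (pw P e)⁻¹ := by
  rw [pw, Exponent.val_neg, qpow_neg, pw]

/-- Formal sums `∑ c • e` of symbolic exponents, as lists of the pairs `(c, e)`. -/
abbrev FormalSum : Type := List (ℤ × Exponent)

namespace FormalSum

/-- The sum `∑ c • f e`. -/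
def eval {A : Type*} [AddCommGroup A] (f : Exponent → A) (l : FormalSum) : A :=
  (l.map fun t => t.1 • f t.2).sum

section

variable {A : Type*} [AddCommGroup A] (f : Exponent → A)

@[simp] theorem eval_nil : eval f [] = 0 := rfl

@[simp] theorem eval_cons (t : ℤ × Exponent) (l : FormalSum) :
    eval f (t :: l) = t.1 • f t.2 + eval f l := rfl

@[simp] theorem eval_append (l l' : FormalSum) : eval f (l ++ l') = eval f l + eval f l' := by
  simp [eval]

/-- Adds the term `c • e`. -/
def insert (c : ℤ) (e : Exponent) : FormalSum → FormalSum
  | [] => [(c, e)]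
  | t :: l => if e = t.2 then (c + t.1, e) :: l else t :: insert c e l

theorem eval_insert (c : ℤ) (e : Exponent) (l : FormalSum) :
    eval f (insert c e l) = c • f e + eval f l := by
  induction l with
  | nil => rfl
  | cons t l ih =>
    rw [insert]
    split_ifs with h
    · rw [eval_cons, eval_cons, add_smul, h, add_assoc]
    · rw [eval_cons, eval_cons, ih]; abel

/-- Collects the terms with equal exponents. -/
def collect (l : FormalSum) : FormalSum := l.foldr (fun t => insert t.1 t.2) []

theorem eval_collect (l : FormalSum) : eval f (collect l) = eval f l := by
  induction l with
  | nil => rfl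
  | cons t l ih => rw [collect, List.foldr_cons, eval_insert, ← collect, ih, eval_cons]

/-- The exponents with positive coefficients, repeated according to their coefficients. -/
def pos (l : FormalSum) : List Exponent := (l.map fun t => List.replicate t.1.toNat t.2).flatten

/-- The exponents with negative coefficients, repeated according to their coefficients. -/
def neg (l : FormalSum) : List Exponent :=
  (l.map fun t => List.replicate (-t.1).toNat t.2).flatten

theorem eval_eq_pos_sub_neg (l : FormalSum) :
    eval f l = ((pos l).map f).sum - ((neg l).map f).sum := by
  induction l with
  | nil => simp [pos, neg]
  | cons t l ih =>
    have h : t.1 • f t.2 = t.1.toNat • f t.2 - (-t.1).toNat • f t.2 := by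
      rw [← natCast_zsmul, ← natCast_zsmul, ← sub_smul]
      congr 1
      omega
    rw [eval_cons, ih, h]
    simp only [pos, neg, List.map_cons, List.flatten_cons, List.map_append, List.sum_append,
      List.map_replicate, List.sum_replicate]
    abel

/-- Multiplies the coefficients by `c` and adds `e` to the exponents. -/
def scale (c : ℤ) (e : Exponent) (l : FormalSum) : FormalSum := l.map fun t => (c * t.1, e + t.2)

/-- The product, for which exponents add up. -/
def mul (l l' : FormalSum) : FormalSum := (l.map fun t => scale t.1 t.2 l').flatten

/-- The negative. -/
def negate (l : FormalSum) : FormalSum := scale (-1) 0 l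

theorem eval_negate (l : FormalSum) : eval f (negate l) = -eval f l := by
  induction l with
  | nil => simp [negate, scale]
  | cons t l ih =>
    have : negate (t :: l) = (-1 * t.1, 0 + t.2) :: negate l := rfl
    rw [this, eval_cons, ih, eval_cons]
    simp [add_comm]

/-- Formal sums whose difference collects to zero are equal. -/
def Equal (l l' : FormalSum) : Prop := ∀ t ∈ collect (l ++ negate l'), t.1 = 0

instance (l l' : FormalSum) : Decidable (Equal l l') :=
  inferInstanceAs (Decidable (∀ t ∈ collect (l ++ negate l'), t.1 = 0))

theorem Equal.eval_eq {l l' : FormalSum} (h : Equal l l') : eval f l = eval f l' := by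
  have h0 : ∀ k : FormalSum, (∀ t ∈ k, t.1 = 0) → eval f k = 0 := by
    intro k hk
    refine List.sum_eq_zero fun x hx => ?_
    obtain ⟨t, ht, rfl⟩ := List.mem_map.1 hx
    rw [hk t ht, zero_smul]
  have := h0 _ h
  rw [eval_collect, eval_append, eval_negate] at this
  rw [← sub_eq_zero, sub_eq_add_neg, this]

end

theorem eval_scale {A : Type*} [CommRing A] {f : Exponent → A}
    (hf : ∀ e e', f (e + e') = f e * f e') (c : ℤ) (e : Exponent) (l : FormalSum) :
    eval f (scale c e l) = (c * f e) * eval f l := by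
  induction l with
  | nil => simp [scale]
  | cons t l ih =>
    have : scale c e (t :: l) = (c * t.1, e + t.2) :: scale c e l := rfl
    rw [this, eval_cons, ih, eval_cons, hf]
    push_cast [zsmul_eq_mul]
    ring

theorem eval_mul {A : Type*} [CommRing A] {f : Exponent → A}
    (hf : ∀ e e', f (e + e') = f e * f e') (l l' : FormalSum) :
    eval f (mul l l') = eval f l * eval f l' := by
  induction l with
  | nil => simp [mul]
  | cons t l ih =>
    have : mul (t :: l) l' = scale t.1 t.2 l' ++ mul l l' := rfl
    rw [this, eval_append, ih, eval_cons, eval_scale hf]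
    push_cast [zsmul_eq_mul]
    ring

end FormalSum

/-- A field with symbolic coefficients: `cre B` stands for the sequence `∑ c q^(e n)`, up to the
factor `1 / [n]_q` for `b^{12}`, `b^{13}`, `b^{23}`, `c`, and the factor `q - q⁻¹` for `a^1`, `a^2`;
similarly for `ann`. The zero modes have the coefficients `const B + phase B * √-1 π / ħ`. -/
structure SymField where
  /-- coefficients of the creation operators -/
  cre : Boson → FormalSum
  /-- coefficients of the annihilation operators -/
  ann : Boson → FormalSum
  /-- coefficients of `Q_g + g_0 ln z` -/
  charge : Ghost → ℤ
  /-- coefficients of `B_0 ln q` -/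
  const : Boson → Exponent
  /-- coefficients of `√-1 π g_0` -/
  phase : Ghost → ℤ

/-- The normalization of the symbolic coefficients. -/
def bosonNorm (P : Params) (n : ℕ+) : Boson → ℂ
  | .a _ => qpow P.ħ 1 - qpow P.ħ (-1)
  | .b _ => (qnum P.ħ n)⁻¹

namespace SymField

open FormalSum

/-- The number `√-1 π / ħ`: `q` to this power is `-1`. -/
def halfPeriod (P : Params) : ℂ := Complex.I * Real.pi / P.ħ

/-- The field that a symbolic field stands for. -/
def toField (P : Params) (s : SymField) : Field where
  cre B n := bosonNorm P n B * eval (fun e => pw P e ^ (n : ℕ)) (s.cre B)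
  ann B n := bosonNorm P n B * eval (fun e => pw P e ^ (n : ℕ)) (s.ann B)
  charge := s.charge
  const B := Exponent.val P (s.const B) + match B with
    | .a _ => 0
    | .b g => s.phase g * halfPeriod P

instance : Add SymField :=
  ⟨fun s t => ⟨fun B => s.cre B ++ t.cre B, fun B => s.ann B ++ t.ann B,
    fun g => s.charge g + t.charge g, fun B => s.const B + t.const B,
    fun g => s.phase g + t.phase g⟩⟩

instance : Neg SymField :=
  ⟨fun s => ⟨fun B => negate (s.cre B), fun B => negate (s.ann B), fun g => -s.charge g,
    fun B => -s.const B, fun g => -s.phase g⟩⟩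

instance : Sub SymField := ⟨fun s t => s + -t⟩

theorem toField_add (P : Params) (s t : SymField) :
    (s + t).toField P = s.toField P + t.toField P := by
  refine Field.ext' ?_ ?_ rfl ?_
  · funext B n
    exact (congrArg (bosonNorm P n B * ·)
      (eval_append (fun e => pw P e ^ (n : ℕ)) (s.cre B) (t.cre B))).trans
      (mul_add _ _ _)
  · funext B n
    exact (congrArg (bosonNorm P n B * ·)
      (eval_append (fun e => pw P e ^ (n : ℕ)) (s.ann B) (t.ann B))).trans
      (mul_add _ _ _)
  · funext B
    change Exponent.val P (s.const B + t.const B) + _ = (_ + _) + (_ + _)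
    rw [Exponent.val_add]
    cases B with
    | a i => simp only; ring
    | b g =>
      change _ + ((s.phase g + t.phase g : ℤ) : ℂ) * _ = _
      push_cast
      ring

theorem toField_neg (P : Params) (s : SymField) : (-s).toField P = -s.toField P := by
  refine Field.ext' ?_ ?_ rfl ?_
  · funext B n
    exact (congrArg (bosonNorm P n B * ·) (eval_negate (fun e => pw P e ^ (n : ℕ)) (s.cre B))).trans
      (mul_neg _ _)
  · funext B n
    exact (congrArg (bosonNorm P n B * ·) (eval_negate (fun e => pw P e ^ (n : ℕ)) (s.ann B))).trans
      (mul_neg _ _)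
  · funext B
    change Exponent.val P (-s.const B) + _ = -(_ + _)
    rw [Exponent.val_neg]
    cases B with
    | a i => simp only; ring
    | b g =>
      change _ + ((-s.phase g : ℤ) : ℂ) * _ = _
      push_cast
      ring

theorem toField_sub (P : Params) (s t : SymField) :
    (s - t).toField P = s.toField P - t.toField P := by
  rw [sub_eq_add_neg, ← toField_neg, ← toField_add]; rfl

/-- `g(q^x z; κ)`. -/
def full (g : Ghost) (x κ : Exponent) : SymField where
  cre B := if B = .b g then [(1, x - κ)] else []
  ann B := if B = .b g then [(-1, -x - κ)] else []
  charge g' := if g' = g then 1 else 0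
  const B := if B = .b g then x else 0
  phase _ := 0

/-- `B_+(q^x z)`. -/
def plus (B : Boson) (x : Exponent) : SymField where
  cre _ := []
  ann B' := if B' = B then match B with
      | .a _ => [(1, -x)]
      | .b _ => [(1, (2, 0) - x), (-1, (-2, 0) - x)]
    else []
  charge _ := 0
  const B' := if B' = B then (2, 0) else 0
  phase _ := 0

/-- `B_-(q^x z)`. -/
def minus (B : Boson) (x : Exponent) : SymField where
  cre B' := if B' = B then match B with
      | .a _ => [(-1, x)]
      | .b _ => [(-1, (2, 0) + x), (1, (-2, 0) + x)]
    else []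
  ann _ := []
  charge _ := 0
  const B' := if B' = B then (-2, 0) else 0
  phase _ := 0

/-- `√-1 π ∑_g ε g * g_0`. -/
def phases (ε : Ghost → ℤ) : SymField where
  cre _ := []
  ann _ := []
  charge _ := 0
  const _ := 0
  phase := ε

/-- `E(q^x z)`. -/
def rescale (x : Exponent) (s : SymField) : SymField where
  cre B := scale 1 x (s.cre B)
  ann B := scale 1 (-x) (s.ann B)
  charge := s.charge
  const
    | .a i => s.const (.a i)
    | .b g => s.const (.b g) + s.charge g • x
  phase := s.phase

/-- Equality of symbolic fields, up to the order and the grouping of the terms. -/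
def Equal (s t : SymField) : Prop :=
  (∀ B, FormalSum.Equal (s.cre B) (t.cre B)) ∧ (∀ B, FormalSum.Equal (s.ann B) (t.ann B)) ∧
    (∀ g, s.charge g = t.charge g) ∧ (∀ B, s.const B = t.const B) ∧ ∀ g, s.phase g = t.phase g

instance (s t : SymField) : Decidable (Equal s t) := by unfold Equal; infer_instance

theorem Equal.toField_eq {s t : SymField} (h : Equal s t) (P : Params) :
    s.toField P = t.toField P := by
  obtain ⟨h1, h2, h3, h4, h5⟩ := h
  refine Field.ext' ?_ ?_ (funext h3) ?_
  · funext B n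
    exact congrArg (bosonNorm P n B * ·) ((h1 B).eval_eq (fun e => pw P e ^ (n : ℕ)))
  · funext B n
    exact congrArg (bosonNorm P n B * ·) ((h2 B).eval_eq (fun e => pw P e ^ (n : ℕ)))
  · funext B
    simp only [toField, h4, h5]

theorem pw_pow_add (P : Params) (n : ℕ) (e f : Exponent) :
    pw P (e + f) ^ n = pw P e ^ n * pw P f ^ n := by rw [pw_add, mul_pow]

theorem pw_pow_eq (P : Params) (n : ℕ) (e : Exponent) :
    pw P e ^ n = qpow P.ħ (Exponent.val P e * n) := (qpow_mul_natCast ..).symm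

theorem toField_rescale (P : Params) (x : Exponent) (s : SymField) :
    (s.rescale x).toField P = (s.toField P).rescale P.ħ (Exponent.val P x) := by
  refine Field.ext' ?_ ?_ rfl ?_
  · funext B n
    change _ * eval _ (scale 1 x (s.cre B)) = _ * _ * _
    rw [eval_scale (pw_pow_add P n), pw]
    push_cast
    ring
  · funext B n
    change _ * eval _ (scale 1 (-x) (s.ann B)) = _ * _ * _
    rw [eval_scale (pw_pow_add P n), pw_neg, pw]
    push_cast
    ring
  · funext B
    cases B with
    | a i => exact (add_zero _).symm
    | b g =>
      change Exponent.val P (s.const (.b g) + s.charge g • x) + s.phase g * halfPeriod P =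
        Exponent.val P (s.const (.b g)) + s.phase g * halfPeriod P +
          Exponent.val P x * (s.charge g : ℂ)
      rw [Exponent.val_add, Exponent.val_zsmul]
      ring

end SymField

theorem qnum_neg (ħ x : ℂ) : qnum ħ (-x) = -qnum ħ x := by
  rw [qnum, qnum, neg_neg, ← neg_div, neg_sub]

theorem toField_full (P : Params) (g : Ghost) (x κ : Exponent) :
    (SymField.full g x κ).toField P = full P.ħ g (Exponent.val P x) (Exponent.val P κ) := by
  refine Field.ext' ?_ ?_ ?_ ?_
  · funext B n
    simp only [SymField.full, SymField.toField, full]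
    split_ifs with h
    · subst h
      rw [FormalSum.eval_cons, FormalSum.eval_nil, one_smul, add_zero, SymField.pw_pow_eq,
        sub_eq_add_neg, Exponent.val_add, Exponent.val_neg, add_mul, qpow_add, bosonNorm, qnum_neg,
        div_neg, neg_neg, div_eq_inv_mul, mul_assoc, mul_comm (qpow _ (_ * _)), neg_mul]
    · simp
  · funext B n
    simp only [SymField.full, SymField.toField, full]
    split_ifs with h
    · subst h
      rw [FormalSum.eval_cons, FormalSum.eval_nil, add_zero, SymField.pw_pow_eq,
        sub_eq_add_neg, Exponent.val_add, Exponent.val_neg, Exponent.val_neg, add_mul, qpow_add,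
        bosonNorm]
      simp only [neg_smul, one_smul, neg_mul]
      ring
    · simp
  · funext g'
    simp only [SymField.full, SymField.toField, full, Pi.single_apply]
  · funext B
    simp only [SymField.full, SymField.toField, full]
    split_ifs with h
    · subst h; simp
    · cases B <;> simp [Exponent.val]

theorem bosonNorm_mul {P : Params} (hP : P.Generic) (n : ℕ+) (g : Ghost) :
    bosonNorm P n (.b g) * (qpow P.ħ n - qpow P.ħ (-n)) = qpow P.ħ 1 - qpow P.ħ (-1) := by
  have h1 := hP.one_sub_ne_zero
  have h2 := hP.sub_ne_zero n
  rw [bosonNorm, qnum, inv_div, div_mul_cancel₀ _ h2]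

theorem toField_plus {P : Params} (hP : P.Generic) (B : Boson) (x : Exponent) :
    (SymField.plus B x).toField P = plus P.ħ B (Exponent.val P x) := by
  refine Field.ext' ?_ ?_ rfl ?_
  · funext B n
    simp [SymField.plus, SymField.toField, plus]
  · funext B' n
    simp only [SymField.plus, SymField.toField, plus]
    split_ifs with h
    · subst h
      cases B' with
      | a i => simp [SymField.pw_pow_eq, Exponent.val_neg, bosonNorm]
      | b g =>
        rw [← bosonNorm_mul hP n g]
        simp only [FormalSum.eval_cons, FormalSum.eval_nil, SymField.pw_pow_eq, sub_eq_add_neg,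
          Exponent.val_add, Exponent.val_neg, add_mul, qpow_add, neg_smul, one_smul]
        simp [Exponent.val]
        ring
    · simp
  · funext B'
    simp only [SymField.plus, SymField.toField, plus]
    split_ifs with h
    · cases B' <;> simp [Exponent.val]
    · cases B' <;> simp [Exponent.val]

theorem toField_minus {P : Params} (hP : P.Generic) (B : Boson) (x : Exponent) :
    (SymField.minus B x).toField P = minus P.ħ B (Exponent.val P x) := by
  refine Field.ext' ?_ ?_ rfl ?_
  · funext B' n
    simp only [SymField.minus, SymField.toField, minus]
    split_ifs with h
    · subst h
      cases B' with
      | a i => simp [SymField.pw_pow_eq, bosonNorm]; ring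
      | b g =>
        rw [← bosonNorm_mul hP n g]
        simp only [FormalSum.eval_cons, FormalSum.eval_nil, SymField.pw_pow_eq,
          Exponent.val_add, add_mul, qpow_add, neg_smul, one_smul]
        simp [Exponent.val]
        ring
    · simp
  · funext B n
    simp [SymField.minus, SymField.toField, minus]
  · funext B'
    simp only [SymField.minus, SymField.toField, minus]
    split_ifs with h
    · cases B' <;> simp [Exponent.val]
    · cases B' <;> simp [Exponent.val]

namespace SymField

open FormalSum

/-- `(q^(a n) - q^(-a n)) (q^((α+1) n) - q^(-(α+1) n))` with `a = a_{ij}`. -/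
def cartanKernel (i j : Fin 2) : FormalSum :=
  [(1, (2 * cartan i j + 2, 2)), (-1, (2 * cartan i j - 2, -2)),
    (-1, (-2 * cartan i j + 2, 2)), (1, (-2 * cartan i j - 2, -2))]

/-- The contraction of two symbolic fields. -/
def contraction (s t : SymField) : FormalSum :=
  mul (cartanKernel 0 0) (mul (s.ann (.a 0)) (t.cre (.a 0))) ++
  mul (cartanKernel 0 1) (mul (s.ann (.a 0)) (t.cre (.a 1))) ++
  mul (cartanKernel 1 0) (mul (s.ann (.a 1)) (t.cre (.a 0))) ++
  mul (cartanKernel 1 1) (mul (s.ann (.a 1)) (t.cre (.a 1))) ++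
  scale (Ghost.sign .b12) 0 (mul (s.ann (.b .b12)) (t.cre (.b .b12))) ++
  scale (Ghost.sign .b13) 0 (mul (s.ann (.b .b13)) (t.cre (.b .b13))) ++
  scale (Ghost.sign .b23) 0 (mul (s.ann (.b .b23)) (t.cre (.b .b23))) ++
  scale (Ghost.sign .c) 0 (mul (s.ann (.b .c)) (t.cre (.b .c)))

theorem comm_a {P : Params} (hP : P.Generic) (n : ℕ+) (i j : Fin 2) :
    bosonNorm P n (.a i) * bosonNorm P n (.a j) * comm P ((n : ℕ) : ℤ) (.a i) (.a j) =
      eval (fun e => pw P e ^ (n : ℕ)) (cartanKernel i j) / (n : ℕ) := by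
  have h1 := hP.one_sub_ne_zero
  simp only [cartanKernel, eval_cons, eval_nil, pw_pow_eq, Exponent.val, comm, bosonNorm, qnum,
    neg_smul, one_smul]
  have e1 : ∀ a b : ℂ, qpow P.ħ (a + b) = qpow P.ħ a * qpow P.ħ b := qpow_add _
  obtain ⟨a, ha⟩ : ∃ a : ℂ, a = cartan i j * (n : ℕ) := ⟨_, rfl⟩
  obtain ⟨b, hb⟩ : ∃ b : ℂ, b = (P.α + 1) * (n : ℕ) := ⟨_, rfl⟩
  push_cast
  rw [show (2 * (cartan i j : ℂ) + 2 + 2 * P.α) / 2 * ((n : ℕ) : ℂ) = a + b by rw [ha, hb]; ring,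
    show (2 * (cartan i j : ℂ) - 2 + -2 * P.α) / 2 * ((n : ℕ) : ℂ) = a + -b by rw [ha, hb]; ring,
    show (-2 * (cartan i j : ℂ) + 2 + 2 * P.α) / 2 * ((n : ℕ) : ℂ) = -a + b by rw [ha, hb]; ring,
    show (-2 * (cartan i j : ℂ) - 2 + -2 * P.α) / 2 * ((n : ℕ) : ℂ) = -a + -b by rw [ha, hb]; ring,
    e1, e1, e1, e1, ← ha, ← hb]
  field_simp
  ring

theorem comm_b {P : Params} (hP : P.Generic) (n : ℕ+) (g : Ghost) :
    bosonNorm P n (.b g) * bosonNorm P n (.b g) * comm P ((n : ℕ) : ℤ) (.b g) (.b g) =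
      g.sign / (n : ℕ) := by
  have h1 := hP.qnum_ne_zero n
  simp only [comm, bosonNorm, if_true]
  push_cast
  field_simp

theorem comm_b_ne (P : Params) (m : ℤ) {g g' : Ghost} (h : g ≠ g') :
    comm P m (.b g) (.b g') = 0 := if_neg h

theorem logSeq_pw (P : Params) (l : FormalSum) (n : ℕ+) :
    eval (fun e => logSeq (pw P e)) l n = eval (fun e => pw P e ^ (n : ℕ)) l / (n : ℕ) := by
  induction l with
  | nil => simp
  | cons t l ih =>
    rw [eval_cons, eval_cons, Pi.add_apply, ih, add_div, Pi.smul_apply, logSeq, zsmul_eq_mul,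
      zsmul_eq_mul, mul_div_assoc]

/-- The symbolic contraction gives the contraction as a combination of powers `q^(e n) / n`. -/
theorem ctr_toField {P : Params} (hP : P.Generic) (s t : SymField) :
    ctr P (s.toField P) (t.toField P) = eval (fun e => logSeq (pw P e)) (contraction s t) := by
  funext n
  have hm := pw_pow_add P n
  have hb : ∀ g, (eval (fun e => pw P e ^ (n : ℕ))
      (scale g.sign 0 (mul (s.ann (.b g)) (t.cre (.b g))))) / (n : ℕ) =
        (toField P t).cre (.b g) n * ((toField P s).ann (.b g) n *
          comm P ((n : ℕ) : ℤ) (.b g) (.b g)) := fun g => by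
    rw [eval_scale hm, eval_mul hm, pw_zero, one_pow, mul_one]
    have := comm_b hP n g
    simp only [toField]
    linear_combination (-(eval (fun e => pw P e ^ (n : ℕ)) (s.ann (.b g))) *
      (eval (fun e => pw P e ^ (n : ℕ)) (t.cre (.b g)))) * this
  have ha : ∀ i j, (eval (fun e => pw P e ^ (n : ℕ))
      (mul (cartanKernel i j) (mul (s.ann (.a i)) (t.cre (.a j))))) / (n : ℕ) =
        (toField P t).cre (.a j) n * ((toField P s).ann (.a i) n *
          comm P ((n : ℕ) : ℤ) (.a i) (.a j)) := fun i j => by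
    rw [eval_mul hm, eval_mul hm]
    have := comm_a hP n i j
    simp only [toField]
    linear_combination (-(eval (fun e => pw P e ^ (n : ℕ)) (s.ann (.a i))) *
      (eval (fun e => pw P e ^ (n : ℕ)) (t.cre (.a j)))) * this
  rw [logSeq_pw]
  simp only [contraction, eval_append, add_div, hb, ha, ctr, shiftCoeff, sum_boson, sum_ghost]
  simp only [comm_b_ne P _ (show Ghost.b12 ≠ .b13 by decide),
    comm_b_ne P _ (show Ghost.b12 ≠ .b23 by decide),
    comm_b_ne P _ (show Ghost.b12 ≠ .c by decide), comm_b_ne P _ (show Ghost.b13 ≠ .b12 by decide),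
    comm_b_ne P _ (show Ghost.b13 ≠ .b23 by decide), comm_b_ne P _ (show Ghost.b13 ≠ .c by decide),
    comm_b_ne P _ (show Ghost.b23 ≠ .b12 by decide),
    comm_b_ne P _ (show Ghost.b23 ≠ .b13 by decide),
    comm_b_ne P _ (show Ghost.b23 ≠ .c by decide), comm_b_ne P _ (show Ghost.c ≠ .b12 by decide),
    comm_b_ne P _ (show Ghost.c ≠ .b13 by decide), comm_b_ne P _ (show Ghost.c ≠ .b23 by decide)]
  have hab : ∀ i g, comm P ((n : ℕ) : ℤ) (.a i) (.b g) = 0 := fun _ _ => rfl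
  have hba : ∀ i g, comm P ((n : ℕ) : ℤ) (.b g) (.a i) = 0 := fun _ _ => rfl
  simp only [hab, hba]
  ring

/-- The symbolic form of the power of `q` in `exp E(z) exp F(w)`. -/
def zeroShift (s t : SymField) : Exponent :=
  (Ghost.sign .b12 * t.charge .b12) • s.const (.b .b12) +
    (Ghost.sign .b13 * t.charge .b13) • s.const (.b .b13) +
    (Ghost.sign .b23 * t.charge .b23) • s.const (.b .b23) +
    (Ghost.sign .c * t.charge .c) • s.const (.b .c)

/-- The symbolic form of the sign in `exp E(z) exp F(w)`. -/
def phaseShift (s t : SymField) : ℤ :=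
  Ghost.sign .b12 * t.charge .b12 * s.phase .b12 + Ghost.sign .b13 * t.charge .b13 * s.phase .b13 +
    Ghost.sign .b23 * t.charge .b23 * s.phase .b23 + Ghost.sign .c * t.charge .c * s.phase .c

theorem qpow_halfPeriod {P : Params} (hP : P.Generic) (n : ℤ) :
    qpow P.ħ (n * halfPeriod P) = (-1) ^ n := by
  have := hP.ħ_ne_zero
  rw [mul_comm, qpow_mul_intCast, qpow, halfPeriod, div_mul_cancel₀ _ this, mul_comm,
    Complex.exp_pi_mul_I]

theorem qpow_zeroPair {P : Params} (hP : P.Generic) (s t : SymField) :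
    qpow P.ħ (zeroPair (s.toField P) (t.toField P)) =
      (-1) ^ phaseShift s t * pw P (zeroShift s t) := by
  rw [← qpow_halfPeriod hP, pw, ← qpow_add]
  congr 1
  simp only [zeroPair, sum_ghost, toField, phaseShift, zeroShift, Exponent.val_add,
    Exponent.val_zsmul]
  push_cast
  ring

/-- The exponent of `z` in `exp E(z) exp F(w)`. -/
def zShift (s t : SymField) : ℤ :=
  s.charge .b12 * (Ghost.sign .b12 * t.charge .b12) +
    s.charge .b13 * (Ghost.sign .b13 * t.charge .b13) +
    s.charge .b23 * (Ghost.sign .b23 * t.charge .b23) +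
    s.charge .c * (Ghost.sign .c * t.charge .c)

theorem zExponent_toField (P : Params) (s t : SymField) :
    zExponent (s.toField P) (t.toField P).charge = zShift s t := by
  simp only [zExponent, sum_ghost, zShift, toField]

/-- The numerator of the operator product with a given denominator. -/
def numerator (ds : List Exponent) (s t : SymField) : List Exponent :=
  neg (collect (contraction s t ++ ds.map fun d => (-1, d)))

/-- The operator product of `s` and `t` has poles at most at the exponents `ds`. -/
def HasPoles (ds : List Exponent) (s t : SymField) : Prop :=
  pos (collect (contraction s t ++ ds.map fun d => (-1, d))) = [] ∧
    zShift s t = (numerator ds s t).length - ds.length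

instance (ds : List Exponent) (s t : SymField) : Decidable (HasPoles ds s t) := by
  unfold HasPoles; infer_instance

/-- The modes of `:exp E(z):`. -/
def mode (P : Params) (s : SymField) (N : ℤ) : Module.End ℂ Fock := expMode P (s.toField P) N

/-- `operatorProduct` for symbolic fields. -/
theorem HasPoles.operatorProduct {P : Params} (hP : P.Generic) {ds : List Exponent}
    {s t : SymField} (h : HasPoles ds s t) (v : Fock) :
    lins (ds.map (pw P)) • prodDist (s.mode P) (t.mode P) v =
      L₂.c ((-1) ^ phaseShift s t * pw P (zeroShift s t)) •
        lins ((numerator ds s t).map (pw P)) • normalDist P (s.toField P) (t.toField P) v := by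
  rw [← qpow_zeroPair hP]
  refine QSl21.operatorProduct P ?_ ?_ v
  · rw [ctr_toField hP, List.map_map, List.map_map]
    have h1 := eval_eq_pos_sub_neg (fun e => logSeq (pw P e))
      (collect (contraction s t ++ ds.map fun d => (-1, d)))
    rw [h.1, eval_collect, eval_append, List.map_nil, List.sum_nil, zero_sub] at h1
    have h2 : eval (fun e => logSeq (pw P e)) (ds.map fun d => (-1, d)) =
        -(ds.map fun e => logSeq (pw P e)).sum := by
      clear h h1
      induction ds with
      | nil => simp
      | cons d ds ih =>
        rw [List.map_cons, eval_cons, ih, List.map_cons, List.sum_cons, neg_add]; simp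
    rw [h2] at h1
    exact (eq_add_of_add_neg_eq h1).trans (neg_add_eq_sub _ _)
  · rw [zExponent_toField, List.length_map, List.length_map]
    exact h.2

end SymField

end QSl21

namespace QSl21

/-! ### Exchange of two symbolic fields -/

section Swap

variable {V : Type*} [AddCommGroup V] [Module ℂ V]

open L₂

/-- The distribution `f(w) e(z) v`, with the exponents of `z` in the first place. -/
def revDist (e f : ℤ → Module.End ℂ V) (v : V) : Dist₂ V := fun x => f x.2 (e x.1 v)

/-- Exchange of the variables. -/
def swapDist (K : Dist₂ V) : Dist₂ V := fun x => K (x.2, x.1)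

theorem swapDist_c_smul (p : ℂ) (K : Dist₂ V) : swapDist (c p • K) = c p • swapDist K :=
  Dist.ext fun x => by simp [swapDist]

theorem swapDist_lin_smul {p : ℂ} (hp : p ≠ 0) (K : Dist₂ V) :
    swapDist (lin p • K) = c (-p) • lin p⁻¹ • swapDist K := by
  refine Dist.ext fun x => ?_
  simp only [swapDist, lin_smul_apply, c_smul_apply, smul_sub, smul_smul, neg_smul, neg_mul,
    mul_inv_cancel₀ hp, one_smul]
  abel

theorem swapDist_lins_smul (P : Params) (l : List Exponent) (K : Dist₂ V) :
    swapDist (lins (l.map (pw P)) • K) =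
      c ((-1) ^ l.length * pw P l.sum) • lins ((l.map Neg.neg).map (pw P)) • swapDist K := by
  induction l with
  | nil => simp [lins, pw_zero, c_one]
  | cons d l ih =>
    simp only [lins, List.map_cons, List.prod_cons, mul_smul] at ih ⊢
    rw [swapDist_lin_smul (pw_ne_zero P d), ih, smul_comm (lin _) (c _), smul_smul, ← c_mul, pw_neg]
    congr 2
    rw [List.length_cons, List.sum_cons, pw_add]
    ring

end Swap

namespace SymField

open L₂

theorem HasPoles.reversed {P : Params} (hP : P.Generic) {ds : List Exponent} {s t : SymField}
    (h : HasPoles ds t s) (v : Fock) :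
    c ((-1) ^ ds.length * pw P ds.sum) • lins ((ds.map Neg.neg).map (pw P)) •
        revDist (s.mode P) (t.mode P) v =
      c ((-1) ^ phaseShift t s * pw P (zeroShift t s) *
          ((-1) ^ (numerator ds t s).length * pw P (numerator ds t s).sum)) •
        lins (((numerator ds t s).map Neg.neg).map (pw P)) •
          normalDist P (s.toField P) (t.toField P) v := by
  have h1 := congrArg swapDist (h.operatorProduct hP v)
  rw [swapDist_c_smul, swapDist_lins_smul, swapDist_lins_smul, smul_smul (c _) (c _), ← c_mul] at h1
  have h2 : swapDist (normalDist P (t.toField P) (s.toField P) v) =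
      normalDist P (s.toField P) (t.toField P) v := Dist.ext fun x => by
    simp only [swapDist, normalDist]
    rw [normalProd_comm]
  rw [h2] at h1
  exact h1

/-- The relation `∏_{d ∈ A} (z - q^d w) exp E(z) exp F(w) =
(-1)^τ q^ρ ∏_{d ∈ A'} (z - q^d w) exp F(w) exp E(z)`, in a form that can be decided. -/
def Related (A A' : List Exponent) (τ : ℤ) (ρ : Exponent) (s t : SymField) : Prop :=
  HasPoles A s t ∧ HasPoles (A'.map Neg.neg) t s ∧
    (numerator A s t).Perm ((numerator (A'.map Neg.neg) t s).map Neg.neg) ∧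
    zeroShift s t = ρ + (zeroShift t s + (numerator (A'.map Neg.neg) t s).sum + A'.sum) ∧
    (phaseShift s t + (τ + phaseShift t s + (numerator (A'.map Neg.neg) t s).length +
      A'.length)) % 2 = 0

instance (A A' : List Exponent) (τ : ℤ) (ρ : Exponent) (s t : SymField) :
    Decidable (Related A A' τ ρ s t) := by
  unfold Related; infer_instance

theorem map_neg_sum (l : List Exponent) : (l.map Neg.neg).sum = -l.sum := by
  induction l with
  | nil => simp
  | cons a l ih => rw [List.map_cons, List.sum_cons, ih, List.sum_cons, neg_add]

theorem neg_one_zpow_eq {m n : ℤ} (h : (m + n) % 2 = 0) : ((-1 : ℂ) ^ m) = (-1) ^ n := by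
  have h1 : Even (m - n) := by rw [Int.even_iff]; omega
  rw [← sub_add_cancel m n, zpow_add₀ (by norm_num), h1.neg_one_zpow, one_mul]

theorem c_smul_eq_of_eq {N R : Dist₂ Fock} {x y a t : ℂ} (hx : x ≠ 0)
    (h : c x • R = c y • N) (ha : a * x = t * y) : c a • N = c t • R := by
  have h1 : c (a * x) • N = c (t * x) • R := by
    rw [ha, c_mul, c_mul, mul_smul, mul_smul, h]
  have h2 := congrArg (c x⁻¹ • ·) h1
  beta_reduce at h2
  rwa [smul_smul, smul_smul, ← c_mul, ← c_mul, mul_comm a, mul_comm t, inv_mul_cancel_left₀ hx,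
    inv_mul_cancel_left₀ hx] at h2

/-- The exchange relation follows from the two operator products, as they have the same normally
ordered product. -/
theorem Related.exchange {P : Params} (hP : P.Generic) {A A' : List Exponent} {τ : ℤ}
    {ρ : Exponent} {s t : SymField} (h : Related A A' τ ρ s t) (v : Fock) :
    lins (A.map (pw P)) • prodDist (s.mode P) (t.mode P) v =
      c ((-1) ^ τ * pw P ρ) • lins (A'.map (pw P)) • revDist (s.mode P) (t.mode P) v := by
  obtain ⟨h1, h2, h3, h4, h5⟩ := h
  have e1 := h1.operatorProduct hP v
  have e2 := h2.reversed hP v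
  have hlins : lins ((numerator A s t).map (pw P)) =
      lins (((numerator (A'.map Neg.neg) t s).map Neg.neg).map (pw P)) :=
    ((h3.map _).map _).prod_eq
  have hA : (A'.map Neg.neg).map Neg.neg = A' := by simp
  rw [hA, List.length_map, map_neg_sum, pw_neg] at e2
  rw [hlins] at e1
  have h0 := pw_ne_zero P A'.sum
  refine e1.trans (c_smul_eq_of_eq (mul_ne_zero (pow_ne_zero _ (by norm_num)) (inv_ne_zero h0))
    e2 ?_)
  rw [neg_one_zpow_eq h5, h4, pw_add, pw_add, pw_add, zpow_add₀ (by norm_num),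
    zpow_add₀ (by norm_num), zpow_add₀ (by norm_num), zpow_natCast, zpow_natCast]
  have hs : ((-1 : ℂ) ^ A'.length * (-1) ^ A'.length) = 1 := by rw [← mul_pow]; norm_num
  field_simp
  linear_combination (pw P ρ * pw P (t.zeroShift s) *
    pw P (numerator (A'.map Neg.neg) t s).sum) * hs

end SymField

/-! ### Currents as sums of exponentials -/

/-- The term `± q^e (q - q⁻¹)^(-depth) z^(-depth) :exp E(z):` of a current. -/
structure Term where
  /-- the sign -/
  sign : ℤ
  /-- the exponent of `q` -/
  exponent : Exponent
  /-- the exponent of `(q - q⁻¹) z` in the denominator -/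
  depth : ℕ
  /-- the exponent `E` -/
  field : SymField

namespace Term

/-- The coefficient of a term. -/
def coef (P : Params) (t : Term) : ℂ :=
  t.sign * pw P t.exponent * ((qpow P.ħ 1 - qpow P.ħ (-1)) ^ t.depth)⁻¹

/-- The coefficient of `z^N` in a term. -/
def mode (P : Params) (t : Term) (N : ℤ) : Module.End ℂ Fock :=
  t.coef P • t.field.mode P (N + t.depth)

/-- The coefficient of `z^N` in a sum of terms. -/
def modes (P : Params) (X : List Term) (N : ℤ) : Module.End ℂ Fock :=
  (X.map fun t => t.mode P N).sum

theorem modes_nil (P : Params) (N : ℤ) : modes P [] N = 0 := rfl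

theorem modes_cons (P : Params) (t : Term) (X : List Term) (N : ℤ) :
    modes P (t :: X) N = t.mode P N + modes P X N := by simp [modes]

theorem modes_append (P : Params) (X Y : List Term) (N : ℤ) :
    modes P (X ++ Y) N = modes P X N + modes P Y N := by simp [modes]

open L₂

/-- The prefactor of the product of two terms. -/
def prefactor (P : Params) (t u : Term) : L₂ :=
  AddMonoidAlgebra.single (-(t.depth : ℤ), -(u.depth : ℤ)) (t.coef P * u.coef P)

theorem prodDist_mode (P : Params) (t u : Term) (v : Fock) :
    prodDist (t.mode P) (u.mode P) v =
      prefactor P t u • prodDist (t.field.mode P) (u.field.mode P) v := by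
  refine Dist.ext fun x => ?_
  rw [prefactor, Dist.single_smul_apply]
  simp [prodDist, mode, smul_smul, mul_comm (t.coef P)]

theorem revDist_mode (P : Params) (t u : Term) (v : Fock) :
    revDist (t.mode P) (u.mode P) v =
      prefactor P t u • revDist (t.field.mode P) (u.field.mode P) v := by
  refine Dist.ext fun x => ?_
  rw [prefactor, Dist.single_smul_apply]
  simp [revDist, mode, smul_smul]

theorem prodDist_nil_left (P : Params) (f : ℤ → Module.End ℂ Fock) (v : Fock) :
    prodDist (modes P []) f v = 0 := Dist.ext fun x => by simp [prodDist, modes_nil]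

theorem prodDist_nil_right (P : Params) (f : ℤ → Module.End ℂ Fock) (v : Fock) :
    prodDist f (modes P []) v = 0 := Dist.ext fun x => by simp [prodDist, modes_nil]

theorem revDist_nil_left (P : Params) (f : ℤ → Module.End ℂ Fock) (v : Fock) :
    revDist (modes P []) f v = 0 := Dist.ext fun x => by simp [revDist, modes_nil]

theorem revDist_nil_right (P : Params) (f : ℤ → Module.End ℂ Fock) (v : Fock) :
    revDist f (modes P []) v = 0 := Dist.ext fun x => by simp [revDist, modes_nil]

theorem prodDist_cons_left (P : Params) (t : Term) (X : List Term) (f : ℤ → Module.End ℂ Fock)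
    (v : Fock) : prodDist (modes P (t :: X)) f v =
      prodDist (t.mode P) f v + prodDist (modes P X) f v :=
  Dist.ext fun x => by simp [prodDist, modes_cons]

theorem prodDist_cons_right (P : Params) (t : Term) (X : List Term) (f : ℤ → Module.End ℂ Fock)
    (v : Fock) : prodDist f (modes P (t :: X)) v =
      prodDist f (t.mode P) v + prodDist f (modes P X) v :=
  Dist.ext fun x => by simp [prodDist, modes_cons]

theorem revDist_cons_left (P : Params) (t : Term) (X : List Term) (f : ℤ → Module.End ℂ Fock)
    (v : Fock) : revDist (modes P (t :: X)) f v =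
      revDist (t.mode P) f v + revDist (modes P X) f v :=
  Dist.ext fun x => by simp [revDist, modes_cons]

theorem revDist_cons_right (P : Params) (t : Term) (X : List Term) (f : ℤ → Module.End ℂ Fock)
    (v : Fock) : revDist f (modes P (t :: X)) v =
      revDist f (t.mode P) v + revDist f (modes P X) v :=
  Dist.ext fun x => by simp [revDist, modes_cons]

theorem mode_exchange {P : Params} (hP : P.Generic) {A A' : List Exponent} {τ : ℤ}
    {ρ : Exponent} {t u : Term} (h : SymField.Related A A' τ ρ t.field u.field) (v : Fock) :
    lins (A.map (pw P)) • prodDist (t.mode P) (u.mode P) v =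
      c ((-1) ^ τ * pw P ρ) • lins (A'.map (pw P)) • revDist (t.mode P) (u.mode P) v := by
  rw [prodDist_mode, revDist_mode, smul_comm _ (prefactor P t u), h.exchange hP,
    smul_comm (prefactor P t u), smul_comm (prefactor P t u)]

/-- Exchange relations of the terms add up to an exchange relation of the sums. -/
theorem modes_exchange {P : Params} (hP : P.Generic) {A A' : List Exponent} {τ : ℤ}
    {ρ : Exponent} {X Y : List Term}
    (h : ∀ t ∈ X, ∀ u ∈ Y, SymField.Related A A' τ ρ t.field u.field) (v : Fock) :
    lins (A.map (pw P)) • prodDist (modes P X) (modes P Y) v =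
      c ((-1) ^ τ * pw P ρ) • lins (A'.map (pw P)) • revDist (modes P X) (modes P Y) v := by
  induction X with
  | nil => simp only [prodDist_nil_left, revDist_nil_left, smul_zero]
  | cons t X ih =>
    have h1 : lins (A.map (pw P)) • prodDist (t.mode P) (modes P Y) v =
      c ((-1) ^ τ * pw P ρ) • lins (A'.map (pw P)) • revDist (t.mode P) (modes P Y) v := by
      have ht := h t List.mem_cons_self
      clear h ih
      induction Y with
      | nil => simp only [prodDist_nil_right, revDist_nil_right, smul_zero]
      | cons u Y ih =>
        rw [prodDist_cons_right, revDist_cons_right, smul_add, smul_add, smul_add,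
          mode_exchange hP (ht u List.mem_cons_self),
          ih fun u hu => ht u (List.mem_cons_of_mem _ hu)]
    rw [prodDist_cons_left, revDist_cons_left, smul_add, smul_add, smul_add, h1,
      ih fun t ht => h t (List.mem_cons_of_mem _ ht)]

end Term

/-! ### The currents of the realization -/

/-- A phase factor to the right of an exponential becomes a part of the exponent. -/
theorem expMode_mul_phase {P : Params} (hP : P.Generic) (E : Field) (N : ℤ) (ε : Ghost → ℤ) :
    expMode P E N * phase ε = expMode P (E + (SymField.phases ε).toField P) N := by
  have hħ := hP.ħ_ne_zero
  refine Finsupp.lhom_ext fun m f => ?_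
  have h1 : (E + (SymField.phases ε).toField P).cre = E.cre := by
    funext B n; simp [SymField.toField, SymField.phases]
  have h2 : (E + (SymField.phases ε).toField P).ann = E.ann := by
    funext B n; simp [SymField.toField, SymField.phases]
  have h3 : (E + (SymField.phases ε).toField P).charge = E.charge := by
    funext B; simp [SymField.toField, SymField.phases]
  have h4 : polyMode P (E + (SymField.phases ε).toField P) = polyMode P E := by
    funext N
    simp only [polyMode, creCoeff, annExp, h1, h2]
  have h5 : zExponent (E + (SymField.phases ε).toField P) m = zExponent E m := by
    simp only [zExponent, h3]
  rw [Module.End.mul_apply, phase, diagonal, sectorwise_single, expMode_single, expMode_single, h3,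
    h4, h5, constTerm_add, qpow_add, add_zero, LinearMap.smul_apply, map_smul, LinearMap.id_apply,
    smul_smul]
  congr 3
  rw [qpow, constTerm, sum_boson]
  congr 1
  simp only [SymField.toField, SymField.phases, zeroMode, SymField.halfPeriod, Exponent.val]
  simp only [Prod.fst_zero, Prod.snd_zero, Int.cast_zero, zero_mul, add_zero, zero_div, zero_add]
  rw [Finset.sum_mul, Finset.mul_sum]
  refine Finset.sum_congr rfl fun g _ => ?_
  field_simp

namespace SymField

/-- The terms of the currents. -/
def currentTerms : Sgn → Fin 2 → List Term
  | .plus, 0 =>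
    [⟨-1, 0, 1, -full .b12 0 (-2, 0) - full .c (2, 0) 0 + phases phaseA⟩,
      ⟨1, 0, 1, -full .b12 0 (-2, 0) - full .c (-2, 0) 0 + phases phaseA⟩]
  | .plus, 1 =>
    [⟨-1, 0, 0, -plus (.b .b12) (2, 0) - plus (.b .b13) (2, 0) + full .b23 (2, 0) 0 +
        phases phaseB⟩,
      ⟨1, 0, 0, full .b12 0 0 + full .b13 0 0 + full .c 0 0⟩]
  | .minus, 0 =>
    [⟨1, 0, 1, plus (.a 0) (1, 1) + full .b12 (4, 2) (2, 0) + plus (.b .b13) (4, 2) -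
        plus (.b .b23) (2, 2) + full .c (2, 2) 0 + phases (-phaseA)⟩,
      ⟨-1, 0, 1, minus (.a 0) (-1, -1) + full .b12 (-4, -2) (2, 0) + minus (.b .b13) (-4, -2) -
        minus (.b .b23) (-2, -2) + full .c (-2, -2) 0 + phases (-phaseA)⟩,
      ⟨1, (2, 2), 0, plus (.a 0) (1, 1) - full .b13 (2, 2) 0 + full .b23 (2, 2) (-2, 0) +
        phases phaseC⟩]
  | .minus, 1 =>
    [⟨1, (2, 0), 1, plus (.a 1) (1, 1) - full .b23 (2, 2) 0 + phases (-phaseB)⟩,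
      ⟨-1, (2, 0), 1, minus (.a 1) (-1, -1) - full .b23 (-2, -2) 0 + phases (-phaseB)⟩,
      ⟨-1, 0, 1, minus (.a 1) (-1, -1) - full .b12 (-2, -2) (2, 0) - full .b13 (-2, -2) (2, 0) -
        full .c (0, -2) 0⟩,
      ⟨1, 0, 1, minus (.a 1) (-1, -1) - full .b12 (-2, -2) (2, 0) - full .b13 (-2, -2) (2, 0) -
        full .c (-4, -2) 0⟩]

end SymField

/-- The currents are the sums of the terms in `currentTerms`. -/
theorem current_eq_modes {P : Params} (hP : P.Generic) (s : Sgn) (i : Fin 2) (n : ℤ) :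
    current P s i n = Term.modes P (SymField.currentTerms s i) (-n - 1) := by
  have v0 : Exponent.val P 0 = 0 := by simp [Exponent.val]
  have v20 : Exponent.val P (2, 0) = 1 := by simp [Exponent.val]
  have v20' : Exponent.val P (-2, 0) = -1 := by simp [Exponent.val]
  have v11 : Exponent.val P (1, 1) = (P.α + 1) / 2 := by simp [Exponent.val, add_comm]
  have v11' : Exponent.val P (-1, -1) = -((P.α + 1) / 2) := by simp [Exponent.val]; ring
  have v42 : Exponent.val P (4, 2) = P.α + 2 := by simp [Exponent.val]; ring
  have v42' : Exponent.val P (-4, -2) = -P.α - 2 := by simp [Exponent.val]; ring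
  have v22 : Exponent.val P (2, 2) = P.α + 1 := by simp [Exponent.val]; ring
  have v22' : Exponent.val P (-2, -2) = -P.α - 1 := by simp [Exponent.val]; ring
  have v02 : Exponent.val P (0, -2) = -P.α := by simp [Exponent.val]; ring
  have hsub : ∀ A B C : Module.End ℂ Fock, (A - B) * C = A * C - B * C := fun A B C =>
    sub_mul A B C
  fin_cases i <;> cases s <;>
  simp only [current, SymField.currentTerms, Term.modes_cons, Term.modes_nil, Term.mode,
    SymField.mode,
    SymField.toField_add, SymField.toField_sub, SymField.toField_neg, toField_full,
    toField_plus hP, toField_minus hP, v0, v20, v20', v11, v11', v42, v42', v22, v22', v02,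
    hsub, expMode_mul_phase hP, Term.coef, pw, add_zero, qpow_zero] <;>
  simp <;> try module

end QSl21

namespace QSl21

open L₂

/-! ### Residues of operator products -/

section Eval

variable {V : Type*} [AddCommGroup V] [Module ℂ V]

theorem evalAt_single_smul {p : ℂ} (hp : p ≠ 0) (a b : ℤ) (x : ℂ) (B : Dist₂ V) (T : ℤ) :
    evalAt p ((AddMonoidAlgebra.single (a, b) x : L₂) • B) T =
      (x * p ^ a) • evalAt p B (T - a - b) := by
  rw [evalAt, evalAt, smul_finsum, ← finsum_comp_equiv (Equiv.addRight a)]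
  refine finsum_congr fun k => ?_
  simp only [Equiv.coe_addRight, Dist.single_smul_apply, Prod.mk_sub_mk, add_sub_cancel_right,
    smul_smul]
  rw [zpow_add₀ hp, show T - (k + a) - b = T - a - b - k by ring]
  congr 1
  ring

theorem evalAt_lins_smul {p : ℂ} (hp : p ≠ 0) (l : List ℂ) {B : Dist₂ V} (hz : BddZ B)
    (hw : BddW B) (T : ℤ) :
    evalAt p (lins l • B) T = (l.map fun x => p - x).prod • evalAt p B (T - l.length) := by
  induction l generalizing T with
  | nil => simp [lins]
  | cons x l ih =>
    have h : lins (x :: l) • B = lin x • lins l • B := by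
      rw [lins, List.map_cons, List.prod_cons, mul_smul]; rfl
    rw [h, evalAt_lin_smul hp x (hz.smul _) (hw.smul _), ih, smul_smul, List.map_cons,
      List.prod_cons, List.length_cons, Nat.cast_succ]
    congr 2
    ring

end Eval

theorem prodDist_bddW {e f : ℤ → Module.End ℂ Fock} {v : Fock}
    (h : ∃ a : ℤ, ∀ M < a, f M v = 0) : BddW (prodDist e f v) := by
  obtain ⟨a, ha⟩ := h
  exact ⟨a, fun N M hM => by rw [prodDist, ha M hM, map_zero]⟩

theorem revDist_bddZ {e f : ℤ → Module.End ℂ Fock} {v : Fock}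
    (h : ∃ a : ℤ, ∀ N < a, e N v = 0) : BddZ (revDist e f v) := by
  obtain ⟨a, ha⟩ := h
  exact ⟨a, fun N M hN => by rw [revDist, ha N hN, map_zero]⟩

theorem expMode_rescale (P : Params) (x : ℂ) (E : Field) (N : ℤ) :
    expMode P (E.rescale P.ħ x) N = qpow P.ħ x ^ N • expMode P E N := by
  refine Finsupp.lhom_ext fun m f => ?_
  rw [LinearMap.smul_apply, expMode_single, expMode_single, constTerm_rescale, zExponent_rescale,
    polyMode_rescale, qpow_add, qpow_mul_intCast, Finsupp.smul_single, smul_smul, smul_smul,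
    mul_assoc, ← zpow_add₀ (qpow_ne_zero _ _), add_sub_cancel, mul_comm]
  rfl

namespace SymField

theorem mode_bdd (P : Params) (s : SymField) (v : Fock) : ∃ a : ℤ, ∀ N < a, s.mode P N v = 0 :=
  expMode_bdd P _ v

theorem mode_rescale (P : Params) (x : Exponent) (s : SymField) (N : ℤ) :
    (s.rescale x).mode P N = pw P x ^ N • s.mode P N := by
  rw [mode, toField_rescale, expMode_rescale]; rfl

theorem Equal.mode_eq {s t : SymField} (h : Equal s t) (P : Params) (N : ℤ) :
    s.mode P N = t.mode P N := by rw [mode, h.toField_eq, mode]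

end SymField

/-- The sign `(-1)^n`. -/
def parity (n : ℤ) : ℤ := if n % 2 = 0 then 1 else -1

theorem cast_parity (n : ℤ) : ((parity n : ℤ) : ℂ) = (-1) ^ n := by
  rw [parity]
  split_ifs with h
  · rw [(Int.even_iff.2 h).neg_one_zpow]; simp
  · rw [(Int.odd_iff.2 (by omega)).neg_one_zpow]; simp

namespace Term

open SymField

theorem mode_bdd (P : Params) (t : Term) (v : Fock) : ∃ a : ℤ, ∀ N < a, t.mode P N v = 0 := by
  obtain ⟨a, ha⟩ := t.field.mode_bdd P v
  exact ⟨a - t.depth, fun N hN => by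
    rw [mode, LinearMap.smul_apply, ha _ (by omega), smul_zero]⟩

/-- The sign of `q^e - q^n` for `n = e ± 2`. -/
def gapSign (e n : Exponent) : ℤ := if n = e + (4, 0) then -1 else 1

/-- The exponent in `q^e - q^n = ± q^((e + n)/2) (q - q⁻¹)` for `n = e ± 2`. -/
def gapExponent (e n : Exponent) : Exponent := if n = e + (4, 0) then e + (2, 0) else e - (2, 0)

theorem pw_sub_pw (P : Params) {e n : Exponent} (h : n = e + (4, 0) ∨ n = e - (4, 0)) :
    pw P e - pw P n =
      gapSign e n * pw P (gapExponent e n) * (qpow P.ħ 1 - qpow P.ħ (-1)) := by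
  have h1 : qpow P.ħ 1 = pw P (2, 0) := by rw [pw]; congr 1; simp [Exponent.val]
  have h2 : qpow P.ħ (-1) = (pw P (2, 0))⁻¹ := by rw [← pw_neg, pw]; congr 1; simp [Exponent.val]
  have h4 : pw P (4, 0) = pw P (2, 0) * pw P (2, 0) := by rw [← pw_add]; rfl
  have h0 := pw_ne_zero P (2, 0)
  rw [h1, h2, gapSign, gapExponent]
  split_ifs with hn
  · rw [hn, pw_add, pw_add, h4]
    push_cast
    field_simp
    ring
  · rw [h.resolve_left hn, sub_eq_add_neg e, sub_eq_add_neg e, pw_add, pw_add, pw_neg, pw_neg, h4]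
    push_cast
    field_simp

/-- The value of `(z - q^e w) t(z) u(w)` at `z = q^e w`. -/
def residue (e : Exponent) (t u : Term) : Term where
  sign := t.sign * u.sign * parity (phaseShift t.field u.field) *
    ((numerator [e] t.field u.field).map (gapSign e)).prod
  exponent := t.exponent + u.exponent + zeroShift t.field u.field - (t.depth : ℤ) • e +
    ((numerator [e] t.field u.field).map (gapExponent e)).sum
  depth := t.depth + u.depth - (numerator [e] t.field u.field).length
  field := t.field.rescale e + u.field

/-- The product `t(z) u(w)` has at most a simple pole at `z = q^e w`, and the factors of its
numerator are of the form `z - q^(e ± 2) w`. -/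
def HasSimplePole (e : Exponent) (t u : Term) : Prop :=
  HasPoles [e] t.field u.field ∧
    (∀ n ∈ numerator [e] t.field u.field, n = e + (4, 0) ∨ n = e - (4, 0)) ∧
      (numerator [e] t.field u.field).length ≤ t.depth + u.depth

instance (e : Exponent) (t u : Term) : Decidable (HasSimplePole e t u) := by
  unfold HasSimplePole; infer_instance

theorem prod_gap (P : Params) {e : Exponent} {l : List Exponent}
    (h : ∀ n ∈ l, n = e + (4, 0) ∨ n = e - (4, 0)) :
    ((l.map (pw P)).map fun x => pw P e - x).prod =
      ((l.map (gapSign e)).prod : ℤ) * pw P (l.map (gapExponent e)).sum *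
        (qpow P.ħ 1 - qpow P.ħ (-1)) ^ l.length := by
  induction l with
  | nil => simp [pw_zero]
  | cons n l ih =>
    simp only [List.map_cons, List.prod_cons, List.sum_cons, List.length_cons]
    rw [ih fun n hn => h n (List.mem_cons_of_mem _ hn), pw_sub_pw P (h n List.mem_cons_self),
      pw_add]
    push_cast
    ring

theorem HasSimplePole.evalAt {P : Params} (hP : P.Generic) {e : Exponent} {t u : Term}
    (h : HasSimplePole e t u) (v : Fock) (T : ℤ) :
    evalAt (pw P e) (lin (pw P e) • prodDist (t.mode P) (u.mode P) v) T =
      (residue e t u).mode P T v := by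
  obtain ⟨h1, h2, h3⟩ := h
  have e1 := h1.operatorProduct hP v
  have hl : lins ([e].map (pw P)) = lin (pw P e) := by simp [lins]
  have hq := hP.one_sub_ne_zero
  have hp := pw_ne_zero P e
  rw [hl] at e1
  rw [prodDist_mode, smul_comm (lin _), e1, prefactor, evalAt_single_smul hp, evalAt_c_smul,
    evalAt_lins_smul hp _ (normalDist_bddZ _ _ _ _) (normalDist_bddW _ _ _ _), prod_gap P h2]
  have e2 : ∀ T, QSl21.evalAt (pw P e) (normalDist P (t.field.toField P) (u.field.toField P) v) T =
      (t.field.rescale e + u.field).mode P T v := fun T => by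
    rw [SymField.mode, toField_add, toField_rescale, ← evalAt_normalDist]; rfl
  rw [e2, smul_smul, smul_smul, mode, LinearMap.smul_apply, List.length_map]
  have hT : T - -(t.depth : ℤ) - -(u.depth : ℤ) - ((numerator [e] t.field u.field).length : ℤ) =
      T + ((residue e t u).depth : ℤ) := by
    simp only [residue]; omega
  have hpow : (qpow P.ħ 1 - qpow P.ħ (-1)) ^ (t.depth + u.depth) =
      (qpow P.ħ 1 - qpow P.ħ (-1)) ^ (residue e t u).depth *
        (qpow P.ħ 1 - qpow P.ħ (-1)) ^ (numerator [e] t.field u.field).length := by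
    rw [← pow_add]; congr 1; simp only [residue]; omega
  rw [hT]
  change _ = (residue e t u).coef P • (t.field.rescale e + u.field).mode P _ v
  congr 1
  have hs : (residue e t u).sign = t.sign * u.sign * parity (phaseShift t.field u.field) *
    ((numerator [e] t.field u.field).map (gapSign e)).prod := rfl
  have hx : pw P (residue e t u).exponent = pw P t.exponent * pw P u.exponent *
      pw P (zeroShift t.field u.field) * (pw P e ^ (t.depth : ℤ))⁻¹ *
        pw P ((numerator [e] t.field u.field).map (gapExponent e)).sum := by
    have : pw P ((t.depth : ℤ) • e) = pw P e ^ (t.depth : ℤ) := by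
      rw [pw, Exponent.val_zsmul, mul_comm, qpow_mul_intCast, pw]
    rw [← this, ← pw_neg, ← pw_add, ← pw_add, ← pw_add, ← pw_add, ← sub_eq_add_neg]
    rfl
  simp only [coef, hs, hx]
  rw [pow_add] at hpow
  have hqd := pow_ne_zero (residue e t u).depth hq
  have hqt := pow_ne_zero t.depth hq
  have hqu := pow_ne_zero u.depth hq
  rw [zpow_neg]
  push_cast
  rw [cast_parity]
  generalize (qpow P.ħ 1 - qpow P.ħ (-1)) ^ (residue e t u).depth = D at *
  generalize (qpow P.ħ 1 - qpow P.ħ (-1)) ^ t.depth = D1 at *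
  generalize (qpow P.ħ 1 - qpow P.ħ (-1)) ^ u.depth = D2 at *
  generalize (qpow P.ħ 1 - qpow P.ħ (-1)) ^ (numerator [e] t.field u.field).length = D3 at *
  have : D1⁻¹ * D2⁻¹ * D3 = D⁻¹ := by
    field_simp
    linear_combination -hpow
  rw [← this]
  ring

/-- The singular part of `t(z) u(w)`, as a pair of the position of the pole and the residue. -/
def singular (t u : Term) : List (Exponent × Term) :=
  match FormalSum.pos (FormalSum.collect (contraction t.field u.field)) with
  | [e] => [(e, residue e t u)]
  | _ => []

/-- The terms `t` and `u` commute, for even `τ`, or anticommute, for odd `τ`, up to a delta function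
supported at a simple pole. -/
def Local (τ : ℤ) (t u : Term) : Prop :=
  match FormalSum.pos (FormalSum.collect (contraction t.field u.field)) with
  | [e] => Related [e] [e] τ 0 t.field u.field ∧ HasSimplePole e t u
  | _ => Related [] [] τ 0 t.field u.field

instance (τ : ℤ) (t u : Term) : Decidable (Local τ t u) := by
  unfold Local; split <;> infer_instance

/-- The singular parts of all the products. -/
def singularParts (X Y : List Term) : List (Exponent × Term) :=
  (X.map fun t => (Y.map fun u => singular t u).flatten).flatten

/-- The value of a sum of residues in the commutator. -/
def deltaSum (P : Params) (l : List (Exponent × Term)) (N T : ℤ) : Module.End ℂ Fock :=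
  (l.map fun r => pw P r.1 ^ (-N - 1) • r.2.mode P T).sum

theorem deltaSum_append (P : Params) (l l' : List (Exponent × Term)) (N T : ℤ) :
    deltaSum P (l ++ l') N T = deltaSum P l N T + deltaSum P l' N T := by simp [deltaSum]

/-- The commutator of two terms with a simple pole in their product: by `delta_formula`, the two
expansions of the product differ by a delta function. -/
theorem Local.commutator {P : Params} (hP : P.Generic) {τ : ℤ} {t u : Term} (h : Local τ t u)
    (N M : ℤ) :
    t.mode P N * u.mode P M - (-1 : ℂ) ^ τ • (u.mode P M * t.mode P N) =
      deltaSum P (singular t u) N (N + M + 1) := by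
  refine LinearMap.ext fun v => ?_
  have hτ : ((-1 : ℂ) ^ τ * pw P 0) = (-1) ^ τ := by rw [pw_zero, mul_one]
  unfold Local at h
  unfold singular
  split at h
  · rename_i e he
    obtain ⟨h1, h2⟩ := h
    have e1 := mode_exchange hP h1 v
    have hl : lins ([e].map (pw P)) = lin (pw P e) := by simp [lins]
    rw [hl, hτ, smul_comm] at e1
    have := delta_formula (pw_ne_zero P e) (prodDist_bddW (u.mode_bdd P v))
      ((revDist_bddZ (f := u.mode P) (t.mode_bdd P v)).smul (c ((-1) ^ τ))) rfl e1.symm N M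
    rw [h2.evalAt hP, c_smul_apply] at this
    simpa [deltaSum, he, prodDist, revDist] using this
  · rename_i he
    have e1 := mode_exchange hP h v
    simp only [lins, List.map_nil, List.prod_nil, one_smul, hτ] at e1
    have := congrFun e1 (N, M)
    rw [c_smul_apply] at this
    simp only [deltaSum, List.map_nil, List.sum_nil, LinearMap.zero_apply]
    exact sub_eq_zero.2 this

/-- The commutator of two sums of terms is the sum of the delta functions of the singular parts. -/
theorem modes_commutator {P : Params} (hP : P.Generic) {τ : ℤ} {X Y : List Term}
    (h : ∀ t ∈ X, ∀ u ∈ Y, Local τ t u) (N M : ℤ) :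
    modes P X N * modes P Y M - (-1 : ℂ) ^ τ • (modes P Y M * modes P X N) =
      deltaSum P (singularParts X Y) N (N + M + 1) := by
  induction X with
  | nil =>
    simp only [modes_nil, zero_mul, mul_zero, smul_zero, singularParts, deltaSum, List.map_nil,
      List.flatten_nil, List.sum_nil]
    exact sub_self (0 : Module.End ℂ Fock)
  | cons t X ih =>
    have h1 : t.mode P N * modes P Y M - (-1 : ℂ) ^ τ • (modes P Y M * t.mode P N) =
        deltaSum P ((Y.map fun u => singular t u).flatten) N (N + M + 1) := by
      have ht := h t List.mem_cons_self
      clear h ih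
      induction Y with
      | nil =>
        simp only [modes_nil, zero_mul, mul_zero, smul_zero, deltaSum, List.map_nil,
          List.flatten_nil, List.sum_nil]
        exact sub_self (0 : Module.End ℂ Fock)
      | cons u Y ih =>
        rw [List.map_cons, List.flatten_cons, deltaSum_append,
          ← ih fun u hu => ht u (List.mem_cons_of_mem _ hu),
          ← (ht u List.mem_cons_self).commutator hP, modes_cons, mul_add, add_mul, smul_add]
        abel
    have h2 : singularParts (t :: X) Y =
        (Y.map fun u => singular t u).flatten ++ singularParts X Y := rfl
    rw [h2, deltaSum_append, ← h1, ← ih fun t ht => h t (List.mem_cons_of_mem _ ht), modes_cons,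
      add_mul, mul_add, smul_add]
    abel

/-- Terms with opposite signs. -/
def Opposite (t u : Term) : Prop :=
  t.sign = -u.sign ∧ t.exponent = u.exponent ∧ t.depth = u.depth ∧ t.field.Equal u.field

instance (t u : Term) : Decidable (Opposite t u) := by unfold Opposite; infer_instance

theorem Opposite.mode_add {t u : Term} (h : Opposite t u) (P : Params) (N : ℤ) :
    t.mode P N + u.mode P N = 0 := by
  obtain ⟨h1, h2, h3, h4⟩ := h
  rw [mode, mode, coef, coef, h1, h2, h3, h4.mode_eq]
  push_cast
  module

/-- Equality of terms, up to the form of the fields. -/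
def Equal (t u : Term) : Prop :=
  t.sign = u.sign ∧ t.exponent = u.exponent ∧ t.depth = u.depth ∧ t.field.Equal u.field

instance (t u : Term) : Decidable (Equal t u) := by unfold Equal; infer_instance

theorem Equal.mode_eq {t u : Term} (h : Equal t u) (P : Params) (N : ℤ) :
    t.mode P N = u.mode P N := by
  obtain ⟨h1, h2, h3, h4⟩ := h
  rw [mode, mode, coef, coef, h1, h2, h3, h4.mode_eq]

end Term

namespace SymField

/-- The exponents of the currents `ψ^{±,i}(z)`. -/
def psiField : Sgn → Fin 2 → SymField
  | .plus, 0 => plus (.a 0) (1, 0) + plus (.b .b12) (0, 1) + plus (.b .b12) (4, 1) +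
      plus (.b .b13) (4, 1) - plus (.b .b23) (2, 1)
  | .plus, 1 => plus (.a 1) (1, 0) - plus (.b .b12) (2, 1) - plus (.b .b13) (2, 1)
  | .minus, 0 => minus (.a 0) (-1, 0) + minus (.b .b12) (0, -1) + minus (.b .b12) (-4, -1) +
      minus (.b .b13) (-4, -1) - minus (.b .b23) (-2, -1)
  | .minus, 1 => minus (.a 1) (-1, 0) - minus (.b .b12) (-2, -1) - minus (.b .b13) (-2, -1)

end SymField

namespace Term

open SymField

/-- The residues add up to zero, in pairs. -/
def Cancels : List (Exponent × Term) → Prop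
  | [a, b] => a.1 = b.1 ∧ Opposite a.2 b.2
  | _ => False

instance (l : List (Exponent × Term)) : Decidable (Cancels l) := by
  unfold Cancels; split <;> infer_instance

theorem Cancels.deltaSum_eq {l : List (Exponent × Term)} (h : Cancels l) (P : Params) (N T : ℤ) :
    deltaSum P l N T = 0 := by
  match l, h with
  | [a, b], h =>
    simp only [deltaSum, List.map_cons, List.map_nil, List.sum_cons, List.sum_nil, add_zero]
    rw [h.1, ← smul_add, h.2.mode_add, smul_zero]

/-- The residues are those of `ψ^{+,i}` and `-ψ^{-,i}`, apart from residues that add up to zero. -/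
def IsPsi (i : Fin 2) : List (Exponent × Term) → Prop
  | [a, b] => a.1 = (0, 2) ∧ Equal a.2 ⟨1, 0, 1, (psiField .plus i).rescale (0, 1)⟩ ∧
      b.1 = (0, -2) ∧ Equal b.2 ⟨-1, 0, 1, (psiField .minus i).rescale (0, -1)⟩
  | [a, r, b, r'] => (a.1 = (0, 2) ∧ Equal a.2 ⟨1, 0, 1, (psiField .plus i).rescale (0, 1)⟩ ∧
      b.1 = (0, -2) ∧ Equal b.2 ⟨-1, 0, 1, (psiField .minus i).rescale (0, -1)⟩) ∧
        r.1 = r'.1 ∧ Opposite r.2 r'.2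
  | _ => False

instance (i : Fin 2) (l : List (Exponent × Term)) : Decidable (IsPsi i l) := by
  unfold IsPsi; split <;> infer_instance

end Term

open SymField Term

/-- The terms of `X^{+,i}` and `X^{-,j}` commute or anticommute up to delta functions, because the
zero modes have been corrected by the phases. -/
theorem local_plus_minus : ∀ i j : Fin 2, ∀ t ∈ currentTerms .plus i, ∀ u ∈ currentTerms .minus j,
    Local (nodeParity i * nodeParity j : ℕ) t u := by decide +kernel

theorem cancels_of_ne : ∀ i j : Fin 2, i ≠ j →
    Cancels (singularParts (currentTerms .plus i) (currentTerms .minus j)) := by decide +kernel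

/-- The residues in the commutator of `X^{+,i}` and `X^{-,i}`. -/
theorem isPsi : ∀ i : Fin 2,
    IsPsi i (singularParts (currentTerms .plus i) (currentTerms .minus i)) := by decide +kernel

end QSl21

namespace QSl21

open L₂

/-! ### Exchange relations between currents -/

section Swap

variable {V : Type*} [AddCommGroup V] [Module ℂ V]

theorem swapDist_add (K L : Dist₂ V) : swapDist (K + L) = swapDist K + swapDist L := rfl

theorem swapDist_prodDist (e f : ℤ → Module.End ℂ V) (v : V) :
    swapDist (prodDist f e v) = revDist e f v := rfl

theorem BddW.swapDist {K : Dist₂ V} (h : BddW K) : BddZ (swapDist K) := by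
  obtain ⟨a, ha⟩ := h
  exact ⟨a, fun N M hN => ha M N hN⟩

theorem BddZ.swapDist {K : Dist₂ V} (h : BddZ K) : BddW (swapDist K) := by
  obtain ⟨a, ha⟩ := h
  exact ⟨a, fun N M hM => ha M N hM⟩

theorem evalAt_swapDist {p : ℂ} (hp : p ≠ 0) (B : Dist₂ V) (T : ℤ) :
    evalAt p⁻¹ (swapDist B) T = (p ^ T)⁻¹ • evalAt p B T := by
  rw [evalAt, evalAt, smul_finsum, ← finsum_comp_equiv (Equiv.subLeft T)]
  refine finsum_congr fun k => ?_
  simp only [Equiv.subLeft_apply, swapDist, sub_sub_cancel, smul_smul]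
  congr 1
  rw [inv_zpow, zpow_sub₀ hp, inv_div, div_eq_inv_mul]

/-- If the exponents of `w` in `K` are bounded below and `(z - p w) K` vanishes at `z = p w`, then
the exponents of `z` in `K` are bounded below if those in `(z - p w) K` are. -/
theorem BddW.bddZ_of_evalAt_eq_zero {p : ℂ} (hp : p ≠ 0) {K : Dist₂ V} (hK : BddW K)
    (hB : BddZ (lin p • K)) (h0 : ∀ T, evalAt p (lin p • K) T = 0) : BddZ K := by
  have h1 := swapDist_lin_smul hp K
  have h2 : lin p⁻¹ • QSl21.swapDist K = c (-p)⁻¹ • QSl21.swapDist (lin p • K) := by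
    rw [h1, smul_smul, ← c_mul, inv_mul_cancel₀ (neg_ne_zero.2 hp), c_one, one_smul]
  exact (hK.swapDist.bddW_of_evalAt_eq_zero (inv_ne_zero hp) h2 (hB.swapDist.smul _) fun T => by
    rw [evalAt_c_smul, evalAt_swapDist hp, h0, smul_zero, smul_zero]).swapDist

end Swap

theorem L₂.smul_left_comm {V : Type*} [AddCommGroup V] [Module ℂ V] (a b : L₂) (K : Dist₂ V) :
    a • b • K = b • a • K := by rw [← mul_smul, mul_comm, mul_smul]

theorem lin_smul_cancel_add {V : Type*} [AddCommGroup V] [Module ℂ V] {A A' R R' : Dist₂ V}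
    {p x y k : ℂ} (h1 : BddW (A + A')) (h2 : BddW (R + R'))
    (e1 : (lin p * lin x) • A = c k • (lin p * lin y) • R)
    (e2 : (lin p * lin x) • A' = c k • (lin p * lin y) • R') :
    lin x • (A + A') = (c k * lin y) • (R + R') := by
  refine (h1.smul _).lin_smul_cancel (h2.smul _) (p := p) ?_
  rw [← mul_smul, smul_add, e1, e2, ← smul_add, ← smul_add, ← mul_smul, ← mul_smul]
  congr 1
  ring

/-- The relation `a(z, w) e(z) f(w) = b(z, w) f(w) e(z)`. -/
def Exchange (a b : L₂) (e f : ℤ → Module.End ℂ Fock) : Prop :=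
  ∀ v, a • prodDist e f v = b • revDist e f v

theorem prodDist_add_left (e e' f : ℤ → Module.End ℂ Fock) (v : Fock) :
    prodDist (e + e') f v = prodDist e f v + prodDist e' f v := rfl

theorem prodDist_add_right (e f f' : ℤ → Module.End ℂ Fock) (v : Fock) :
    prodDist e (f + f') v = prodDist e f v + prodDist e f' v :=
  Dist.ext fun x => map_add (e x.1) _ _

theorem revDist_add_left (e e' f : ℤ → Module.End ℂ Fock) (v : Fock) :
    revDist (e + e') f v = revDist e f v + revDist e' f v :=
  Dist.ext fun x => map_add (f x.2) _ _

theorem revDist_add_right (e f f' : ℤ → Module.End ℂ Fock) (v : Fock) :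
    revDist e (f + f') v = revDist e f v + revDist e f' v := rfl

theorem Exchange.add_left {a b : L₂} {e e' f : ℤ → Module.End ℂ Fock} (h : Exchange a b e f)
    (h' : Exchange a b e' f) : Exchange a b (e + e') f := fun v => by
  rw [prodDist_add_left, revDist_add_left, smul_add, smul_add, h v, h' v]

theorem Exchange.add_right {a b : L₂} {e f f' : ℤ → Module.End ℂ Fock} (h : Exchange a b e f)
    (h' : Exchange a b e f') : Exchange a b e (f + f') := fun v => by
  rw [prodDist_add_right, revDist_add_right, smul_add, smul_add, h v, h' v]

/-- The exchange relation with the factors `z - ξ w` and `ξ z - w`. -/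
def QExchange (ξ : ℂ) : (ℤ → Module.End ℂ Fock) → (ℤ → Module.End ℂ Fock) → Prop :=
  Exchange (lin ξ) (c ξ * lin ξ⁻¹)

theorem QExchange.coeff {ξ : ℂ} (hξ : ξ ≠ 0) {e f : ℤ → Module.End ℂ Fock}
    (h : QExchange ξ e f) (N M : ℤ) :
    e (N - 1) * f M - ξ • (f M * e (N - 1)) + (f (M - 1) * e N - ξ • (e N * f (M - 1))) = 0 := by
  refine LinearMap.ext fun v => ?_
  have h1 := congrFun (h v) (N, M)
  rw [mul_smul, c_smul_apply, lin_smul_apply, lin_smul_apply] at h1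
  simp only [prodDist, revDist, smul_sub, smul_smul, mul_inv_cancel₀ hξ, one_smul] at h1
  have h2 : ∀ a b c d : Fock, a - b = c - d → a - c + (d - b) = 0 := fun a b c d h => by
    rw [sub_eq_sub_iff_add_eq_add] at h
    rw [sub_add_sub_comm, h]
    abel
  exact h2 _ _ _ _ h1

namespace Term

open SymField

theorem lins_singleton (P : Params) (e : Exponent) : lins ([e].map (pw P)) = lin (pw P e) := by
  rw [lins, List.map_singleton, List.map_singleton, List.prod_singleton]

theorem lins_pair (P : Params) (e e' : Exponent) :
    lins ([e, e'].map (pw P)) = lin (pw P e) * lin (pw P e') := by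
  rw [lins, List.map_cons, List.map_cons, List.map_singleton, List.map_singleton, List.prod_cons,
    List.prod_singleton]

theorem qExchange_modes {P : Params} (hP : P.Generic) {ξ : Exponent} {X Y : List Term}
    (h : ∀ t ∈ X, ∀ u ∈ Y, Related [ξ] [-ξ] 0 ξ t.field u.field) :
    QExchange (pw P ξ) (modes P X) (modes P Y) := fun v => by
  have := modes_exchange hP h v
  rw [lins_singleton, lins_singleton, zpow_zero, one_mul, pw_neg, ← mul_smul] at this
  exact this

theorem modes_bdd (P : Params) (X : List Term) (v : Fock) :
    ∃ a : ℤ, ∀ N < a, modes P X N v = 0 := by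
  induction X with
  | nil => exact ⟨0, fun N _ => by rw [modes_nil, LinearMap.zero_apply]⟩
  | cons t X ih =>
    obtain ⟨a, ha⟩ := ih
    obtain ⟨b, hb⟩ := t.mode_bdd P v
    exact ⟨min a b, fun N hN => by
      rw [modes_cons, LinearMap.add_apply, ha N (by omega), hb N (by omega), add_zero]⟩

theorem bddZ_of_hasPoles {P : Params} (hP : P.Generic) {ds : List Exponent} {t u : Term}
    (h : HasPoles ds t.field u.field) (v : Fock) :
    BddZ (lins (ds.map (pw P)) • prodDist (t.mode P) (u.mode P) v) := by
  rw [prodDist_mode, L₂.smul_left_comm, h.operatorProduct hP]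
  have h1 := (normalDist_bddZ P (t.field.toField P) (u.field.toField P) v).smul
    (lins ((numerator ds t.field u.field).map (pw P)))
  have h2 := h1.smul (c ((-1) ^ phaseShift t.field u.field * pw P (zeroShift t.field u.field)))
  exact h2.smul (prefactor P t u)

/-- The four terms have two products with a pole at the same point, and opposite residues. -/
def PolesCancel (e : Exponent) (t t' u u' : Term) : Prop :=
  HasSimplePole e t u ∧ HasSimplePole e t' u' ∧ Opposite (residue e t u) (residue e t' u')

instance (e : Exponent) (t t' u u' : Term) : Decidable (PolesCancel e t t' u u') := by
  unfold PolesCancel; infer_instance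

theorem PolesCancel.bddZ {P : Params} (hP : P.Generic) {e : Exponent} {t t' u u' : Term}
    (h : PolesCancel e t t' u u') (v : Fock) :
    BddZ (prodDist (t.mode P) (u.mode P) v + prodDist (t'.mode P) (u'.mode P) v) := by
  obtain ⟨h1, h2, h3⟩ := h
  have b1 := bddZ_of_hasPoles hP h1.1 v
  have b2 := bddZ_of_hasPoles hP h2.1 v
  rw [lins_singleton] at b1 b2
  have w1 := prodDist_bddW (e := t.mode P) (u.mode_bdd P v)
  have w2 := prodDist_bddW (e := t'.mode P) (u'.mode_bdd P v)
  refine (w1.add w2).bddZ_of_evalAt_eq_zero (pw_ne_zero P e) ?_ fun T => ?_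
  · rw [smul_add]; exact b1.add b2
  · rw [smul_add, evalAt_add _ b1 (w1.smul _) b2 (w2.smul _), h1.evalAt hP, h2.evalAt hP,
      ← LinearMap.add_apply, h3.mode_add, LinearMap.zero_apply]

/-- If poles cancel in the products in one order, then the exchange relation may be divided by the
corresponding factor. -/
theorem PolesCancel.qExchange {P : Params} (hP : P.Generic) {e ξ : Exponent} {t t' u u' : Term}
    (h : PolesCancel (-e) u u' t t') (h1 : Related [e, ξ] [e, -ξ] 0 ξ t.field u.field)
    (h2 : Related [e, ξ] [e, -ξ] 0 ξ t'.field u'.field) (v : Fock) :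
    lin (pw P ξ) • (prodDist (t.mode P) (u.mode P) v + prodDist (t'.mode P) (u'.mode P) v) =
      (c (pw P ξ) * lin (pw P ξ)⁻¹) •
        (revDist (t.mode P) (u.mode P) v + revDist (t'.mode P) (u'.mode P) v) := by
  have w1 := (prodDist_bddW (e := t.mode P) (u.mode_bdd P v)).add
    (prodDist_bddW (e := t'.mode P) (u'.mode_bdd P v))
  have w2 := (h.bddZ hP v).swapDist
  rw [swapDist_add, swapDist_prodDist, swapDist_prodDist] at w2
  have e1 := mode_exchange hP h1 v
  have e2 := mode_exchange hP h2 v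
  rw [lins_pair, lins_pair, zpow_zero, one_mul, pw_neg] at e1 e2
  exact lin_smul_cancel_add w1 w2 e1 e2

end Term

/-! ### The exchange relations of the realization -/

open SymField Term

namespace SymField

/-- The `n`-th term of a current. -/
def currentTerm (s : Sgn) (i : Fin 2) (n : ℕ) : Term :=
  (currentTerms s i).getD n ⟨0, 0, 0, phases 0⟩

end SymField

/-- The exchange relation of the sums of terms whose products have cancelling poles. -/
theorem qExchange_pole (P : Params) (hP : P.Generic) :
    QExchange (pw P (2, 0)) (modes P [currentTerm .minus 0 0, currentTerm .minus 0 2])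
      (modes P [currentTerm .minus 1 1, currentTerm .minus 1 3]) := fun v => by
  have h1 := PolesCancel.qExchange (P := P) hP (e := (-6, -4)) (ξ := (2, 0))
    (t := currentTerm .minus 0 0) (u := currentTerm .minus 1 3) (t' := currentTerm .minus 0 2)
    (u' := currentTerm .minus 1 1) (by decide +kernel) (by decide +kernel) (by decide +kernel) v
  have h2 := qExchange_modes hP (ξ := (2, 0)) (X := [currentTerm .minus 0 0])
    (Y := [currentTerm .minus 1 1]) (by decide +kernel) v
  have h3 := qExchange_modes hP (ξ := (2, 0)) (X := [currentTerm .minus 0 2])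
    (Y := [currentTerm .minus 1 3]) (by decide +kernel) v
  simp only [prodDist_cons_left, prodDist_nil_left, prodDist_cons_right, prodDist_nil_right,
    revDist_cons_left, revDist_nil_left, revDist_cons_right, revDist_nil_right, add_zero,
    smul_add] at h1 h2 h3 ⊢
  rw [h2, h3]
  generalize (c (pw P (2, 0)) * lin (pw P (2, 0))⁻¹) = b at *
  generalize lin (pw P (2, 0)) = a at *
  have h4 : ∀ x y z w y' z' : Dist₂ Fock, z + y = z' + y' → x + y + (z + w) = x + y' + (z' + w) :=
    fun x y z w y' z' h => by
      rw [add_assoc, ← add_assoc y, add_comm y, h, add_comm z', add_assoc, add_assoc]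
  exact h4 _ _ _ _ _ _ h1

end QSl21

namespace QSl21

/-! ### The Serre relation from wheel conditions -/

/-- Laurent polynomials in three variables. -/
abbrev L₃ : Type := AddMonoidAlgebra ℂ (ℤ × ℤ × ℤ)

/-- Distributions in three variables. -/
abbrev Dist₃ (V : Type*) : Type _ := Dist (ℤ × ℤ × ℤ) V

namespace L₃

/-- The scalar `t`. -/
def c (t : ℂ) : L₃ := AddMonoidAlgebra.single 0 t
/-- The first variable. -/
def z₁ : L₃ := AddMonoidAlgebra.single (1, 0, 0) 1
/-- The second variable. -/
def z₂ : L₃ := AddMonoidAlgebra.single (0, 1, 0) 1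
/-- The third variable. -/
def w : L₃ := AddMonoidAlgebra.single (0, 0, 1) 1

theorem c_mul (a b : ℂ) : c (a * b) = c a * c b := by simp [c, AddMonoidAlgebra.single_mul_single]
theorem c_one : c 1 = 1 := rfl
theorem c_sub (a b : ℂ) : c (a - b) = c a - c b := AddMonoidAlgebra.single_sub ..

end L₃

section Wheel

open L₃

variable {V : Type*} [AddCommGroup V] [Module ℂ V]

theorem c₃_smul_apply (t : ℂ) (F : Dist₃ V) (x : ℤ × ℤ × ℤ) : (c t • F) x = t • F x := by
  simp [c]

theorem z₁_smul_apply (F : Dist₃ V) (i j k : ℤ) : (z₁ • F) (i, j, k) = F (i - 1, j, k) := by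
  simp [z₁]

theorem z₂_smul_apply (F : Dist₃ V) (i j k : ℤ) : (z₂ • F) (i, j, k) = F (i, j - 1, k) := by
  simp [z₂]

theorem w₃_smul_apply (F : Dist₃ V) (i j k : ℤ) : (w • F) (i, j, k) = F (i, j, k - 1) := by
  simp [L₃.w]

/-- `F` vanishes on the set `C` of exponents; `C` is a lower set below, so that the property passes
to polynomial multiples of `F`. -/
def VanishesOn (C : Set (ℤ × ℤ × ℤ)) (F : Dist₃ V) : Prop := ∀ x ∈ C, F x = 0

namespace VanishesOn

variable {C : Set (ℤ × ℤ × ℤ)} {F G : Dist₃ V}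

theorem add (hF : VanishesOn C F) (hG : VanishesOn C G) : VanishesOn C (F + G) := fun x hx => by
  rw [Dist.add_apply, hF x hx, hG x hx, add_zero]

theorem c_smul (hF : VanishesOn C F) (t : ℂ) : VanishesOn C (c t • F) := fun x hx => by
  rw [c₃_smul_apply, hF x hx, smul_zero]

theorem z₁_smul (hC : IsLowerSet C) (hF : VanishesOn C F) : VanishesOn C (z₁ • F) :=
  fun ⟨i, j, k⟩ hx => by
    rw [z₁_smul_apply]
    exact hF _ (hC (show (i - 1, j, k) ≤ (i, j, k) from ⟨by simp, le_rfl⟩) hx)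

theorem z₂_smul (hC : IsLowerSet C) (hF : VanishesOn C F) : VanishesOn C (z₂ • F) :=
  fun ⟨i, j, k⟩ hx => by
    rw [z₂_smul_apply]
    exact hF _ (hC (show (i, j - 1, k) ≤ (i, j, k) from ⟨le_rfl, by simp, le_rfl⟩) hx)

theorem w_smul (hC : IsLowerSet C) (hF : VanishesOn C F) : VanishesOn C (w • F) :=
  fun ⟨i, j, k⟩ hx => by
    rw [w₃_smul_apply]
    exact hF _ (hC (show (i, j, k - 1) ≤ (i, j, k) from ⟨le_rfl, le_rfl, by simp⟩) hx)

theorem lin_smul (hC : IsLowerSet C) (hF : VanishesOn C F) (a b d : ℂ) :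
    VanishesOn C ((c a * z₁ + c b * z₂ + c d * w) • F) := by
  rw [add_smul, add_smul, mul_smul, mul_smul, mul_smul]
  exact (((hF.z₁_smul hC).c_smul a).add ((hF.z₂_smul hC).c_smul b)).add
    ((hF.w_smul hC).c_smul d)

end VanishesOn

/-- A distribution supported on the line `z₁ = t w`, `w = t z₂` vanishes if, in every total degree,
some coefficient vanishes. -/
theorem eq_zero_of_wheel {t : ℂ} (ht : t ≠ 0) {G : Dist₃ V} (h1 : (z₁ - c t * w) • G = 0)
    (h2 : (w - c t * z₂) • G = 0)
    (h0 : ∀ T : ℤ, ∃ i j k : ℤ, i + j + k = T ∧ G (i, j, k) = 0) : G = 0 := by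
  have e1 : ∀ i j k, G (i - 1, j, k) = t • G (i, j, k - 1) := fun i j k => by
    have := congrFun h1 (i, j, k)
    rw [sub_smul, mul_smul, Dist.sub_apply, z₁_smul_apply, c₃_smul_apply, w₃_smul_apply] at this
    exact sub_eq_zero.1 this
  have e2 : ∀ i j k, G (i, j, k - 1) = t • G (i, j - 1, k) := fun i j k => by
    have := congrFun h2 (i, j, k)
    rw [sub_smul, mul_smul, Dist.sub_apply, w₃_smul_apply, c₃_smul_apply, z₂_smul_apply] at this
    exact sub_eq_zero.1 this
  have s1 : ∀ (n : ℤ) (i j k : ℤ), G (i, j, k) = 0 → G (i + n, j, k - n) = 0 := by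
    intro n
    induction n using Int.induction_on with
    | zero => intro i j k h; simpa using h
    | succ n ih =>
      intro i j k h
      have := e1 (i + n + 1) j (k - n)
      rw [add_sub_cancel_right, ih i j k h] at this
      have h' := (smul_eq_zero.1 this.symm).resolve_left ht
      rw [show i + ((n : ℤ) + 1) = i + n + 1 by ring, show k - ((n : ℤ) + 1) = k - n - 1 by ring]
      exact h'
    | pred n ih =>
      intro i j k h
      have := e1 (i + -n) j (k - -n + 1)
      rw [add_sub_cancel_right, ih i j k h, smul_zero] at this
      rw [show i + (-(n : ℤ) - 1) = i + -n - 1 by ring,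
        show k - (-(n : ℤ) - 1) = k - -n + 1 by ring]
      exact this
  have s2 : ∀ (n : ℤ) (i j k : ℤ), G (i, j, k) = 0 → G (i, j + n, k - n) = 0 := by
    intro n
    induction n using Int.induction_on with
    | zero => intro i j k h; simpa using h
    | succ n ih =>
      intro i j k h
      have := e2 i (j + n + 1) (k - n)
      rw [add_sub_cancel_right, ih i j k h, smul_zero] at this
      rw [show j + ((n : ℤ) + 1) = j + n + 1 by ring, show k - ((n : ℤ) + 1) = k - n - 1 by ring]
      exact this
    | pred n ih =>
      intro i j k h
      have := e2 i (j + -n) (k - -n + 1)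
      rw [add_sub_cancel_right, ih i j k h] at this
      have h' := (smul_eq_zero.1 this.symm).resolve_left ht
      rw [show j + (-(n : ℤ) - 1) = j + -n - 1 by ring,
        show k - (-(n : ℤ) - 1) = k - -n + 1 by ring]
      exact h'
  refine Dist.ext fun ⟨i, j, k⟩ => ?_
  obtain ⟨i', j', k', hT, h⟩ := h0 (i + j + k)
  have := s2 (j - j') _ _ _ (s1 (i - i') i' j' k' h)
  rw [add_sub_cancel, add_sub_cancel, show k' - (i - i') - (j - j') = k by omega] at this
  exact this

/-- A region where two of the three exponents are bounded above contains exponents of every total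
degree. -/
theorem exists_mem_degree (a b : ℤ) (T : ℤ) :
    (∃ i j k : ℤ, i + j + k = T ∧ i < a ∧ j < b) ∧ (∃ i j k : ℤ, i + j + k = T ∧ i < a ∧ k < b) ∧
      ∃ i j k : ℤ, i + j + k = T ∧ j < a ∧ k < b :=
  ⟨⟨a - 1, b - 1, T - (a - 1) - (b - 1), by omega, by omega, by omega⟩,
    ⟨a - 1, T - (a - 1) - (b - 1), b - 1, by omega, by omega, by omega⟩,
    ⟨T - (a - 1) - (b - 1), a - 1, b - 1, by omega, by omega, by omega⟩⟩

/-- Six distributions `F₁, …, F₃'`, to be thought of as `e f g`, `e g f`, `g e f`, `f e g`, `f g e`,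
`g f e` for fields `e(z₁)`, `f(z₂)`, `g(w)`, that are related by exchange relations. -/
structure Hexagon (t : ℂ) (F₁ F₂ F₃ F₁' F₂' F₃' : Dist₃ V) : Prop where
  efg : (z₂ - c t * w) • F₁ + (w - c t * z₂) • F₂ = 0
  egf : (z₁ - c t * w) • F₂ + (w - c t * z₁) • F₃ = 0
  feg : (z₁ - c t * w) • F₁' + (w - c t * z₁) • F₂' = 0
  fge : (z₂ - c t * w) • F₂' + (w - c t * z₂) • F₃' = 0
  ef_g : (c t * c t * z₁ - z₂) • F₁ + (c t * c t * z₂ - z₁) • F₁' = 0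
  g_ef : (c t * c t * z₁ - z₂) • F₃ + (c t * c t * z₂ - z₁) • F₃' = 0

/-- The Serre expression, times `t`. -/
def serreDist (t : ℂ) (F₁ F₂ F₃ F₁' F₂' F₃' : Dist₃ V) : Dist₃ V :=
  c t • F₁ - (c t * c t + 1) • F₂ + c t • F₃ +
    (c t • F₁' - (c t * c t + 1) • F₂' + c t • F₃')

namespace Hexagon

variable {t : ℂ} {F₁ F₂ F₃ F₁' F₂' F₃' : Dist₃ V}

/-- The exchange relations alone show that the unmixed products of linear factors kill the Serre
expression; no boundedness is needed. -/
theorem mul_serreDist (h : Hexagon t F₁ F₂ F₃ F₁' F₂' F₃') :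
    (z₁ - c t * w) • (z₂ - c t * w) • serreDist t F₁ F₂ F₃ F₁' F₂' F₃' = 0 ∧
    (w - c t * z₁) • (w - c t * z₂) • serreDist t F₁ F₂ F₃ F₁' F₂' F₃' = 0 := by
  obtain ⟨h1, h2, h1', h2', hR, hR'⟩ := h
  rw [serreDist]
  generalize c t = T at *
  generalize z₁ = z at *
  generalize z₂ = y at *
  generalize L₃.w = w at *
  constructor
  · linear_combination (norm := module) (T * (z - T * w)) • h1 -
      (T * (w - T * y) + (T * T + 1) * (y - T * w)) • h2 + (T * (y - T * w)) • h1' -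
      (T * (w - T * z) + (T * T + 1) * (z - T * w)) • h2' + (w * (T * T - 1)) • hR'
  · linear_combination (norm := module) (-T * (z - T * w) - (T * T + 1) * (w - T * z)) • h1 +
      (T * (w - T * y)) • h2 - (T * (y - T * w) + (T * T + 1) * (w - T * y)) • h1' +
      (T * (w - T * z)) • h2' + (w * (T * T - 1)) • hR

/-- On the product of the two mixed factors, the Serre expression involves only three of the six
distributions. -/
theorem mixed_mul_serreDist (h : Hexagon t F₁ F₂ F₃ F₁' F₂' F₃') :
    (w - c t * z₁) • (z₂ - c t * w) • serreDist t F₁ F₂ F₃ F₁' F₂' F₃' =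
      (c (t * t) * z₁ + c (-1) * z₂ + c 0 * w) • w • c (1 - t * t) • F₂ +
        (c (-t) * z₁ + c 0 * z₂ + c 1 * w) • (c 0 * z₁ + c 1 * z₂ + c (-t) * w) • c t • F₁' +
        ((c (-t) * z₁ + c 0 * z₂ + c 1 * w) • (c 0 * z₁ + c (-t) * z₂ + c 1 * w) •
            c (t * t + 1) • F₃' +
          (c (-t) * z₁ + c 0 * z₂ + c 1 * w) • (c 0 * z₁ + c 1 * z₂ + c (-t) * w) •
            c t • F₃') := by
  obtain ⟨h1, h2, h1', h2', hR, hR'⟩ := h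
  have hc : c (t * t + 1) = c t * c t + 1 := by
    rw [← c_mul, ← c_one]; exact AddMonoidAlgebra.single_add ..
  have hn : c (-t) = -c t := AddMonoidAlgebra.single_neg ..
  have h0 : c 0 = 0 := AddMonoidAlgebra.single_zero ..
  have hn1 : c (-1) = -1 := by rw [← c_one]; exact AddMonoidAlgebra.single_neg ..
  rw [serreDist, hc, hn, h0, hn1, c_sub, c_one, c_mul]
  generalize c t = T at *
  generalize z₁ = z at *
  generalize z₂ = y at *
  generalize L₃.w = w at *
  linear_combination (norm := module) (T * (w - T * z)) • h1 + (T * (y - T * w)) • h2 -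
    ((T * T + 1) * (w - T * z)) • h2'

/-- A mixed product of linear factors kills the Serre expression as soon as the three distributions
in `mixed_mul_serreDist` vanish on a common region `C`: multiplied by the mixed factors, the
expression is supported on a line, by `mul_serreDist`, and so it is determined by one coefficient in
every total degree. -/
theorem mixed_eq_zero (ht : t ≠ 0) (h : Hexagon t F₁ F₂ F₃ F₁' F₂' F₃') {C : Set (ℤ × ℤ × ℤ)}
    (hC : IsLowerSet C) (hT : ∀ T : ℤ, ∃ i j k : ℤ, i + j + k = T ∧ (i, j, k) ∈ C)
    (v2 : VanishesOn C F₂) (v1' : VanishesOn C F₁') (v3' : VanishesOn C F₃') :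
    (w - c t * z₁) • (z₂ - c t * w) • serreDist t F₁ F₂ F₃ F₁' F₂' F₃' = 0 := by
  have v : VanishesOn C ((w - c t * z₁) • (z₂ - c t * w) •
      serreDist t F₁ F₂ F₃ F₁' F₂' F₃') := by
    rw [h.mixed_mul_serreDist]
    exact ((((v2.c_smul _).w_smul hC).lin_smul hC _ _ _).add
      (((v1'.c_smul _).lin_smul hC _ _ _).lin_smul hC _ _ _)).add
        ((((v3'.c_smul _).lin_smul hC _ _ _).lin_smul hC _ _ _).add
          (((v3'.c_smul _).lin_smul hC _ _ _).lin_smul hC _ _ _))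
  refine eq_zero_of_wheel ht ?_ ?_ fun T => ?_
  · have := congrArg (fun G => (w - c t * z₁) • G) h.mul_serreDist.1
    simp only [smul_zero] at this
    rw [← this]
    module
  · have := congrArg (fun G => (z₂ - c t * w) • G) h.mul_serreDist.2
    simp only [smul_zero] at this
    rw [← this]
    module
  · obtain ⟨i, j, k, hs, hm⟩ := hT T
    exact ⟨i, j, k, hs, v _ hm⟩

end Hexagon

/-- Exchanges the first two variables. -/
def swap₁₂ (F : Dist₃ V) : Dist₃ V := fun x => F (x.2.1, x.1, x.2.2)

theorem swap₁₂_lin (F : Dist₃ V) (t : ℂ) :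
    swap₁₂ ((w - c t * z₁) • F) = (w - c t * z₂) • swap₁₂ F ∧
      swap₁₂ ((z₂ - c t * w) • F) = (z₁ - c t * w) • swap₁₂ F := by
  constructor <;> refine Dist.ext fun ⟨i, j, k⟩ => ?_ <;>
    simp only [swap₁₂, sub_smul, mul_smul, Dist.sub_apply, c₃_smul_apply, z₁_smul_apply,
      z₂_smul_apply, w₃_smul_apply]

/-- A distribution is zero if the two unmixed and the two mixed products of linear factors kill it:
these four products generate the unit ideal of the Laurent polynomials. -/
theorem eq_zero_of_mixed {t : ℂ} (ht : t * t ≠ 1) {G : Dist₃ V}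
    (h1 : (z₁ - c t * w) • (z₂ - c t * w) • G = 0) (h2 : (w - c t * z₁) • (w - c t * z₂) • G = 0)
    (h3 : (w - c t * z₁) • (z₂ - c t * w) • G = 0)
    (h4 : (w - c t * z₂) • (z₁ - c t * w) • G = 0) : G = 0 := by
  have h : c ((1 - t * t) * (1 - t * t)) • z₁ • z₂ • G = 0 := by
    rw [c_mul, c_sub, c_one, c_mul]
    generalize c t = T at *
    linear_combination (norm := module) h1 + (T * T) • h2 + T • h3 + T • h4
  have h' : (1 - t * t) * (1 - t * t) ≠ 0 :=
    mul_ne_zero (sub_ne_zero.2 (Ne.symm ht)) (sub_ne_zero.2 (Ne.symm ht))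
  refine Dist.ext fun ⟨i, j, k⟩ => ?_
  have := congrFun h (i + 1, j + 1, k)
  rw [c₃_smul_apply, z₁_smul_apply, z₂_smul_apply, add_sub_cancel_right,
    add_sub_cancel_right] at this
  exact (smul_eq_zero.1 this).resolve_left h'

/-- Half of the Serre expression, times `t`. -/
def serreHalf {A : Type*} [Ring A] [Algebra ℂ A] (t : ℂ) (x y z : A) : A :=
  t • (x * y * z) - (t * t + 1) • (x * z * y) + t • (z * x * y)

theorem serreHalf_add_left {A : Type*} [Ring A] [Algebra ℂ A] (t : ℂ) (x x' y z : A) :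
    serreHalf t (x + x') y z = serreHalf t x y z + serreHalf t x' y z := by
  simp only [serreHalf, add_mul, mul_add, smul_add]; abel

theorem serreHalf_add_mid {A : Type*} [Ring A] [Algebra ℂ A] (t : ℂ) (x y y' z : A) :
    serreHalf t x (y + y') z = serreHalf t x y z + serreHalf t x y' z := by
  simp only [serreHalf, add_mul, mul_add, smul_add]; abel

theorem serreHalf_add_right {A : Type*} [Ring A] [Algebra ℂ A] (t : ℂ) (x y z z' : A) :
    serreHalf t x y (z + z') = serreHalf t x y z + serreHalf t x y z' := by
  simp only [serreHalf, add_mul, mul_add, smul_add]; abel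

/-- The Serre relation for the fields `e`, `f`, `g`, symmetrized in `e`, `f`. -/
def Serre (t : ℂ) (e f g : ℤ → Module.End ℂ V) : Prop :=
  ∀ i j k, serreHalf t (e i) (f j) (g k) + serreHalf t (f j) (e i) (g k) = 0

namespace Serre

variable {t : ℂ} {e e' f f' g g' : ℤ → Module.End ℂ V}

theorem symm (h : Serre t e f g) : Serre t f e g := fun i j k => by
  rw [add_comm]; exact h j i k

theorem add_left (h : Serre t e f g) (h' : Serre t e' f g) : Serre t (e + e') f g :=
  fun i j k => by
    rw [Pi.add_apply, serreHalf_add_left, serreHalf_add_mid, add_add_add_comm, h i j k, h' i j k,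
      add_zero]

theorem add_mid (h : Serre t e f g) (h' : Serre t e f' g) : Serre t e (f + f') g :=
  (h.symm.add_left h'.symm).symm

theorem add_right (h : Serre t e f g) (h' : Serre t e f g') : Serre t e f (g + g') :=
  fun i j k => by
    rw [Pi.add_apply, serreHalf_add_right, serreHalf_add_right, add_add_add_comm, h i j k,
      h' i j k, add_zero]

theorem add_self (h : Serre t e e g) (h' : Serre t e f g) (h'' : Serre t f f g) :
    Serre t (e + f) (e + f) g :=
  (h.add_mid h').add_left (h'.symm.add_mid h'')

end Serre

/-- In the product `e(z) f(w)`, the exponents of `z` are bounded below on every vector. -/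
def LeftBounded (e f : ℤ → Module.End ℂ V) : Prop :=
  ∀ v, ∃ a : ℤ, ∀ N < a, ∀ M, e N (f M v) = 0

/-- The coefficients of the relation `(z - ξ w) e(z) f(w) = (ξ z - w) f(w) e(z)`. -/
def CoeffExchange (ξ : ℂ) (e f : ℤ → Module.End ℂ V) : Prop :=
  ∀ N M, e (N - 1) * f M - ξ • (f M * e (N - 1)) + (f (M - 1) * e N - ξ • (e N * f (M - 1))) = 0

/-- The exponents of each field are bounded below on every vector. -/
def ModeBounded (e : ℤ → Module.End ℂ V) : Prop := ∀ v, ∃ a : ℤ, ∀ N < a, e N v = 0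

/-- The condition under which a mixed factor kills the Serre expression: one of the three pairs has
no poles, in the order given. On a suitable region of exponents the three distributions in
`mixed_mul_serreDist` then vanish. -/
def WheelBounded (e f g : ℤ → Module.End ℂ V) : Prop :=
  LeftBounded g e ∨ LeftBounded f g ∨ LeftBounded e f

variable {t : ℂ} {e f g : ℤ → Module.End ℂ V}

/-- The distribution with given coefficients. -/
def Dist₃.of (F : ℤ × ℤ × ℤ → V) : Dist₃ V := F

theorem Dist₃.of_apply (F : ℤ × ℤ × ℤ → V) (x : ℤ × ℤ × ℤ) : Dist₃.of F x = F x := rfl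

/-- The distribution obtained from the Serre expression of the fields `e(z₁)`, `f(z₂)`, `g(w)`,
times `t`. -/
def serreFields (t : ℂ) (e f g : ℤ → Module.End ℂ V) (v : V) : Dist₃ V :=
  serreDist t (.of fun x => e x.1 (f x.2.1 (g x.2.2 v))) (.of fun x => e x.1 (g x.2.2 (f x.2.1 v)))
    (.of fun x => g x.2.2 (e x.1 (f x.2.1 v))) (.of fun x => f x.2.1 (e x.1 (g x.2.2 v)))
    (.of fun x => f x.2.1 (g x.2.2 (e x.1 v))) (.of fun x => g x.2.2 (f x.2.1 (e x.1 v)))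

theorem hexagon_fields (ht : t ≠ 0) (heg : CoeffExchange t e g) (hfg : CoeffExchange t f g)
    (hef : CoeffExchange (t * t)⁻¹ e f) (v : V) :
    Hexagon t (.of fun x => e x.1 (f x.2.1 (g x.2.2 v))) (.of fun x => e x.1 (g x.2.2 (f x.2.1 v)))
    (.of fun x => g x.2.2 (e x.1 (f x.2.1 v))) (.of fun x => f x.2.1 (e x.1 (g x.2.2 v)))
    (.of fun x => f x.2.1 (g x.2.2 (e x.1 v))) (.of fun x => g x.2.2 (f x.2.1 (e x.1 v))) := by
  have key : ∀ {x y : ℤ → Module.End ℂ V}, CoeffExchange t x y → ∀ N M u,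
      x (N - 1) (y M u) - t • x N (y (M - 1) u) + (y (M - 1) (x N u) - t • y M (x (N - 1) u)) = 0 :=
    fun h N M u => by
      have := LinearMap.congr_fun (h N M) u
      simp only [LinearMap.add_apply, LinearMap.sub_apply, LinearMap.smul_apply,
        Module.End.mul_apply, LinearMap.zero_apply] at this
      rw [← this]
      abel
  have key' : ∀ N M u, (t * t) • e (N - 1) (f M u) - e N (f (M - 1) u) +
      ((t * t) • f (M - 1) (e N u) - f M (e (N - 1) u)) = 0 := fun N M u => by
    have := congrArg (fun x => (t * t) • x) (LinearMap.congr_fun (hef N M) u)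
    have ht' : t * t ≠ 0 := mul_ne_zero ht ht
    simp only [LinearMap.add_apply, LinearMap.sub_apply, LinearMap.smul_apply,
      Module.End.mul_apply, LinearMap.zero_apply, smul_zero, smul_add, smul_sub, smul_smul,
      mul_inv_cancel₀ ht', one_smul] at this
    rw [← this]
    simp only [mul_smul]
    abel
  constructor <;> refine Dist.ext fun ⟨i, j, k⟩ => ?_ <;>
    simp only [sub_smul, mul_smul, Dist.sub_apply, Dist.add_apply, c₃_smul_apply, z₁_smul_apply,
      z₂_smul_apply, w₃_smul_apply, Dist₃.of_apply]
  · have := congrArg (e i) (key hfg j k v)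
    simp only [map_add, map_sub, map_smul, map_zero] at this
    exact this
  · exact key heg i k (f j v)
  · have := congrArg (f j) (key heg i k v)
    simp only [map_add, map_sub, map_smul, map_zero] at this
    exact this
  · exact key hfg j k (e i v)
  · have := key' i j (g k v)
    simp only [mul_smul] at this
    exact this
  · have := congrArg (g k) (key' i j v)
    simp only [map_add, map_sub, map_smul, map_zero, mul_smul] at this
    exact this

theorem mixed_serreFields_eq_zero (ht : t ≠ 0) (he : ModeBounded e) (hf : ModeBounded f)
    (hg : ModeBounded g) (h : ∀ v, Hexagon t (.of fun x => e x.1 (f x.2.1 (g x.2.2 v)))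
      (.of fun x => e x.1 (g x.2.2 (f x.2.1 v))) (.of fun x => g x.2.2 (e x.1 (f x.2.1 v)))
      (.of fun x => f x.2.1 (e x.1 (g x.2.2 v))) (.of fun x => f x.2.1 (g x.2.2 (e x.1 v)))
      (.of fun x => g x.2.2 (f x.2.1 (e x.1 v)))) (hw : WheelBounded f e g) (v : V) :
    (w - c t * z₁) • (z₂ - c t * w) • serreFields t e f g v = 0 := by
  obtain ⟨a, ha⟩ := he v
  obtain ⟨b, hb⟩ := hf v
  obtain ⟨d, hd⟩ := hg v
  rcases hw with hw | hw | hw <;> obtain ⟨r, hr⟩ := hw v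
  · refine (h v).mixed_eq_zero ht (C := {x | x.1 < a ∧ x.2.2 < min d r})
      (fun x y hxy hx => ⟨hxy.1.trans_lt hx.1, hxy.2.2.trans_lt hx.2⟩) (fun T => ?_)
      (fun x hx => ?_) (fun x hx => ?_) fun x hx => ?_
    · obtain ⟨i, j, k, h1, h2, h3⟩ := (exists_mem_degree a (min d r) T).2.1
      exact ⟨i, j, k, h1, h2, h3⟩
    · simp only [hr _ (lt_of_lt_of_le hx.2 (min_le_right _ _)), map_zero, Dist₃.of_apply]
    · simp only [Dist₃.of_apply, hd _ (lt_of_lt_of_le hx.2 (min_le_left _ _)), map_zero]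
    · simp only [Dist₃.of_apply, ha _ hx.1, map_zero]
  · refine (h v).mixed_eq_zero ht (C := {x | x.1 < min a r ∧ x.2.1 < b})
      (fun x y hxy hx => ⟨hxy.1.trans_lt hx.1, hxy.2.1.trans_lt hx.2⟩) (fun T => ?_)
      (fun x hx => ?_) (fun x hx => ?_) fun x hx => ?_
    · obtain ⟨i, j, k, h1, h2, h3⟩ := (exists_mem_degree (min a r) b T).1
      exact ⟨i, j, k, h1, h2, h3⟩
    · simp only [Dist₃.of_apply, hb _ hx.2, map_zero]
    · simp only [Dist₃.of_apply, hr _ (lt_of_lt_of_le hx.1 (min_le_right _ _)), map_zero]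
    · simp only [Dist₃.of_apply, ha _ (lt_of_lt_of_le hx.1 (min_le_left _ _)), map_zero]
  · refine (h v).mixed_eq_zero ht (C := {x | x.2.1 < min b r ∧ x.2.2 < d})
      (fun x y hxy hx => ⟨hxy.2.1.trans_lt hx.1, hxy.2.2.trans_lt hx.2⟩) (fun T => ?_)
      (fun x hx => ?_) (fun x hx => ?_) fun x hx => ?_
    · obtain ⟨i, j, k, h1, h2, h3⟩ := (exists_mem_degree (min b r) d T).2.2
      exact ⟨i, j, k, h1, h2, h3⟩
    · simp only [Dist₃.of_apply, hb _ (lt_of_lt_of_le hx.1 (min_le_left _ _)), map_zero]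
    · simp only [Dist₃.of_apply, hd _ hx.2, map_zero]
    · simp only [Dist₃.of_apply, hr _ (lt_of_lt_of_le hx.1 (min_le_right _ _)), map_zero]

theorem swap₁₂_serreFields (v : V) :
    swap₁₂ (serreFields t f e g v) = serreFields t e f g v := by
  simp only [serreFields, serreDist, mul_smul, add_smul, one_smul]
  refine Dist.ext fun ⟨i, j, k⟩ => ?_
  simp only [swap₁₂, Dist.add_apply, Dist.sub_apply, c₃_smul_apply, Dist₃.of_apply]
  exact add_comm (G := V) _ _

/-- The Serre relation for fields with the exchange relations of the Serre triple, if the mixed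
factors kill it. -/
theorem serre_of_wheelBounded (ht : t ≠ 0) (ht' : t * t ≠ 1) (he : ModeBounded e)
    (hf : ModeBounded f) (hg : ModeBounded g) (heg : CoeffExchange t e g)
    (hfg : CoeffExchange t f g) (hef : CoeffExchange (t * t)⁻¹ e f)
    (hfe : CoeffExchange (t * t)⁻¹ f e) (h1 : WheelBounded f e g) (h2 : WheelBounded e f g) :
    Serre t e f g := by
  have key : ∀ v, serreFields t e f g v = 0 := fun v => by
    have H := hexagon_fields ht heg hfg hef v
    refine eq_zero_of_mixed ht' H.mul_serreDist.1 H.mul_serreDist.2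
      (mixed_serreFields_eq_zero ht he hf hg (hexagon_fields ht heg hfg hef) h1 v) ?_
    have := congrArg swap₁₂
      (mixed_serreFields_eq_zero ht hf he hg (hexagon_fields ht hfg heg hfe) h2 v)
    rw [(swap₁₂_lin _ t).1, (swap₁₂_lin _ t).2, swap₁₂_serreFields] at this
    exact this
  intro i j k
  refine LinearMap.ext fun v => ?_
  have := congrFun (key v) (i, j, k)
  simp only [serreFields, serreDist, mul_smul, add_smul, one_smul, Dist.add_apply,
    Dist.sub_apply, c₃_smul_apply, Dist₃.of_apply] at this
  simp only [serreHalf, LinearMap.add_apply, LinearMap.sub_apply, LinearMap.smul_apply,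
    Module.End.mul_apply, LinearMap.zero_apply, mul_smul, add_smul, one_smul]
  exact this

end Wheel

end QSl21

namespace QSl21

/-! ### The quadratic and cubic relations of the currents -/

namespace Term

open SymField L₂

/-- No product of a term in `X` with a term in `Y` has a pole. -/
def Regular (X Y : List Term) : Prop := ∀ t ∈ X, ∀ u ∈ Y, HasPoles [] t.field u.field

instance (X Y : List Term) : Decidable (Regular X Y) := by unfold Regular; infer_instance

theorem LeftBounded.add_left {e e' f : ℤ → Module.End ℂ Fock} (h : LeftBounded e f)
    (h' : LeftBounded e' f) : LeftBounded (e + e') f := fun v => by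
  obtain ⟨a, ha⟩ := h v
  obtain ⟨b, hb⟩ := h' v
  exact ⟨min a b, fun N hN M => by
    rw [Pi.add_apply, LinearMap.add_apply, ha N (by omega), hb N (by omega), add_zero]⟩

theorem LeftBounded.add_right {e f f' : ℤ → Module.End ℂ Fock} (h : LeftBounded e f)
    (h' : LeftBounded e f') : LeftBounded e (f + f') := fun v => by
  obtain ⟨a, ha⟩ := h v
  obtain ⟨b, hb⟩ := h' v
  exact ⟨min a b, fun N hN M => by
    rw [Pi.add_apply, LinearMap.add_apply, map_add, ha N (by omega), hb N (by omega), add_zero]⟩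

theorem modes_cons' (P : Params) (t : Term) (X : List Term) :
    modes P (t :: X) = t.mode P + modes P X := funext fun N => modes_cons P t X N

theorem leftBounded_mode {P : Params} (hP : P.Generic) {t u : Term}
    (h : HasPoles [] t.field u.field) : LeftBounded (t.mode P) (u.mode P) := fun v => by
  obtain ⟨a, ha⟩ := bddZ_of_hasPoles hP h v
  rw [List.map_nil, lins, List.map_nil, List.prod_nil, one_smul] at ha
  exact ⟨a, fun N hN M => ha N M hN⟩

theorem Regular.leftBounded {P : Params} (hP : P.Generic) {X Y : List Term} (h : Regular X Y) :
    LeftBounded (modes P X) (modes P Y) := by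
  induction X with
  | nil => exact fun v => ⟨0, fun N _ M => by rw [modes_nil, LinearMap.zero_apply]⟩
  | cons t X ih =>
    rw [modes_cons']
    refine LeftBounded.add_left ?_ (ih fun t ht => h t (List.mem_cons_of_mem _ ht))
    have ht := h t List.mem_cons_self
    clear h ih
    induction Y with
    | nil => exact fun v => ⟨0, fun N _ M => by rw [modes_nil, LinearMap.zero_apply, map_zero]⟩
    | cons u Y ih =>
      rw [modes_cons']
      exact LeftBounded.add_right (leftBounded_mode hP (ht u List.mem_cons_self))
        (ih fun u hu => ht u (List.mem_cons_of_mem _ hu))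

/-- The exchange relation with the factors `z - q^ξ w`, `q^ξ z - w` holds for all the terms. -/
def Exchanges (ξ : Exponent) (X Y : List Term) : Prop :=
  ∀ t ∈ X, ∀ u ∈ Y, Related [ξ] [-ξ] 0 ξ t.field u.field

instance (ξ : Exponent) (X Y : List Term) : Decidable (Exchanges ξ X Y) := by
  unfold Exchanges; infer_instance

theorem Exchanges.coeffExchange {P : Params} (hP : P.Generic) {ξ : Exponent} {X Y : List Term}
    (h : Exchanges ξ X Y) : CoeffExchange (pw P ξ) (modes P X) (modes P Y) :=
  (qExchange_modes hP h).coeff (pw_ne_zero P ξ)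

/-- The condition on terms that corresponds to `WheelBounded`. -/
def WheelRegular (X Y Z : List Term) : Prop := Regular Z X ∨ Regular Y Z ∨ Regular X Y

instance (X Y Z : List Term) : Decidable (WheelRegular X Y Z) := by
  unfold WheelRegular; infer_instance

theorem WheelRegular.wheelBounded {P : Params} (hP : P.Generic) {X Y Z : List Term}
    (h : WheelRegular X Y Z) : WheelBounded (modes P X) (modes P Y) (modes P Z) :=
  h.imp (·.leftBounded hP) (Or.imp (·.leftBounded hP) (·.leftBounded hP))

/-- The Serre relation for sums of terms: only the factors `e`, `f` have to satisfy their exchange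
relations term by term. -/
theorem serre_modes {P : Params} (hP : P.Generic) {τ : Exponent} {X Y Z : List Term}
    (ht : pw P τ * pw P τ ≠ 1) (hXZ : CoeffExchange (pw P τ) (modes P X) (modes P Z))
    (hYZ : CoeffExchange (pw P τ) (modes P Y) (modes P Z)) (hXY : Exchanges (-(τ + τ)) X Y)
    (hYX : Exchanges (-(τ + τ)) Y X) (h1 : WheelBounded (modes P X) (modes P Y) (modes P Z))
    (h2 : WheelBounded (modes P Y) (modes P X) (modes P Z)) :
    Serre (pw P τ) (modes P X) (modes P Y) (modes P Z) := by
  have hττ : pw P (-(τ + τ)) = (pw P τ * pw P τ)⁻¹ := by rw [pw_neg, pw_add]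
  have h3 := hXY.coeffExchange hP
  have h4 := hYX.coeffExchange hP
  rw [hττ] at h3 h4
  exact serre_of_wheelBounded (pw_ne_zero P τ) ht (modes_bdd P X) (modes_bdd P Y) (modes_bdd P Z)
    hXZ hYZ h3 h4 h2 h1

/-- The decidable conditions for the Serre relation. -/
def SerreRegular (τ : Exponent) (X Y Z : List Term) : Prop :=
  Exchanges τ X Z ∧ Exchanges τ Y Z ∧ Exchanges (-(τ + τ)) X Y ∧ Exchanges (-(τ + τ)) Y X ∧
    WheelRegular X Y Z ∧ WheelRegular Y X Z

instance (τ : Exponent) (X Y Z : List Term) : Decidable (SerreRegular τ X Y Z) := by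
  unfold SerreRegular; infer_instance

theorem SerreRegular.serre {P : Params} (hP : P.Generic) {τ : Exponent} {X Y Z : List Term}
    (ht : pw P τ * pw P τ ≠ 1) (h : SerreRegular τ X Y Z) :
    Serre (pw P τ) (modes P X) (modes P Y) (modes P Z) :=
  serre_modes hP ht (h.1.coeffExchange hP) (h.2.1.coeffExchange hP) h.2.2.1 h.2.2.2.1
    (h.2.2.2.2.1.wheelBounded hP) (h.2.2.2.2.2.wheelBounded hP)

end Term

open SymField Term

theorem Params.Generic.pw_mul_self_ne_one {P : Params} (hP : P.Generic) :
    pw P (2, 0) * pw P (2, 0) ≠ 1 := by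
  have h := hP 2 (by norm_num)
  rw [← Complex.exp_nat_mul] at h
  have h' : pw P (2, 0) * pw P (2, 0) = Complex.exp ((2 : ℕ) * P.ħ) := by
    rw [← pw_add, pw, qpow]
    congr 2
    simp only [Exponent.val, Prod.mk_add_mk]
    norm_num
  rwa [h']

theorem Params.Generic.pw_neg_mul_self_ne_one {P : Params} (hP : P.Generic) :
    pw P (-2, 0) * pw P (-2, 0) ≠ 1 := fun h => by
  have h2 : pw P (-2, 0) = (pw P (2, 0))⁻¹ := (congrArg (pw P) (by decide)).trans (pw_neg P (2, 0))
  rw [h2, ← mul_inv, inv_eq_one] at h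
  exact hP.pw_mul_self_ne_one h

theorem coeffExchange_self {P : Params} (hP : P.Generic) (s : Sgn) :
    CoeffExchange (pw P (4 * s.val, 0)) (modes P (currentTerms s 0))
      (modes P (currentTerms s 0)) := by
  refine Exchanges.coeffExchange hP ?_
  cases s <;> decide +kernel

theorem coeffExchange_mixed {P : Params} (hP : P.Generic) (s : Sgn) :
    CoeffExchange (pw P (-2 * s.val, 0)) (modes P (currentTerms s 0))
      (modes P (currentTerms s 1)) := by
  cases s
  · exact Exchanges.coeffExchange hP (by decide +kernel)
  · have h1 := qExchange_pole P hP
    have h2 := qExchange_modes hP (ξ := (2, 0))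
      (X := [currentTerm .minus 0 0, currentTerm .minus 0 2])
      (Y := [currentTerm .minus 1 0, currentTerm .minus 1 2]) (by decide +kernel)
    have h3 := qExchange_modes hP (ξ := (2, 0)) (X := [currentTerm .minus 0 1])
      (Y := currentTerms .minus 1) (by decide +kernel)
    have e1 : modes P (currentTerms .minus 1) =
        modes P [currentTerm .minus 1 1, currentTerm .minus 1 3] +
          modes P [currentTerm .minus 1 0, currentTerm .minus 1 2] := by
      funext N
      simp only [Pi.add_apply, modes_cons, modes_nil, currentTerm, currentTerms,
        List.getD_cons_zero, List.getD_cons_succ]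
      abel
    have e2 : modes P (currentTerms .minus 0) =
        modes P [currentTerm .minus 0 0, currentTerm .minus 0 2] +
          modes P [currentTerm .minus 0 1] := by
      funext N
      simp only [Pi.add_apply, modes_cons, modes_nil, currentTerm, currentTerms,
        List.getD_cons_zero, List.getD_cons_succ]
      abel
    have h4 := h1.add_right h2
    rw [← e1] at h4
    have h5 := h4.add_left h3
    rw [← e2] at h5
    have h6 : ((-2 * Sgn.minus.val, 0) : Exponent) = (2, 0) := by decide
    rw [h6]
    exact QExchange.coeff (pw_ne_zero P _) h5

theorem anticommute_odd {P : Params} (hP : P.Generic) (s : Sgn) (N M : ℤ) :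
    modes P (currentTerms s 1) N * modes P (currentTerms s 1) M +
      modes P (currentTerms s 1) M * modes P (currentTerms s 1) N = 0 := by
  have h : ∀ t ∈ currentTerms s 1, ∀ u ∈ currentTerms s 1, Related [] [] 1 0 t.field u.field := by
    cases s <;> decide +kernel
  refine LinearMap.ext fun v => ?_
  have := congrFun (modes_exchange hP h v) (N, M)
  rw [List.map_nil, lins, List.map_nil, List.prod_nil, one_smul, one_smul, pw_zero, mul_one,
    zpow_one, c_smul_apply, prodDist, revDist, neg_one_smul] at this
  rw [LinearMap.add_apply, Module.End.mul_apply, Module.End.mul_apply, LinearMap.zero_apply]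
  simp only at this
  rw [this]
  exact neg_add_cancel _

/-- The Serre relation is trilinear, so that it suffices to split the currents into groups of terms
that satisfy a wheel condition. -/
theorem serre_plus {P : Params} (hP : P.Generic) :
    Serre (pw P (-2, 0)) (modes P (currentTerms .plus 0)) (modes P (currentTerms .plus 0))
      (modes P (currentTerms .plus 1)) := by
  have ht : pw P (-2, 0) * pw P (-2, 0) ≠ 1 := hP.pw_neg_mul_self_ne_one
  have h0 := SerreRegular.serre hP (X := currentTerms .plus 0) (Y := currentTerms .plus 0)
    (Z := [currentTerm .plus 1 0]) ht (by decide +kernel)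
  have h1 := SerreRegular.serre hP (X := [currentTerm .plus 0 0]) (Y := [currentTerm .plus 0 0])
    (Z := [currentTerm .plus 1 1]) ht (by decide +kernel)
  have h2 := SerreRegular.serre hP (X := [currentTerm .plus 0 0]) (Y := [currentTerm .plus 0 1])
    (Z := [currentTerm .plus 1 1]) ht (by decide +kernel)
  have h3 := SerreRegular.serre hP (X := [currentTerm .plus 0 1]) (Y := [currentTerm .plus 0 1])
    (Z := [currentTerm .plus 1 1]) ht (by decide +kernel)
  have e1 : modes P (currentTerms .plus 1) = modes P [currentTerm .plus 1 0] +
      modes P [currentTerm .plus 1 1] := funext fun N => modes_append P [_] [_] N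
  have e0 : modes P (currentTerms .plus 0) = modes P [currentTerm .plus 0 0] +
      modes P [currentTerm .plus 0 1] := funext fun N => modes_append P [_] [_] N
  have h4 := h1.add_self h2 h3
  rw [← e0] at h4
  rw [e1]
  exact h0.add_right h4

theorem LeftBounded.add_of_bddZ {V : Type*} [AddCommGroup V] [Module ℂ V]
    {e e' f f' : ℤ → Module.End ℂ V}
    (h : ∀ v, BddZ (prodDist e f v + prodDist e' f' v)) (r1 : LeftBounded e' f)
    (r2 : LeftBounded e f') : LeftBounded (e' + e) (f + f') := fun v => by
  obtain ⟨a, ha⟩ := h v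
  obtain ⟨b, hb⟩ := r1 v
  obtain ⟨d, hd⟩ := r2 v
  refine ⟨min a (min b d), fun N hN M => ?_⟩
  have h1 : e N (f M v) + e' N (f' M v) = 0 := ha N M (by omega)
  rw [Pi.add_apply, Pi.add_apply, LinearMap.add_apply, LinearMap.add_apply, map_add, map_add,
    hb N (by omega) M, hd N (by omega) M, zero_add, add_zero, add_comm, h1]

theorem modes_pair (P : Params) (t u : Term) : modes P [t, u] = t.mode P + u.mode P := by
  funext N
  rw [modes_cons, modes_cons, modes_nil, add_zero, Pi.add_apply]

theorem Term.PolesCancel.leftBounded {P : Params} (hP : P.Generic) {e : Exponent}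
    {t t' u u' : Term} (h : PolesCancel e t t' u u') (r1 : HasPoles [] t'.field u.field)
    (r2 : HasPoles [] t.field u'.field) :
    LeftBounded (modes P [t', t]) (modes P [u, u']) := by
  rw [modes_pair, modes_pair]
  exact LeftBounded.add_of_bddZ (h.bddZ hP) (leftBounded_mode hP r1) (leftBounded_mode hP r2)

/-- As for `serre_plus`, but the terms `1`, `3` of `X^{-,2}` and the terms `0`, `2` of `X^{-,1}`,
counted from `0`, have products with poles that cancel only in the sums, so that they stay together.
-/
theorem serre_minus {P : Params} (hP : P.Generic) :
    Serre (pw P (2, 0)) (modes P (currentTerms .minus 0)) (modes P (currentTerms .minus 0))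
      (modes P (currentTerms .minus 1)) := by
  have ht : pw P (2, 0) * pw P (2, 0) ≠ 1 := hP.pw_mul_self_ne_one
  let E : ℕ → List Term := fun n => [currentTerm .minus 0 n]
  let G : ℕ → List Term := fun n => [currentTerm .minus 1 n]
  let E02 : List Term := [currentTerm .minus 0 0, currentTerm .minus 0 2]
  let G13 : List Term := [currentTerm .minus 1 1, currentTerm .minus 1 3]
  have e1 : modes P (currentTerms .minus 1) = modes P (G 0) + modes P (G 2) + modes P G13 := by
    funext N
    simp only [Pi.add_apply, modes_cons, modes_nil, currentTerm, currentTerms, G, G13,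
      List.getD_cons_zero, List.getD_cons_succ]
    abel
  have e02 : modes P E02 = modes P (E 0) + modes P (E 2) :=
    funext fun N => modes_append P [_] [_] N
  have e0 : modes P (currentTerms .minus 0) = modes P E02 + modes P (E 1) := by
    funext N
    simp only [Pi.add_apply, modes_cons, modes_nil, currentTerm, currentTerms, E, E02,
      List.getD_cons_zero, List.getD_cons_succ]
    abel
  have s0 : Serre (pw P (2, 0)) (modes P (currentTerms .minus 0)) (modes P (currentTerms .minus 0))
      (modes P (G 0)) := by
    have h00 := SerreRegular.serre hP (X := E 0) (Y := E 0) (Z := G 0) ht (by decide +kernel)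
    have h02 := SerreRegular.serre hP (X := E 0) (Y := E 2) (Z := G 0) ht (by decide +kernel)
    have h22 := SerreRegular.serre hP (X := E 2) (Y := E 2) (Z := G 0) ht (by decide +kernel)
    have h01 := SerreRegular.serre hP (X := E02) (Y := E 1) (Z := G 0) ht (by decide +kernel)
    have h11 := SerreRegular.serre hP (X := E 1) (Y := E 1) (Z := G 0) ht (by decide +kernel)
    have h := h00.add_self h02 h22
    rw [← e02] at h
    rw [e0]
    exact h.add_self h01 h11
  have s2 : Serre (pw P (2, 0)) (modes P (currentTerms .minus 0)) (modes P (currentTerms .minus 0))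
      (modes P (G 2)) := by
    have h00 := SerreRegular.serre hP (X := E02) (Y := E02) (Z := G 2) ht (by decide +kernel)
    have h01 := SerreRegular.serre hP (X := E02) (Y := E 1) (Z := G 2) ht (by decide +kernel)
    have h11 := SerreRegular.serre hP (X := E 1) (Y := E 1) (Z := G 2) ht (by decide +kernel)
    rw [e0]
    exact h00.add_self h01 h11
  have s13 : Serre (pw P (2, 0)) (modes P (currentTerms .minus 0)) (modes P (currentTerms .minus 0))
      (modes P G13) := by
    have hp := (qExchange_pole P hP).coeff (pw_ne_zero P _)
    have h1 : Exchanges (2, 0) (E 1) G13 := by decide +kernel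
    have hp1 := h1.coeffExchange hP
    have hA : LeftBounded (modes P G13) (modes P E02) :=
      PolesCancel.leftBounded hP (e := (6, 4)) (by decide +kernel) (by decide +kernel)
        (by decide +kernel)
    have hB : Regular (E 1) E02 := by decide +kernel
    have h00 := serre_modes hP (X := E02) (Y := E02) (Z := G13) ht hp hp (by decide +kernel)
      (by decide +kernel) (.inl hA) (.inl hA)
    have h01 := serre_modes hP (X := E02) (Y := E 1) (Z := G13) ht hp hp1 (by decide +kernel)
      (by decide +kernel) (.inl hA) (.inr (.inr (hB.leftBounded hP)))
    have h11 := serre_modes hP (X := E 1) (Y := E 1) (Z := G13) ht hp1 hp1 (by decide +kernel)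
      (by decide +kernel) (WheelRegular.wheelBounded hP (by decide +kernel))
      (WheelRegular.wheelBounded hP (by decide +kernel))
    rw [e0]
    exact h00.add_self h01 h11
  rw [e1]
  exact (s0.add_right s2).add_right s13

end QSl21

namespace QSl21

/-! ### Heisenberg operators and exponentials -/

/-- If `x` commutes with the terms of a series up to a scalar in degree `d`, it commutes with the
exponential of the series up to a multiple of the exponential. -/
theorem expCoeff_mul_of_scalar {A : Type*} [Ring A] [Algebra ℂ A] {p : ℕ+ → A}
    (hp : ∀ i j, Commute (p i) (p j)) {x : A} {d : ℕ+} {a : ℂ}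
    (hx : ∀ r, p r * x = x * p r + if r = d then a • (1 : A) else 0) (n : ℕ) :
    expCoeff p n * x = x * expCoeff p n +
      if (d : ℕ) ≤ n then a • expCoeff p (n - d) else 0 := by
  induction n using Nat.strong_induction_on with
  | _ n ih =>
    rcases n with _ | m
    · have : ¬ (d : ℕ) ≤ 0 := by have := d.pos; omega
      rw [if_neg this, expCoeff_zero, one_mul, mul_one, add_zero]
    have hm : ((m : ℂ) + 1) ≠ 0 := by exact_mod_cast Nat.succ_ne_zero m
    refine smul_right_injective A hm ?_
    simp only [smul_add]
    rw [← smul_mul_assoc, ← mul_smul_comm, expCoeff_succ p hp, Finset.sum_mul, Finset.mul_sum]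
    have h1 : ∀ ij ∈ Finset.HasAntidiagonal.antidiagonal m,
        ((ij.1 : ℂ) + 1) • (p ij.1.succPNat * expCoeff p ij.2) * x =
          x * ((ij.1 : ℂ) + 1) • (p ij.1.succPNat * expCoeff p ij.2) +
            ((if ij.1.succPNat = d then (((d : ℕ) : ℂ) * a) • expCoeff p ij.2 else 0) +
              if (d : ℕ) ≤ ij.2 then
                a • ((ij.1 : ℂ) + 1) • (p ij.1.succPNat * expCoeff p (ij.2 - d)) else 0) := by
      intro ij hij
      have hij := Finset.HasAntidiagonal.mem_antidiagonal.1 hij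
      rw [smul_mul_assoc, mul_assoc, ih ij.2 (by omega), mul_add, ← mul_assoc, hx, add_mul,
        mul_smul_comm, ← mul_assoc]
      have hd : ij.1.succPNat = d → ((ij.1 : ℂ) + 1) = ((d : ℕ) : ℂ) := fun h => by
        rw [← h]; simp
      split_ifs with h1 h2 h2
      · rw [← hd h1]
        simp only [smul_add, smul_mul_assoc, one_mul, mul_smul_comm, smul_smul, mul_comm a]
        abel
      · rw [← hd h1]
        simp only [smul_add, smul_mul_assoc, one_mul, mul_zero, smul_smul, add_zero]
      · simp only [smul_add, zero_mul, mul_smul_comm, smul_smul, mul_comm a, add_zero, zero_add]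
      · simp only [zero_mul, mul_zero, add_zero]
    rw [Finset.sum_congr rfl h1, Finset.sum_add_distrib, Finset.sum_add_distrib]
    congr 1
    rw [Finset.Nat.sum_antidiagonal_eq_sum_range_succ_mk,
      Finset.Nat.sum_antidiagonal_eq_sum_range_succ_mk]
    by_cases h : (d : ℕ) ≤ m + 1
    · rw [if_pos h]
      obtain ⟨M, hM⟩ := Nat.exists_eq_add_of_le h
      have e1 : ∑ k ∈ Finset.range m.succ, (if k.succPNat = d then
          (((d : ℕ) : ℂ) * a) • expCoeff p (m - k) else 0) =
            (((d : ℕ) : ℂ) * a) • expCoeff p M := by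
        rw [Finset.sum_eq_single (d : ℕ).pred]
        · rw [if_pos (PNat.eq ((Nat.succPNat_coe _).trans (Nat.succ_pred_eq_of_pos d.pos)))]
          congr 2
          have := d.pos
          simp only [Nat.pred_eq_sub_one]
          omega
        · intro k _ hk
          refine if_neg fun hkd => hk ?_
          rw [← hkd]; rfl
        · intro hk
          have := d.pos
          simp only [Finset.mem_range, Nat.pred_eq_sub_one] at hk
          omega
      have e2 : ∑ k ∈ Finset.range m.succ, (if (d : ℕ) ≤ m - k then
          a • ((k : ℂ) + 1) • (p k.succPNat * expCoeff p (m - k - d)) else 0) =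
            a • (M : ℂ) • expCoeff p M := by
        rcases M with _ | M
        · rw [Nat.cast_zero, zero_smul, smul_zero]
          refine Finset.sum_eq_zero fun k _ => if_neg ?_
          omega
        · rw [Nat.cast_succ, expCoeff_succ p hp,
            Finset.Nat.sum_antidiagonal_eq_sum_range_succ_mk, Finset.smul_sum]
          rw [← Finset.sum_subset (Finset.range_mono (show M.succ ≤ m.succ by omega))]
          · refine Finset.sum_congr rfl fun k hk => ?_
            have := Finset.mem_range.1 hk
            rw [if_pos (by omega), show m - k - (d : ℕ) = M - k by omega]
          · intro k _ hk
            have : ¬ k < M.succ := fun h => hk (Finset.mem_range.2 h)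
            have := d.pos
            exact if_neg (by omega)
      rw [e1, e2, show m + 1 - (d : ℕ) = M by omega, smul_smul, ← add_smul, smul_smul]
      congr 1
      have : ((m : ℂ) + 1) = (d : ℕ) + M := by exact_mod_cast hM
      rw [this]
      ring
    · rw [if_neg h, smul_zero, Finset.sum_eq_zero, Finset.sum_eq_zero, add_zero]
      · intro k _
        exact if_neg (by omega)
      · intro k hk
        refine if_neg fun hkd => h ?_
        rw [← hkd]
        simpa using Finset.mem_range.1 hk

theorem Poly.induction {p : Poly → Prop} (one : p 1) (add : ∀ f g, p f → p g → p (f + g))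
    (smul : ∀ (a : ℂ) f, p f → p (a • f)) (mul : ∀ v f, p f → p (MvPolynomial.X v * f))
    (f : Poly) : p f := by
  induction f using MvPolynomial.induction_on with
  | C a => simpa [MvPolynomial.smul_eq_C_mul] using smul a 1 one
  | add f g hf hg => exact add f g hf hg
  | mul_X f v hf => rw [mul_comm]; exact mul v f hf

/-- The coefficient of `w^r` in the exponential of the annihilation operators. -/
def annCoeff (P : Params) (E : Field) (r : ℕ) : Module.End ℂ Poly where
  toFun f := (annExp P E f).coeff r
  map_add' f g := by rw [map_add, Polynomial.coeff_add]
  map_smul' a f := by rw [map_smul, Polynomial.coeff_smul, RingHom.id_apply]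

theorem annCoeff_apply (P : Params) (E : Field) (r : ℕ) (f : Poly) :
    annCoeff P E r f = (annExp P E f).coeff r := rfl

theorem annCoeff_one (P : Params) (E : Field) (r : ℕ) :
    annCoeff P E r 1 = if r = 0 then 1 else 0 := by
  rw [annCoeff_apply, map_one, Polynomial.coeff_one]

theorem annCoeff_X_mul (P : Params) (E : Field) (r : ℕ) (v : Boson × ℕ+) (f : Poly) :
    annCoeff P E r (MvPolynomial.X v * f) = MvPolynomial.X v * annCoeff P E r f +
      if (v.2 : ℕ) ≤ r then shiftCoeff P E v • annCoeff P E (r - v.2) f else 0 := by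
  simp only [annCoeff_apply, map_mul, annExp_X, add_mul, Polynomial.coeff_add,
    Polynomial.coeff_C_mul, ← Polynomial.C_mul_X_pow_eq_monomial, mul_assoc,
    Polynomial.coeff_X_pow_mul', MvPolynomial.smul_eq_C_mul]
  congr 1
  split_ifs <;> simp

/-- The annihilation part of degree `n`, `∑_B ann B n * B_n`, on polynomials. -/
def annDer (P : Params) (E : Field) (n : ℕ+) : Module.End ℂ Poly :=
  ∑ B : Boson, shiftCoeff P E (B, n) • (MvPolynomial.pderiv (R := ℂ) (B, n)).toLinearMap

/-- The creation part of degree `n`, `∑_B cre B n * B_{-n}`. -/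
def crePoly (E : Field) (n : ℕ+) : Poly := ∑ B : Boson, E.cre B n • (MvPolynomial.X (B, n) : Poly)

theorem annDer_one (P : Params) (E : Field) (n : ℕ+) : annDer P E n 1 = 0 := by
  simp [annDer, LinearMap.sum_apply]

theorem annDer_mul (P : Params) (E : Field) (n : ℕ+) (f g : Poly) :
    annDer P E n (f * g) = f * annDer P E n g + annDer P E n f * g := by
  simp only [annDer, LinearMap.sum_apply, LinearMap.smul_apply, Derivation.coeFn_coe,
    Derivation.leibniz, smul_eq_mul, smul_add, Finset.sum_add_distrib, Finset.mul_sum,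
    Finset.sum_mul, mul_smul_comm, smul_mul_assoc]
  congr 1
  exact Finset.sum_congr rfl fun B _ => by rw [mul_comm g]

theorem annDer_X (P : Params) (E : Field) (n : ℕ+) (v : Boson × ℕ+) :
    annDer P E n (MvPolynomial.X v) = if n = v.2 then shiftCoeff P E v • 1 else 0 := by
  simp only [annDer, LinearMap.sum_apply, LinearMap.smul_apply, Derivation.coeFn_coe,
    MvPolynomial.pderiv_X, Pi.single_apply]
  obtain ⟨B, k⟩ := v
  by_cases h : n = k
  · subst h
    rw [Finset.sum_eq_single B]
    · simp
    · intro B' _ hB'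
      rw [if_neg (fun h => hB' (congrArg Prod.fst h).symm), smul_zero]
    · simp
  · rw [if_neg h]
    exact Finset.sum_eq_zero fun B' _ => by
      rw [if_neg (fun h' => h (congrArg Prod.snd h').symm), smul_zero]

theorem annDer_comm (P : Params) (E F : Field) (i j : ℕ+) :
    Commute (annDer P E i) (annDer P F j) := by
  refine LinearMap.ext fun f => ?_
  rw [Module.End.mul_apply, Module.End.mul_apply]
  induction f using Poly.induction with
  | one => simp only [annDer_one, map_zero]
  | add f g hf hg => simp only [map_add, hf, hg]
  | smul a f hf => simp only [map_smul, hf]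
  | mul v f hf =>
    have h : ∀ (E : Field) i (F : Field) j,
        annDer P E i (annDer P F j (MvPolynomial.X v)) = 0 := fun E i F j => by
      rw [annDer_X]; split_ifs
      · rw [map_smul, annDer_one, smul_zero]
      · rw [map_zero]
    simp only [annDer_mul, map_add, hf, h, zero_mul]
    ring

/-- The translation `annExp` is the exponential of a derivation. -/
theorem annCoeff_eq_expCoeff (P : Params) (E : Field) (r : ℕ) :
    annCoeff P E r = expCoeff (annDer P E) r := by
  have hc : ∀ i j, Commute (annDer P E i) (annDer P E j) := annDer_comm P E E
  have hX : ∀ v r, expCoeff (annDer P E) r * LinearMap.mulLeft ℂ (MvPolynomial.X v : Poly) =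
      LinearMap.mulLeft ℂ (MvPolynomial.X v : Poly) * expCoeff (annDer P E) r +
        if (v.2 : ℕ) ≤ r then shiftCoeff P E v • expCoeff (annDer P E) (r - v.2) else 0 :=
    fun v => expCoeff_mul_of_scalar hc fun r => LinearMap.ext fun f => by
      rw [LinearMap.add_apply, Module.End.mul_apply, Module.End.mul_apply,
        LinearMap.mulLeft_apply, LinearMap.mulLeft_apply, annDer_mul, annDer_X]
      split_ifs <;> simp
  refine LinearMap.ext fun f => ?_
  induction f using Poly.induction generalizing r with
  | one =>
    rw [annCoeff_one]
    induction r using Nat.strong_induction_on with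
    | _ r ih =>
      rcases r with _ | m
      · rw [expCoeff_zero, if_pos rfl, Module.End.one_apply]
      have hm : ((m : ℂ) + 1) ≠ 0 := by exact_mod_cast Nat.succ_ne_zero m
      have h := LinearMap.congr_fun (expCoeff_succ (annDer P E) hc m) 1
      rw [LinearMap.sum_apply, Finset.sum_eq_zero, LinearMap.smul_apply] at h
      · rw [(smul_eq_zero.1 h).resolve_left hm, if_neg (Nat.succ_ne_zero m)]
      · intro ij hij
        have hij := Finset.HasAntidiagonal.mem_antidiagonal.1 hij
        rw [LinearMap.smul_apply, Module.End.mul_apply, ← ih ij.2 (by omega)]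
        split_ifs
        · rw [annDer_one, smul_zero]
        · rw [map_zero, smul_zero]
  | add f g hf hg => simp only [map_add, hf, hg]
  | smul a f hf => simp only [map_smul, hf]
  | mul v f hf =>
    have h := LinearMap.congr_fun (hX v r) f
    rw [LinearMap.add_apply, Module.End.mul_apply, Module.End.mul_apply, LinearMap.mulLeft_apply,
      LinearMap.mulLeft_apply] at h
    rw [annCoeff_X_mul, h, hf, hf]
    split_ifs <;> rfl

theorem annDer_annCoeff (P : Params) (E F : Field) (n : ℕ+) (r : ℕ) (f : Poly) :
    annDer P E n (annCoeff P F r f) = annCoeff P F r (annDer P E n f) := by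
  induction f using Poly.induction generalizing r with
  | one =>
    rw [annCoeff_one, annDer_one, map_zero]
    split_ifs
    · rw [annDer_one]
    · rw [map_zero]
  | add f g hf hg => simp only [map_add, hf, hg]
  | smul a f hf => simp only [map_smul, hf]
  | mul v f hf =>
    have h : ∀ r (g : Poly), annCoeff P F r (annDer P E n (MvPolynomial.X v) * g) =
        annDer P E n (MvPolynomial.X v) * annCoeff P F r g := fun r g => by
      rw [annDer_X]; split_ifs <;> simp
    rw [annCoeff_X_mul, map_add, annDer_mul, annDer_mul, map_add, h, hf, annCoeff_X_mul]
    split_ifs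
    · rw [map_smul, hf]; ring
    · rw [map_zero]; ring

theorem crePoly_commutator (P : Params) (E F : Field) (n k : ℕ+) :
    annDer P E n (crePoly F k) = if n = k then ctr P E F n • 1 else 0 := by
  simp only [crePoly, map_sum, map_smul, annDer_X]
  split_ifs with h
  · subst h
    simp only [ctr, Finset.sum_smul, smul_smul]
  · simp

theorem annDer_creCoeff (P : Params) (E F : Field) (n : ℕ+) (j : ℤ) :
    annDer P E n (creCoeff F j) = ctr P E F n • creCoeff F (j - n) := by
  have hn := n.pos
  rcases lt_or_ge j 0 with hj | hj
  · rw [creCoeff_neg F hj, creCoeff_neg F (by omega), map_zero, smul_zero]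
  obtain ⟨m, rfl⟩ := Int.eq_ofNat_of_zero_le hj
  have hmap : ∀ k, LinearMap.mulLeft ℂ (expCoeff (crePoly F) k) =
      expCoeff (fun r => LinearMap.mulLeft ℂ (crePoly F r)) k := fun k =>
    expCoeff_map (Algebra.lmul ℂ Poly) (crePoly F) k
  have h := expCoeff_mul_of_scalar (p := fun r => LinearMap.mulLeft ℂ (crePoly F r))
    (x := annDer P E n) (d := n) (a := -ctr P E F n)
    (fun i j => LinearMap.ext fun f => by
      simp only [Module.End.mul_apply, LinearMap.mulLeft_apply]; ring)
    (fun r => LinearMap.ext fun f => by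
      simp only [LinearMap.add_apply, Module.End.mul_apply, LinearMap.mulLeft_apply, annDer_mul,
        crePoly_commutator]
      by_cases hr : r = n
      · rw [if_pos hr, if_pos hr.symm]; simp
      · rw [if_neg hr, if_neg (Ne.symm hr)]; simp) m
  have h1 := LinearMap.congr_fun h 1
  rw [← hmap, ← hmap, Module.End.mul_apply, LinearMap.add_apply, Module.End.mul_apply,
    LinearMap.mulLeft_apply, LinearMap.mulLeft_apply, annDer_one, mul_zero, mul_one] at h1
  rw [creCoeff_natCast]
  change annDer P E n (expCoeff (crePoly F) m) = _
  rw [eq_neg_of_add_eq_zero_left h1.symm]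
  split_ifs with hnm
  · have : ((m : ℕ) : ℤ) - ((n : ℕ) : ℤ) = ((m - n : ℕ) : ℤ) := by omega
    change _ = ctr P E F n • creCoeff F (((m : ℕ) : ℤ) - ((n : ℕ) : ℤ))
    rw [this, creCoeff_natCast]
    rw [neg_smul, LinearMap.neg_apply, neg_neg, LinearMap.smul_apply, LinearMap.mulLeft_apply,
      mul_one]
    rfl
  · rw [creCoeff_neg F (by omega), smul_zero, LinearMap.zero_apply, neg_zero]

theorem polyMode_eq_sum_annCoeff (P : Params) (E : Field) (N : ℤ) (f : Poly) {D : ℕ}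
    (hD : (annExp P E f).natDegree < D) :
    polyMode P E N f = ∑ r ∈ Finset.range D, creCoeff E (N + r) * annCoeff P E r f :=
  polyMode_eq_sum P E N f hD

/-- The Heisenberg commutator within one sector. -/
theorem annDer_polyMode (P : Params) (E F : Field) (n : ℕ+) (N : ℤ) (f : Poly) :
    annDer P E n (polyMode P F N f) =
      polyMode P F N (annDer P E n f) + ctr P E F n • polyMode P F (N - n) f := by
  set D := max (annExp P F f).natDegree (annExp P F (annDer P E n f)).natDegree + 1
  rw [polyMode_eq_sum_annCoeff P F N f (D := D) (by omega),
    polyMode_eq_sum_annCoeff P F _ f (D := D) (by omega),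
    polyMode_eq_sum_annCoeff P F N _ (D := D) (by omega), map_sum, Finset.smul_sum,
    ← Finset.sum_add_distrib]
  refine Finset.sum_congr rfl fun r _ => ?_
  rw [annDer_mul, annDer_creCoeff, annDer_annCoeff, smul_mul_assoc,
    show N + (r : ℤ) - (n : ℕ) = N - (n : ℕ) + r by ring]

theorem annCoeff_crePoly_mul (P : Params) (E F : Field) (n : ℕ+) (r : ℕ) (f : Poly) :
    annCoeff P E r (crePoly F n * f) = crePoly F n * annCoeff P E r f +
      if (n : ℕ) ≤ r then ctr P E F n • annCoeff P E (r - n) f else 0 := by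
  rw [crePoly, Finset.sum_mul, Finset.sum_mul, map_sum]
  simp only [smul_mul_assoc, map_smul, annCoeff_X_mul, smul_add, Finset.sum_add_distrib]
  congr 1
  split_ifs
  · simp only [ctr, Finset.sum_smul, smul_smul]
  · simp

theorem polyMode_crePoly_mul (P : Params) (E F : Field) (n : ℕ+) (N : ℤ) (f : Poly) :
    polyMode P F N (crePoly E n * f) =
      crePoly E n * polyMode P F N f + ctr P F E n • polyMode P F (N + n) f := by
  set D := max (annExp P F f).natDegree (annExp P F (crePoly E n * f)).natDegree + 1
  rw [polyMode_eq_sum_annCoeff P F N f (D := D + n) (by omega),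
    polyMode_eq_sum_annCoeff P F _ f (D := D) (by omega),
    polyMode_eq_sum_annCoeff P F N _ (D := D + n) (by omega), Finset.mul_sum, Finset.smul_sum]
  simp only [annCoeff_crePoly_mul, mul_add, Finset.sum_add_distrib]
  congr 1
  · exact Finset.sum_congr rfl fun r _ => by ring
  · rw [add_comm D, Finset.sum_range_add, Finset.sum_eq_zero, zero_add]
    · refine Finset.sum_congr rfl fun r _ => ?_
      rw [if_pos (by omega), Nat.add_sub_cancel_left, mul_smul_comm]
      congr 3
      push_cast
      ring
    · intro r hr
      have := Finset.mem_range.1 hr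
      rw [if_neg (by omega), mul_zero]

/-- The operator that acts on the polynomials in all the sectors by `T`. -/
def sectorEnd : Module.End ℂ Poly →ₐ[ℂ] Module.End ℂ Fock :=
  AlgHom.ofLinearMap
    { toFun := fun T => sectorwise 0 fun _ => T
      map_add' := fun S T => Finsupp.lhom_ext fun m f => by
        rw [LinearMap.add_apply, sectorwise_single, sectorwise_single, sectorwise_single,
          LinearMap.add_apply, Finsupp.single_add]
      map_smul' := fun a T => Finsupp.lhom_ext fun m f => by
        rw [LinearMap.smul_apply, sectorwise_single, sectorwise_single, LinearMap.smul_apply,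
          RingHom.id_apply, Finsupp.smul_single] }
    (Finsupp.lhom_ext fun m f => by
      change sectorwise 0 _ _ = _
      rw [sectorwise_single, add_zero]; rfl)
    fun S T => Finsupp.lhom_ext fun m f => by
      change sectorwise 0 _ _ = sectorwise 0 _ (sectorwise 0 _ _)
      rw [sectorwise_single, sectorwise_single, sectorwise_single, add_zero, add_zero]; rfl

theorem sectorEnd_single (T : Module.End ℂ Poly) (m : Ghost → ℤ) (f : Poly) :
    sectorEnd T (Finsupp.single m f) = Finsupp.single m (T f) :=
  (sectorwise_single 0 _ m f).trans (by rw [add_zero])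

/-- A linear combination of annihilation operators commutes with an exponential up to the
contraction. -/
theorem sectorEnd_annDer_expMode (P : Params) (E F : Field) (n : ℕ+) (N : ℤ) :
    sectorEnd (annDer P E n) * expMode P F N =
      expMode P F N * sectorEnd (annDer P E n) + ctr P E F n • expMode P F (N - n) := by
  refine Finsupp.lhom_ext fun m f => ?_
  rw [LinearMap.add_apply, Module.End.mul_apply, Module.End.mul_apply, LinearMap.smul_apply,
    sectorEnd_single, expMode_single, expMode_single, expMode_single, sectorEnd_single,
    Finsupp.smul_single, ← Finsupp.single_add, map_smul, annDer_polyMode, smul_add, smul_smul,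
    smul_smul, mul_comm (ctr P E F n),
    show N - zExponent F m - (n : ℕ) = N - (n : ℕ) - zExponent F m by ring]

/-- A linear combination of creation operators commutes with an exponential up to the contraction.
-/
theorem sectorEnd_crePoly_expMode (P : Params) (E F : Field) (n : ℕ+) (N : ℤ) :
    expMode P F N * sectorEnd (LinearMap.mulLeft ℂ (crePoly E n)) =
      sectorEnd (LinearMap.mulLeft ℂ (crePoly E n)) * expMode P F N +
        ctr P F E n • expMode P F (N + n) := by
  refine Finsupp.lhom_ext fun m f => ?_
  rw [LinearMap.add_apply, Module.End.mul_apply, Module.End.mul_apply, LinearMap.smul_apply,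
    sectorEnd_single, expMode_single, expMode_single, expMode_single, sectorEnd_single,
    Finsupp.smul_single, ← Finsupp.single_add, map_smul, LinearMap.mulLeft_apply,
    polyMode_crePoly_mul, smul_add, smul_smul, LinearMap.mulLeft_apply,
    smul_smul, mul_comm (ctr P F E n),
    show N - zExponent F m + (n : ℕ) = N + (n : ℕ) - zExponent F m by ring]

theorem sectorEnd_annDer_crePoly (P : Params) (E F : Field) (n k : ℕ+) :
    sectorEnd (annDer P E n) * sectorEnd (LinearMap.mulLeft ℂ (crePoly F k)) =
      sectorEnd (LinearMap.mulLeft ℂ (crePoly F k)) * sectorEnd (annDer P E n) +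
        if n = k then ctr P E F n • 1 else 0 := by
  refine Finsupp.lhom_ext fun m f => ?_
  rw [LinearMap.add_apply, Module.End.mul_apply, Module.End.mul_apply, sectorEnd_single,
    sectorEnd_single, sectorEnd_single, sectorEnd_single, LinearMap.mulLeft_apply,
    LinearMap.mulLeft_apply, annDer_mul, crePoly_commutator, Finsupp.single_add]
  congr 1
  split_ifs
  · rw [smul_mul_assoc, one_mul, LinearMap.smul_apply, Module.End.one_apply, Finsupp.smul_single]
  · rw [zero_mul, Finsupp.single_zero]; rfl

/-- An exponential of annihilation operators. -/
theorem expMode_of_cre_eq_zero (P : Params) {E : Field} (h : E.cre = 0) (hc : E.charge = 0)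
    (N : ℤ) : expMode P E N = if N ≤ 0 then (diagonal fun m => qpow P.ħ (constTerm P E m)) *
      sectorEnd (expCoeff (annDer P E) (-N).toNat) else 0 := by
  have hE : ∀ j, creCoeff E j = if j = 0 then 1 else 0 := fun j => by
    rcases lt_or_ge j 0 with hj | hj
    · rw [creCoeff_neg E hj, if_neg (by omega)]
    obtain ⟨m, rfl⟩ := Int.eq_ofNat_of_zero_le hj
    have h0 : (fun n : ℕ+ => ∑ B : Boson, E.cre B n • (MvPolynomial.X (B, n) : Poly)) = 0 := by
      funext n; simp [h]
    have h1 := congrArg (PowerSeries.coeff m) (expSeries_zero (A := Poly))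
    rw [expSeries, PowerSeries.coeff_mk, PowerSeries.coeff_one] at h1
    rw [creCoeff_natCast, h0, h1]
    simp
  refine Finsupp.lhom_ext fun m f => ?_
  have hz : zExponent E m = 0 := by simp [zExponent, hc]
  rw [expMode_single, hz, sub_zero, hc, add_zero,
    polyMode_eq_sum_annCoeff P E N f (Nat.lt_succ_self _)]
  simp only [hE]
  split_ifs with hN
  · rw [Module.End.mul_apply, sectorEnd_single, diagonal, sectorwise_single, add_zero,
      ← annCoeff_eq_expCoeff, LinearMap.smul_apply, LinearMap.id_apply]
    congr 2
    by_cases hr : (-N).toNat ∈ Finset.range ((annExp P E f).natDegree + 1)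
    · rw [Finset.sum_eq_single_of_mem _ hr, if_pos (by omega), one_mul]
      intro r _ hrN
      rw [if_neg (by omega), zero_mul]
    · rw [Finset.mem_range] at hr
      rw [Finset.sum_eq_zero, annCoeff_apply, Polynomial.coeff_eq_zero_of_natDegree_lt (by omega)]
      intro r hr'
      have := Finset.mem_range.1 hr'
      rw [if_neg (by omega), zero_mul]
  · rw [Finset.sum_eq_zero, smul_zero, Finsupp.single_zero]
    · rfl
    intro r _
    rw [if_neg (by omega), zero_mul]

/-- An exponential of creation operators. -/
theorem expMode_of_ann_eq_zero (P : Params) {E : Field} (h : E.ann = 0) (hc : E.charge = 0)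
    (N : ℤ) : expMode P E N = if 0 ≤ N then (diagonal fun m => qpow P.ħ (constTerm P E m)) *
      expCoeff (fun n => sectorEnd (LinearMap.mulLeft ℂ (crePoly E n))) N.toNat else 0 := by
  have hmap : expCoeff (fun n => sectorEnd (LinearMap.mulLeft ℂ (crePoly E n))) N.toNat =
      sectorEnd (LinearMap.mulLeft ℂ (expCoeff (crePoly E) N.toNat)) :=
    (expCoeff_map (sectorEnd.comp (Algebra.lmul ℂ Poly)) (crePoly E) N.toNat).symm
  have hE : ∀ f, annExp P E f = Polynomial.C f := fun f => by
    refine Polynomial.ext fun r => ?_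
    change annCoeff P E r f = _
    induction f using Poly.induction generalizing r with
    | one => rw [annCoeff_one, Polynomial.coeff_C]
    | add f g hf hg => rw [map_add, hf, hg, map_add, Polynomial.coeff_add]
    | smul a f hf => rw [map_smul, hf, ← Polynomial.smul_C, Polynomial.coeff_smul]
    | mul v f hf =>
      have : shiftCoeff P E v = 0 := by simp [shiftCoeff, h]
      rw [annCoeff_X_mul, hf, this, zero_smul, ite_self, add_zero, map_mul,
        Polynomial.coeff_C_mul]
  refine Finsupp.lhom_ext fun m f => ?_
  have hz : zExponent E m = 0 := by simp [zExponent, hc]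
  rw [expMode_single, hz, sub_zero, hc, add_zero, polyMode_eq_sum P E N f (D := 1)
    (by rw [hE, Polynomial.natDegree_C]; omega), Finset.sum_range_one, hE,
    Polynomial.coeff_C_zero, Nat.cast_zero, add_zero, hmap]
  split_ifs with hN
  · obtain ⟨k, rfl⟩ := Int.eq_ofNat_of_zero_le hN
    rw [Module.End.mul_apply, sectorEnd_single, diagonal, sectorwise_single, add_zero,
      LinearMap.smul_apply, LinearMap.id_apply, LinearMap.mulLeft_apply, creCoeff_natCast]
    rfl
  · rw [creCoeff_neg E (by omega), zero_mul, smul_zero, Finsupp.single_zero]; rfl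

end QSl21

namespace QSl21

/-! ### The Cartan currents -/

theorem osc_pos (P : Params) (B : Boson) (n : ℕ+) : osc P B (n : ℤ) =
    sectorEnd (∑ B' : Boson,
      comm P (n : ℤ) B B' • (MvPolynomial.pderiv (R := ℂ) (B', n)).toLinearMap) := by
  obtain ⟨k, rfl⟩ : ∃ k : ℕ, n = k.succPNat := ⟨n.natPred, (PNat.succPNat_natPred n).symm⟩
  rfl

theorem osc_neg (P : Params) (B : Boson) (n : ℕ+) : osc P B (-(n : ℤ)) =
    sectorEnd (LinearMap.mulLeft ℂ (MvPolynomial.X (B, n) : Poly)) := by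
  obtain ⟨k, rfl⟩ : ∃ k : ℕ, n = k.succPNat := ⟨n.natPred, (PNat.succPNat_natPred n).symm⟩
  rfl

theorem sectorEnd_annDer (P : Params) (E : Field) (n : ℕ+) :
    sectorEnd (annDer P E n) = ∑ B, E.ann B n • osc P B (n : ℤ) := by
  simp only [osc_pos, ← map_smul, ← map_sum]
  congr 1
  simp only [annDer, shiftCoeff, Finset.sum_smul, Finset.smul_sum, smul_smul]
  exact Finset.sum_comm

theorem sectorEnd_crePoly (P : Params) (E : Field) (n : ℕ+) :
    sectorEnd (LinearMap.mulLeft ℂ (crePoly E n)) = ∑ B, E.cre B n • osc P B (-(n : ℤ)) := by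
  simp only [osc_neg, ← map_smul, ← map_sum]
  congr 1
  refine LinearMap.ext fun f => ?_
  simp only [crePoly, LinearMap.mulLeft_apply, LinearMap.sum_apply, LinearMap.smul_apply,
    Finset.sum_mul, smul_mul_assoc]

/-- The operator `± (q - q⁻¹) h^i_{± n}` of the current `ψ^{±,i}`. -/
def psiLog (P : Params) (i : Fin 2) (n : ℕ+) : Sgn → Module.End ℂ Fock
  | .plus => sectorEnd (annDer P ((SymField.psiField .plus i).toField P) n)
  | .minus => sectorEnd (LinearMap.mulLeft ℂ (crePoly ((SymField.psiField .minus i).toField P) n))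

theorem psiLog_eq {P : Params} (hP : P.Generic) (i : Fin 2) (n : ℕ+) (s : Sgn) :
    ((s.val : ℂ) * (qpow P.ħ 1 - qpow P.ħ (-1))) • hMode P i (s.val * (n : ℤ)) =
      psiLog P i n s := by
  have v1 : Exponent.val P (1, 0) = 1 / 2 := by simp [Exponent.val]
  have v1' : Exponent.val P (-1, 0) = -(1 / 2) := by simp [Exponent.val]; ring
  have v01 : Exponent.val P (0, 1) = P.α / 2 := by simp [Exponent.val]
  have v01' : Exponent.val P (0, -1) = -(P.α / 2) := by simp [Exponent.val]; ring
  have v41 : Exponent.val P (4, 1) = P.α / 2 + 2 := by simp [Exponent.val]; ring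
  have v41' : Exponent.val P (-4, -1) = -(P.α / 2 + 2) := by simp [Exponent.val]; ring
  have v21 : Exponent.val P (2, 1) = P.α / 2 + 1 := by simp [Exponent.val]; ring
  have v21' : Exponent.val P (-2, -1) = -(P.α / 2 + 1) := by simp [Exponent.val]; ring
  have hn : |(n : ℤ)| = n := abs_of_pos (by exact_mod_cast n.pos)
  have q1 : qpow P.ħ (-(P.α / 2 + 1) * n) * (qpow P.ħ n + qpow P.ħ (-n)) =
      qpow P.ħ (-(P.α / 2) * n) + qpow P.ħ (-(P.α / 2 + 2) * n) := by
    rw [mul_add, ← qpow_add, ← qpow_add]; ring_nf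
  have q3 : qpow P.ħ (-(n / 2)) = qpow P.ħ (-(1 / 2) * n) := by ring_nf
  cases s
  · rw [psiLog, sectorEnd_annDer, sum_boson, sum_ghost]
    fin_cases i <;>
    simp only [SymField.psiField, SymField.toField_add, SymField.toField_sub, toField_plus hP,
      Field.add_ann, Field.sub_ann, Pi.add_apply, Pi.sub_apply, plus, hMode, Sgn.val, one_mul,
      hn, Fin.zero_eta, Fin.mk_one, v1, v01, v41, v21, Int.cast_natCast, q1, q3] <;>
    simp <;> module
  · rw [psiLog, sectorEnd_crePoly, sum_boson, sum_ghost]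
    fin_cases i <;>
    simp only [SymField.psiField, SymField.toField_add, SymField.toField_sub, toField_minus hP,
      Field.add_cre, Field.sub_cre, Pi.add_apply, Pi.sub_apply, minus, hMode, Sgn.val,
      hn, Fin.zero_eta, Fin.mk_one, v1', v01', v41', v21', neg_one_mul, abs_neg,
      Int.cast_natCast, q1, q3] <;>
    simp <;> module

theorem constTerm_psiField (P : Params) (hP : P.Generic) (s : Sgn) (i : Fin 2) (m : Ghost → ℤ) :
    constTerm P ((SymField.psiField s i).toField P) m = s.val * hZero P m i := by
  rw [constTerm, sum_boson, sum_ghost]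
  cases s <;> fin_cases i <;>
  simp only [SymField.psiField, SymField.toField_add, SymField.toField_sub, toField_plus hP,
    toField_minus hP, Field.add_const, Field.sub_const, Pi.add_apply, Pi.sub_apply, plus, minus,
    hZero, Sgn.val, Fin.zero_eta, Fin.mk_one] <;>
  simp <;> ring

/-- The modes of `ψ^{±,i}` are the modes of an exponential. -/
theorem psiField_mode {P : Params} (hP : P.Generic) (s : Sgn) (i : Fin 2) (n : ℤ) :
    (SymField.psiField s i).mode P (-n) =
      if 0 ≤ s.val * n then (diagonal fun m => qpow P.ħ (s.val * hZero P m i)) *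
        expCoeff (fun r : ℕ+ => ((s.val : ℂ) * (qpow P.ħ 1 - qpow P.ħ (-1))) •
          hMode P i (s.val * (r : ℤ))) (s.val * n).toNat else 0 := by
  simp only [psiLog_eq hP, ← constTerm_psiField P hP]
  rw [SymField.mode]
  cases s
  · have h1 : ((SymField.psiField .plus i).toField P).cre = 0 := by
      funext B r
      fin_cases i <;>
      simp [SymField.psiField, SymField.toField_add, SymField.toField_sub, toField_plus hP, plus]
    have h2 : ((SymField.psiField .plus i).toField P).charge = 0 := by fin_cases i <;> rfl
    rw [expMode_of_cre_eq_zero P h1 h2]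
    simp only [Sgn.val, one_mul, neg_neg, Left.neg_nonpos_iff]
    congr 2
    exact expCoeff_map sectorEnd _ _
  · have h1 : ((SymField.psiField .minus i).toField P).ann = 0 := by
      funext B r
      fin_cases i <;>
      simp [SymField.psiField, SymField.toField_add, SymField.toField_sub, toField_minus hP, minus]
    have h2 : ((SymField.psiField .minus i).toField P).charge = 0 := by fin_cases i <;> rfl
    rw [expMode_of_ann_eq_zero P h1 h2]
    simp only [Sgn.val, neg_one_mul]
    rfl

end QSl21

namespace QSl21

open SymField Term

/-! ### Commutators with the Cartan currents and with `d` -/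

namespace Term

theorem modes_commute_of_terms {P : Params} {X : List Term} {A : Module.End ℂ Fock} {N N' : ℤ}
    {x y : ℂ} (h : ∀ t ∈ X, A * t.mode P N = x • (t.mode P N * A) + y • t.mode P N') :
    A * modes P X N = x • (modes P X N * A) + y • modes P X N' := by
  induction X with
  | nil => simp only [modes_nil, mul_zero, zero_mul, smul_zero, add_zero]
  | cons t X ih =>
    rw [modes_cons, modes_cons, mul_add, add_mul, h t List.mem_cons_self,
      ih fun t ht => h t (List.mem_cons_of_mem _ ht), smul_add, smul_add, add_add_add_comm]

theorem mode_commute_of_field {P : Params} (t : Term) {A : Module.End ℂ Fock} {N N' : ℤ} {x y : ℂ}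
    (h : A * t.field.mode P (N + t.depth) =
      x • (t.field.mode P (N + t.depth) * A) + y • t.field.mode P (N' + t.depth)) :
    A * t.mode P N = x • (t.mode P N * A) + y • t.mode P N' := by
  rw [mode, mode, mul_smul_comm, h, smul_add, smul_mul_assoc, smul_comm x (t.coef P),
    smul_comm y (t.coef P)]

end Term

/-- The contraction of `ψ^{±,i}` with the terms of the current `X^{s,j}`. -/
def cartanContraction (s : Sgn) (i j : Fin 2) : FormalSum :=
  [(s.val, (2 * cartan i j, -s.val)), (-s.val, (-(2 * cartan i j), -s.val))]

theorem contraction_psiField (s : Sgn) : ∀ i j : Fin 2, ∀ t ∈ currentTerms s j,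
    FormalSum.Equal (contraction (psiField .plus i) t.field) (cartanContraction s i j) ∧
      FormalSum.Equal (contraction t.field (psiField .minus i)) (cartanContraction s i j) ∧
        zeroShift (psiField .plus i) t.field = (s.val * (2 * cartan i j), 0) ∧
          phaseShift (psiField .plus i) t.field = 0 := by cases s <;> decide +kernel

theorem contraction_psiField_psiField : ∀ i j : Fin 2,
    FormalSum.Equal (contraction (psiField .plus i) (psiField .minus j))
      [(-1, (2 * cartan i j, 2)), (1, (-(2 * cartan i j), 2)), (1, (2 * cartan i j, -2)),
        (-1, (-(2 * cartan i j), -2))] := by decide +kernel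

theorem eval_cartanContraction {P : Params} (hP : P.Generic) (s : Sgn) (i j : Fin 2) (n : ℕ+) :
    FormalSum.eval (fun e => logSeq (pw P e)) (cartanContraction s i j) n =
      (s.val * (qpow P.ħ 1 - qpow P.ħ (-1))) * ((qnum P.ħ (cartan i j * n) / n) *
        qpow P.ħ (-(s.val * (n : ℂ)) * (P.α / 2))) := by
  have hq := hP.one_sub_ne_zero
  have hn : ((n : ℕ) : ℂ) ≠ 0 := by exact_mod_cast n.ne_zero
  have e1 : ∀ a : ℤ, pw P (2 * a, -s.val) ^ (n : ℕ) =
      qpow P.ħ (a * n) * qpow P.ħ (-(s.val * (n : ℂ)) * (P.α / 2)) := fun a => by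
    rw [pw, ← qpow_mul_natCast, ← qpow_add, Exponent.val]
    congr 1
    push_cast
    ring
  have e2 : pw P (-(2 * cartan i j), -s.val) ^ (n : ℕ) =
      qpow P.ħ (-(cartan i j * n)) * qpow P.ħ (-(s.val * (n : ℂ)) * (P.α / 2)) := by
    have := e1 (-cartan i j)
    rw [mul_neg] at this
    rw [this]
    push_cast
    rw [neg_mul]
  rw [cartanContraction, FormalSum.eval_cons, FormalSum.eval_cons, FormalSum.eval_nil]
  simp only [Pi.add_apply, Pi.smul_apply, Pi.zero_apply, logSeq, e1, e2, qnum]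
  simp only [zsmul_eq_mul]
  push_cast
  field_simp
  ring

/-- The commutator of `h^i_m` with a current is a mode of the same current, because all the terms of
the current have the same contraction with `ψ^{±,i}`. -/
theorem psiLog_commutator_current {P : Params} (hP : P.Generic) (s' s : Sgn) (i j : Fin 2) (n : ℕ+)
    (N : ℤ) :
    psiLog P i n s' * modes P (currentTerms s j) N =
      modes P (currentTerms s j) N * psiLog P i n s' +
      (s'.val * ((s.val * (qpow P.ħ 1 - qpow P.ħ (-1))) * ((qnum P.ħ (cartan i j * n) / n) *
        qpow P.ħ (-(s.val * (n : ℂ)) * (P.α / 2))))) •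
          modes P (currentTerms s j) (N - s'.val * n) := by
  rw [← eval_cartanContraction hP]
  have h := modes_commute_of_terms (P := P) (X := currentTerms s j) (A := psiLog P i n s')
    (N := N) (N' := N - s'.val * n) (x := 1)
    (y := s'.val * FormalSum.eval (fun e => logSeq (pw P e)) (cartanContraction s i j) n)
    fun t ht => mode_commute_of_field t ?_
  · rwa [one_smul] at h
  obtain ⟨h1, h2, -, -⟩ := contraction_psiField s i j t ht
  rw [one_smul]
  cases s'
  · rw [← h1.eval_eq, ← ctr_toField hP]
    have := sectorEnd_annDer_expMode P ((psiField .plus i).toField P) (t.field.toField P) n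
      (N + t.depth)
    simp only [Sgn.val, Int.cast_one, one_mul]
    rw [show N - (n : ℕ) + (t.depth : ℤ) = N + t.depth - (n : ℕ) by ring]
    exact this
  · rw [← h2.eval_eq, ← ctr_toField hP]
    have := sectorEnd_crePoly_expMode P ((psiField .minus i).toField P) (t.field.toField P) n
      (N + t.depth)
    simp only [Sgn.val, Int.reduceNeg, Int.cast_neg, Int.cast_one, neg_mul, one_mul, neg_smul,
      sub_neg_eq_add]
    rw [show N + (n : ℕ) + (t.depth : ℤ) = N + t.depth + (n : ℕ) by ring]
    exact (eq_add_neg_of_add_eq this.symm)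

theorem exists_sgn_mul {m : ℤ} (hm : m ≠ 0) : ∃ (s : Sgn) (n : ℕ+), m = s.val * n := by
  rcases lt_or_gt_of_ne hm with h | h
  · exact ⟨.minus, ⟨(-m).toNat, by omega⟩, by simp only [Sgn.val, PNat.mk_coe]; omega⟩
  · exact ⟨.plus, ⟨m.toNat, by omega⟩, by simp only [Sgn.val, PNat.mk_coe]; omega⟩

theorem Sgn.val_ne_zero (s : Sgn) : (s.val : ℂ) ≠ 0 := by cases s <;> simp [Sgn.val]

theorem Sgn.abs_val_mul (s : Sgn) (n : ℕ+) : |s.val * (n : ℤ)| = n := by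
  cases s <;> simp [Sgn.val]

theorem hMode_eq {P : Params} (hP : P.Generic) (s : Sgn) (i : Fin 2) (n : ℕ+) :
    hMode P i (s.val * n) = (s.val * (qpow P.ħ 1 - qpow P.ħ (-1)))⁻¹ • psiLog P i n s := by
  rw [← psiLog_eq hP, smul_smul, inv_mul_cancel₀ (mul_ne_zero s.val_ne_zero hP.one_sub_ne_zero),
    one_smul]

theorem qnum_div_even (ħ : ℂ) (a : ℤ) (s : Sgn) (n : ℕ+) :
    qnum ħ (a * (s.val * (n : ℤ) : ℤ)) / (s.val * (n : ℤ) : ℤ) = qnum ħ (a * n) / n := by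
  cases s
  · simp [Sgn.val]
  · simp [Sgn.val, qnum_neg]

/-- The operators on the two sides of the relation between `h^i_m` and `X^{s,j}_n`. -/
theorem hMode_commutator_current {P : Params} (hP : P.Generic) (i : Fin 2) {m : ℤ} (hm : m ≠ 0)
    (s : Sgn) (j : Fin 2) (n : ℤ) :
    hMode P i m * current P s j n - current P s j n * hMode P i m =
      (s.val * (qnum P.ħ (cartan i j * m) / m)) •
        (qpow P.ħ ((-(s.val * |m|) : ℤ) * (P.α / 2)) • current P s j (n + m)) := by
  obtain ⟨s', r, rfl⟩ := exists_sgn_mul hm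
  have hq := hP.one_sub_ne_zero
  have hs := s'.val_ne_zero
  rw [qnum_div_even, Sgn.abs_val_mul, current_eq_modes hP, current_eq_modes hP, hMode_eq hP,
    smul_mul_assoc, mul_smul_comm, psiLog_commutator_current hP, smul_add]
  have hsub : ∀ A B : Module.End ℂ Fock, A + B - A = B := fun A B => add_sub_cancel_left A B
  rw [hsub, smul_smul, smul_smul,
    show -n - 1 - s'.val * (r : ℕ) = -(n + s'.val * (r : ℕ)) - 1 by ring]
  congr 1
  push_cast
  field_simp

theorem psiLog_comm (P : Params) (s : Sgn) (i j : Fin 2) (n k : ℕ+) :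
    psiLog P i n s * psiLog P j k s = psiLog P j k s * psiLog P i n s := by
  have h : ∀ a b : Poly, LinearMap.mulLeft ℂ a * LinearMap.mulLeft ℂ b =
      LinearMap.mulLeft ℂ b * LinearMap.mulLeft ℂ a := fun a b => LinearMap.ext fun f => by
    simp only [Module.End.mul_apply, LinearMap.mulLeft_apply]; ring
  cases s
  · rw [psiLog, psiLog, ← map_mul, ← map_mul, (annDer_comm P _ _ n k).eq]
  · rw [psiLog, psiLog, ← map_mul, ← map_mul, h]

theorem psiLog_plus_minus {P : Params} (hP : P.Generic) (i j : Fin 2) (n k : ℕ+) :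
    psiLog P i n .plus * psiLog P j k .minus = psiLog P j k .minus * psiLog P i n .plus +
      (if n = k then -((qpow P.ħ 1 - qpow P.ħ (-1)) * (qnum P.ħ (cartan i j * n) / n) *
        (qpow P.ħ (n * P.α) - qpow P.ħ (-(n * P.α)))) else 0) • 1 := by
  have hq := hP.one_sub_ne_zero
  have hn : ((n : ℕ) : ℂ) ≠ 0 := by exact_mod_cast n.ne_zero
  have := sectorEnd_annDer_crePoly P ((psiField .plus i).toField P) ((psiField .minus j).toField P)
    n k
  rw [psiLog, psiLog, this]
  congr 1
  split_ifs with h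
  · congr 1
    have e1 : ∀ a b : ℤ, pw P (2 * a, 2 * b) ^ (n : ℕ) =
        qpow P.ħ (a * n) * qpow P.ħ (b * (n * P.α)) :=
      fun a b => by
        rw [pw, ← qpow_mul_natCast, ← qpow_add, Exponent.val]
        congr 1
        push_cast
        ring
    have e2 := e1 (cartan i j) 1
    have e3 := e1 (-cartan i j) 1
    have e4 := e1 (cartan i j) (-1)
    have e5 := e1 (-cartan i j) (-1)
    rw [mul_neg] at e3 e5
    norm_num at e2 e3 e4 e5
    rw [ctr_toField hP, (contraction_psiField_psiField i j).eval_eq]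
    simp only [FormalSum.eval_cons, FormalSum.eval_nil, Pi.add_apply, Pi.smul_apply, Pi.zero_apply,
      logSeq, e2, e3, e4, e5, qnum]
    simp only [zsmul_eq_mul]
    push_cast
    field_simp
    ring
  · rw [zero_smul]

theorem hMode_commutator {P : Params} (hP : P.Generic) (i j : Fin 2) {m n : ℤ} (hm : m ≠ 0)
    (hn : n ≠ 0) :
    hMode P i m * hMode P j n = hMode P j n * hMode P i m +
      (if m + n = 0 then (qnum P.ħ (cartan i j * m) / m) * ((qpow P.ħ 1 - qpow P.ħ (-1))⁻¹ *
        (qpow P.ħ (m * P.α) - qpow P.ħ (-(m * P.α)))) else 0) • 1 := by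
  have hq := hP.one_sub_ne_zero
  obtain ⟨s, r, rfl⟩ := exists_sgn_mul hm
  obtain ⟨s', r', rfl⟩ := exists_sgn_mul hn
  have hr := r.pos
  have hr' := r'.pos
  rw [qnum_div_even, hMode_eq hP, hMode_eq hP, smul_mul_smul_comm, smul_mul_smul_comm]
  cases s <;> cases s'
  · rw [psiLog_comm, if_neg (by simp only [Sgn.val]; omega), zero_smul, add_zero, mul_comm]
  · rw [psiLog_plus_minus hP, smul_add, smul_smul, mul_comm]
    by_cases h : r = r'
    · subst h
      rw [if_pos rfl, if_pos (by simp [Sgn.val])]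
      congr 2
      simp only [Sgn.val]
      push_cast
      field_simp
    · have : (r : ℕ) ≠ r' := fun h' => h (PNat.eq h')
      rw [if_neg h, if_neg (by simp only [Sgn.val]; omega), mul_zero]
  · have h0 : psiLog P i r .minus * psiLog P j r' .plus =
        psiLog P j r' .plus * psiLog P i r .minus +
      -((if r' = r then -((qpow P.ħ 1 - qpow P.ħ (-1)) * (qnum P.ħ (cartan j i * r') / r') *
        (qpow P.ħ (r' * P.α) - qpow P.ħ (-(r' * P.α)))) else 0) • 1) :=
      eq_add_neg_of_add_eq (psiLog_plus_minus hP j i r' r).symm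
    have hc : cartan j i = cartan i j := by fin_cases i <;> fin_cases j <;> rfl
    rw [h0, smul_add, ← neg_smul, smul_smul, mul_comm]
    by_cases h : r' = r
    · subst h
      rw [if_pos rfl, if_pos (by simp [Sgn.val]), hc]
      congr 2
      simp only [Sgn.val]
      push_cast
      simp only [neg_mul, one_mul, neg_neg]
      field_simp
      ring
    · have : (r : ℕ) ≠ r' := fun h' => h (PNat.eq h'.symm)
      rw [if_neg h, if_neg (by simp only [Sgn.val]; omega), neg_zero, mul_zero]
  · rw [psiLog_comm, if_neg (by simp only [Sgn.val]; omega), zero_smul, add_zero, mul_comm]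

/-! ### Zero modes -/

theorem diagonal_single (e : (Ghost → ℤ) → ℂ) (m : Ghost → ℤ) (f : Poly) :
    diagonal e (Finsupp.single m f) = Finsupp.single m (e m • f) := by
  rw [diagonal, sectorwise_single, add_zero]; rfl

theorem diagonal_mul (e e' : (Ghost → ℤ) → ℂ) :
    diagonal e * diagonal e' = diagonal fun m => e m * e' m := by
  refine Finsupp.lhom_ext fun m f => ?_
  rw [Module.End.mul_apply, diagonal_single, diagonal_single, diagonal_single, smul_smul]

theorem diagonal_one : (diagonal fun _ => 1) = 1 := by
  refine Finsupp.lhom_ext fun m f => ?_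
  rw [diagonal_single, one_smul]; rfl

theorem diagonal_sectorEnd (e : (Ghost → ℤ) → ℂ) (T : Module.End ℂ Poly) :
    diagonal e * sectorEnd T = sectorEnd T * diagonal e := by
  refine Finsupp.lhom_ext fun m f => ?_
  rw [Module.End.mul_apply, Module.End.mul_apply, diagonal_single, sectorEnd_single,
    sectorEnd_single, diagonal_single, map_smul]

theorem diagonal_hMode {P : Params} (hP : P.Generic) (e : (Ghost → ℤ) → ℂ) (i : Fin 2) {m : ℤ}
    (hm : m ≠ 0) : diagonal e * hMode P i m = hMode P i m * diagonal e := by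
  obtain ⟨s, r, rfl⟩ := exists_sgn_mul hm
  rw [hMode_eq hP, mul_smul_comm, smul_mul_assoc]
  cases s <;> rw [psiLog, diagonal_sectorEnd]

theorem diagonal_expMode (P : Params) (E F : Field) (N : ℤ) :
    (diagonal fun m => qpow P.ħ (constTerm P E m)) * expMode P F N =
      qpow P.ħ (zeroPair E F) •
        (expMode P F N * diagonal fun m => qpow P.ħ (constTerm P E m)) := by
  refine Finsupp.lhom_ext fun m f => ?_
  rw [Module.End.mul_apply, LinearMap.smul_apply, Module.End.mul_apply, diagonal_single,
    expMode_single, expMode_single, diagonal_single, constTerm_add_momentum, qpow_add,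
    Finsupp.smul_single, map_smul]
  congr 1
  module

theorem diagonal_hZero_current {P : Params} (hP : P.Generic) (i : Fin 2) (s : Sgn) (j : Fin 2)
    (n : ℤ) :
    (diagonal fun m => qpow P.ħ (hZero P m i)) * current P s j n =
      qpow P.ħ (s.val * cartan i j) •
        (current P s j n * diagonal fun m => qpow P.ħ (hZero P m i)) := by
  have e1 : (fun m => qpow P.ħ (hZero P m i)) =
      fun m => qpow P.ħ (constTerm P ((psiField .plus i).toField P) m) := by
    funext m
    rw [constTerm_psiField P hP, Sgn.val, Int.cast_one, one_mul]
  rw [e1, current_eq_modes hP]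
  have h := modes_commute_of_terms (P := P) (X := currentTerms s j)
    (A := diagonal fun m => qpow P.ħ (constTerm P ((psiField .plus i).toField P) m))
    (N := -n - 1) (N' := 0) (x := qpow P.ħ (s.val * cartan i j)) (y := 0)
    fun t ht => mode_commute_of_field t ?_
  · rwa [zero_smul, add_zero] at h
  obtain ⟨-, -, h3, h4⟩ := contraction_psiField s i j t ht
  rw [zero_smul, add_zero, SymField.mode, diagonal_expMode, qpow_zeroPair hP, h3, h4, zpow_zero,
    one_mul, pw]
  congr 2
  simp only [Exponent.val]
  push_cast
  ring

end QSl21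

namespace QSl21

open SymField Term

/-! ### The degree operator -/

/-- The derivation with `B_{-n} ↦ -n B_{-n}`. -/
def degreeDer : Module.End ℂ Poly :=
  (MvPolynomial.mkDerivation ℂ fun v : Boson × ℕ+ =>
    -((v.2 : ℕ) : ℂ) • (MvPolynomial.X v : Poly)).toLinearMap

theorem degreeDer_one : degreeDer 1 = 0 := by simp [degreeDer]

theorem degreeDer_mul (f g : Poly) : degreeDer (f * g) = f * degreeDer g + degreeDer f * g := by
  simp only [degreeDer, Derivation.coeFn_coe, Derivation.leibniz, smul_eq_mul]
  rw [mul_comm g]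

theorem degreeDer_X (v : Boson × ℕ+) :
    degreeDer (MvPolynomial.X v) = -((v.2 : ℕ) : ℂ) • (MvPolynomial.X v : Poly) := by
  simp [degreeDer, MvPolynomial.mkDerivation_X]

theorem degreeDer_crePoly (E : Field) (n : ℕ+) :
    degreeDer (crePoly E n) = -((n : ℕ) : ℂ) • crePoly E n := by
  simp only [crePoly, map_sum, map_smul, degreeDer_X, Finset.smul_sum, smul_smul, mul_comm]

theorem degreeDer_annDer (P : Params) (E : Field) (n : ℕ+) (f : Poly) :
    degreeDer (annDer P E n f) = annDer P E n (degreeDer f) + ((n : ℕ) : ℂ) • annDer P E n f := by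
  induction f using Poly.induction with
  | one => simp only [annDer_one, degreeDer_one, map_zero, smul_zero, add_zero]
  | add f g hf hg => simp only [map_add, hf, hg, smul_add]; abel
  | smul a f hf => simp only [map_smul, hf, smul_add, smul_comm a]
  | mul v f hf =>
    have h : degreeDer (annDer P E n (MvPolynomial.X v)) = 0 := by
      rw [annDer_X]; split_ifs
      · rw [map_smul, degreeDer_one, smul_zero]
      · rw [map_zero]
    have h' : ((v.2 : ℕ) : ℂ) • annDer P E n (MvPolynomial.X v) =
        ((n : ℕ) : ℂ) • annDer P E n (MvPolynomial.X v) := by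
      rw [annDer_X]; split_ifs with hv
      · rw [hv]
      · rw [smul_zero, smul_zero]
    have h'' : annDer P E n (-((v.2 : ℕ) : ℂ) • (MvPolynomial.X v : Poly)) =
        -((n : ℕ) : ℂ) • annDer P E n (MvPolynomial.X v) := by
      rw [map_smul, neg_smul, h', neg_smul]
    rw [annDer_mul, map_add, degreeDer_mul, degreeDer_mul, h, hf, degreeDer_X, degreeDer_mul,
      degreeDer_X, map_add, annDer_mul, annDer_mul, h'']
    simp only [smul_mul_assoc, mul_smul_comm, mul_add, smul_add, zero_mul]
    module

theorem degreeDer_creCoeff (E : Field) (j : ℤ) :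
    degreeDer (creCoeff E j) = -(j : ℂ) • creCoeff E j := by
  rcases lt_or_ge j 0 with hj | hj
  · rw [creCoeff_neg E hj, map_zero, smul_zero]
  obtain ⟨m, rfl⟩ := Int.eq_ofNat_of_zero_le hj
  rw [creCoeff_natCast, Int.cast_natCast]
  change degreeDer (expCoeff (crePoly E) m) = -(m : ℂ) • expCoeff (crePoly E) m
  clear hj
  induction m using Nat.strong_induction_on with
  | _ m ih =>
    rcases m with _ | m
    · rw [expCoeff_zero, degreeDer_one, Nat.cast_zero, neg_zero, zero_smul]
    have hm : ((m : ℂ) + 1) ≠ 0 := by exact_mod_cast Nat.succ_ne_zero m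
    refine smul_right_injective Poly hm ?_
    simp only
    rw [← map_smul, smul_comm, expCoeff_succ (crePoly E) (fun i j => mul_comm _ _), map_sum,
      Finset.smul_sum]
    refine Finset.sum_congr rfl fun ij hij => ?_
    have hij := Finset.HasAntidiagonal.mem_antidiagonal.1 hij
    rw [map_smul, degreeDer_mul, ih ij.2 (by omega), degreeDer_crePoly, ← hij]
    simp only [Nat.succPNat_coe]
    push_cast
    simp only [smul_mul_assoc, mul_smul_comm]
    module

theorem degreeDer_annCoeff (P : Params) (E : Field) (r : ℕ) (f : Poly) :
    degreeDer (annCoeff P E r f) = annCoeff P E r (degreeDer f) + (r : ℂ) • annCoeff P E r f := by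
  induction f using Poly.induction generalizing r with
  | one =>
    rw [annCoeff_one, degreeDer_one, map_zero]
    split_ifs with h
    · rw [degreeDer_one, h, Nat.cast_zero, zero_smul, zero_add]
    · rw [map_zero, smul_zero, zero_add]
  | add f g hf hg => simp only [map_add, hf, hg, smul_add]; abel
  | smul a f hf => simp only [map_smul, hf, smul_add, smul_comm a]
  | mul v f hf =>
    simp only [degreeDer_mul, degreeDer_X, map_add, smul_mul_assoc, map_smul, annCoeff_X_mul]
    split_ifs with hv
    · have : ((r - (v.2 : ℕ) : ℕ) : ℂ) = r - (v.2 : ℕ) := Nat.cast_sub hv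
      simp only [map_smul, hf, this, smul_add, mul_add, mul_smul_comm]
      module
    · simp only [map_zero, add_zero, hf, mul_add, mul_smul_comm]
      module

theorem degreeDer_polyMode (P : Params) (E : Field) (N : ℤ) (f : Poly) :
    degreeDer (polyMode P E N f) =
      polyMode P E N (degreeDer f) - (N : ℂ) • polyMode P E N f := by
  set D := max (annExp P E f).natDegree (annExp P E (degreeDer f)).natDegree + 1
  rw [polyMode_eq_sum_annCoeff P E N f (D := D) (by omega),
    polyMode_eq_sum_annCoeff P E N _ (D := D) (by omega), map_sum, Finset.smul_sum,
    ← Finset.sum_sub_distrib]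
  refine Finset.sum_congr rfl fun r _ => ?_
  rw [degreeDer_mul, degreeDer_creCoeff, degreeDer_annCoeff]
  push_cast
  simp only [mul_add, smul_mul_assoc, mul_smul_comm]
  module

theorem dOp_single (P : Params) (m : Ghost → ℤ) (f : Poly) :
    dOp P (Finsupp.single m f) = Finsupp.single m (degreeDer f + dZero P m • f) := by
  rw [dOp, sectorwise_single, add_zero]; rfl

theorem dOp_sectorEnd (P : Params) {T : Module.End ℂ Poly} {x : ℂ}
    (h : ∀ f, degreeDer (T f) = T (degreeDer f) + x • T f) :
    dOp P * sectorEnd T = sectorEnd T * dOp P + x • sectorEnd T := by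
  refine Finsupp.lhom_ext fun m f => ?_
  rw [LinearMap.add_apply, Module.End.mul_apply, Module.End.mul_apply, LinearMap.smul_apply,
    sectorEnd_single, dOp_single, dOp_single, sectorEnd_single, Finsupp.smul_single,
    ← Finsupp.single_add, h, map_add, map_smul]
  congr 1
  abel

theorem dOp_hMode {P : Params} (hP : P.Generic) (i : Fin 2) {m : ℤ} (hm : m ≠ 0) :
    dOp P * hMode P i m = hMode P i m * dOp P + (m : ℂ) • hMode P i m := by
  obtain ⟨s, r, rfl⟩ := exists_sgn_mul hm
  have h : dOp P * psiLog P i r s = psiLog P i r s * dOp P +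
      ((s.val * (r : ℤ) : ℤ) : ℂ) • psiLog P i r s := by
    cases s
    · refine dOp_sectorEnd P fun f => ?_
      rw [degreeDer_annDer, Sgn.val, one_mul, Int.cast_natCast]
    · refine dOp_sectorEnd P fun f => ?_
      rw [LinearMap.mulLeft_apply, LinearMap.mulLeft_apply, degreeDer_mul, degreeDer_crePoly,
        Sgn.val, smul_mul_assoc]
      push_cast
      rw [neg_one_mul]
  rw [hMode_eq hP, mul_smul_comm, smul_mul_assoc, h, smul_add, smul_comm _ ((_ : ℤ) : ℂ)]

theorem dOp_diagonal (P : Params) (e : (Ghost → ℤ) → ℂ) :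
    dOp P * diagonal e = diagonal e * dOp P := by
  refine Finsupp.lhom_ext fun m f => ?_
  rw [Module.End.mul_apply, Module.End.mul_apply, diagonal_single, dOp_single, dOp_single,
    diagonal_single, map_smul, smul_add, smul_comm (dZero P m)]

/-- The commutator of `d` with a mode of an exponential is `x - N` times the mode, if the change of
the zero mode part of `d` compensates the dependence of the exponent of `z` on the sector. -/
theorem dOp_expMode (P : Params) (E : Field) {x : ℂ}
    (h : ∀ m, (zExponent E m : ℂ) + dZero P (m + E.charge) - dZero P m = x) (N : ℤ) :
    dOp P * expMode P E N = expMode P E N * dOp P + (x - N) • expMode P E N := by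
  refine Finsupp.lhom_ext fun m f => ?_
  rw [LinearMap.add_apply, Module.End.mul_apply, Module.End.mul_apply, LinearMap.smul_apply,
    expMode_single, dOp_single, dOp_single, expMode_single, Finsupp.smul_single,
    ← Finsupp.single_add, map_smul, map_add, map_smul, degreeDer_polyMode]
  congr 1
  rw [← h m]
  push_cast
  module

namespace SymField

/-- Twice the constant by which the commutator of `d` with an exponential of the given charge
differs from the negative of the exponent of `z`. -/
def weightDefect (s : SymField) : ℤ :=
  s.charge .b12 ^ 2 - s.charge .b13 * (s.charge .b13 + 1) - s.charge .b23 * (s.charge .b23 + 1) -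
    s.charge .c ^ 2

theorem weight_toField (P : Params) (s : SymField) (m : Ghost → ℤ) :
    (zExponent (s.toField P) m : ℂ) + dZero P (m + (s.toField P).charge) - dZero P m =
      (weightDefect s : ℂ) / 2 := by
  have ha : ∀ i, zeroMode P (m + s.charge) (.a i) = zeroMode P m (.a i) := fun i => rfl
  simp only [zExponent, sum_ghost, dZero, toField, ha]
  simp only [zeroMode, Ghost.sign, weightDefect, Pi.add_apply]
  push_cast
  ring

end SymField

/-- The zero mode part of `d` is such that every current has conformal weight `1`. -/
theorem weightDefect_currentTerms :
    ∀ i : Fin 2, ∀ t ∈ currentTerms .plus i ++ currentTerms .minus i,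
      weightDefect t.field = 2 * ((t.depth : ℤ) - 1) := by decide +kernel

theorem dOp_current {P : Params} (hP : P.Generic) (s : Sgn) (i : Fin 2) (n : ℤ) :
    dOp P * current P s i n = current P s i n * dOp P + (n : ℂ) • current P s i n := by
  rw [current_eq_modes hP]
  have h := modes_commute_of_terms (P := P) (X := currentTerms s i) (A := dOp P)
    (N := -n - 1) (N' := -n - 1) (x := 1) (y := n)
    fun t ht => mode_commute_of_field t ?_
  · rwa [one_smul] at h
  have ht' : t ∈ currentTerms .plus i ++ currentTerms .minus i := by
    cases s
    · exact List.mem_append_left _ ht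
    · exact List.mem_append_right _ ht
  have hw := weightDefect_currentTerms i t ht'
  rw [one_smul, SymField.mode, dOp_expMode P _ (x := t.depth - 1)]
  · congr 2
    push_cast
    ring
  · intro m
    rw [weight_toField, hw]
    push_cast
    ring

end QSl21

namespace QSl21

open SymField Term

/-! ### The defining relations hold on the Fock space -/

/-- The operators on the Fock space that realize the words in the generators. -/
def realizeHom (P : Params) : Words →ₐ[ℂ] Module.End ℂ Fock := FreeAlgebra.lift ℂ (realize P)

theorem realizeHom_ι (P : Params) (g : Gen) :
    realizeHom P (FreeAlgebra.ι ℂ g) = realize P g := FreeAlgebra.lift_ι_apply ..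

theorem realizeHom_X (P : Params) (s : Sgn) (i : Fin 2) (n : ℤ) :
    realizeHom P (Words.X s i n) = current P s i n := realizeHom_ι ..

theorem realizeHom_h (P : Params) (i : Fin 2) {m : ℤ} (hm : m ≠ 0) :
    realizeHom P (Words.h i m) = hMode P i m := by
  rw [Words.h, dif_pos hm]; exact realizeHom_ι ..

theorem realizeHom_K (P : Params) (i : Fin 2) (s : Sgn) :
    realizeHom P (Words.K i s) = diagonal fun m => qpow P.ħ (s.val * hZero P m i) :=
  realizeHom_ι ..

theorem realizeHom_d (P : Params) : realizeHom P Words.d = dOp P := realizeHom_ι ..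

theorem realizeHom_C (P : Params) (n : ℤ) :
    realizeHom P (Words.C n) = qpow P.ħ (n * (P.α / 2)) • 1 := by
  have h : ∀ (x : ℂ) (k : ℕ), (x • (1 : Module.End ℂ Fock)) ^ k = x ^ k • 1 := fun x k => by
    rw [smul_pow, one_pow]
  rw [Words.C]
  split_ifs with hn
  · obtain ⟨k, rfl⟩ := Int.eq_ofNat_of_zero_le hn
    rw [map_pow, realizeHom_ι, realize, h, ← qpow_mul_natCast]
    congr 2
    simp only [Sgn.val, Int.toNat_natCast]
    push_cast
    ring
  · obtain ⟨k, hk⟩ := Int.eq_ofNat_of_zero_le (show 0 ≤ -n by omega)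
    obtain rfl : n = -(k : ℤ) := by omega
    rw [map_pow, realizeHom_ι, realize, h, ← qpow_mul_natCast]
    congr 2
    simp only [Sgn.val, neg_neg, Int.toNat_natCast]
    push_cast
    ring

theorem realizeHom_psi {P : Params} (hP : P.Generic) (s : Sgn) (i : Fin 2) (n : ℤ) :
    realizeHom P (Words.psi P.ħ s i n) = (psiField s i).mode P (-n) := by
  rw [psiField_mode hP, Words.psi]
  split_ifs with h
  · rw [map_mul, realizeHom_K, expCoeff_map]
    congr 2
    funext r
    have hr : s.val * (r : ℤ) ≠ 0 := by
      have := r.pos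
      cases s <;> simp only [Sgn.val] <;> omega
    rw [map_smul, realizeHom_h P i hr]
  · exact map_zero _

theorem map_qbracket {A B : Type*} [Ring A] [Algebra ℂ A] [Ring B] [Algebra ℂ B] (φ : A →ₐ[ℂ] B)
    (p r : ℕ) (ξ : ℂ) (x y : A) : φ (qbracket p r ξ x y) = qbracket p r ξ (φ x) (φ y) := by
  rw [qbracket, map_sub, map_smul, map_mul, map_mul, qbracket]

/-- The sum of residues in the commutator of `X^{+,i}` and `X^{-,i}`. -/
theorem deltaSum_of_isPsi {P : Params} {i : Fin 2} {l : List (Exponent × Term)}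
    (h : IsPsi i l) (m n : ℤ) :
    deltaSum P l (-m - 1) (-m - n - 1) = (qpow P.ħ 1 - qpow P.ħ (-1))⁻¹ •
      (qpow P.ħ ((m - n : ℤ) * (P.α / 2)) • (psiField .plus i).mode P (-(m + n)) -
        qpow P.ħ ((-(m - n) : ℤ) * (P.α / 2)) • (psiField .minus i).mode P (-(m + n))) := by
  have key : ∀ (s : Sgn) (x : ℤ), pw P (0, 2 * x) ^ (-(-m - 1) - 1) *
      pw P (0, x) ^ (-m - n - 1 + (1 : ℕ)) = qpow P.ħ ((x * (m - n) : ℤ) * (P.α / 2)) := by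
    intro s x
    rw [pw, pw, ← qpow_mul_intCast, ← qpow_mul_intCast, ← qpow_add, Exponent.val, Exponent.val]
    congr 1
    push_cast
    ring
  have k1 := key .plus 1
  have k2 := key .plus (-1)
  rw [one_mul] at k1
  rw [neg_one_mul] at k2
  have hT : -m - n - 1 + ((1 : ℕ) : ℤ) = -(m + n) := by push_cast; ring
  have main : ∀ a b : Exponent × Term, a.1 = (0, 2) →
      Term.Equal a.2 ⟨1, 0, 1, (psiField .plus i).rescale (0, 1)⟩ → b.1 = (0, -2) →
      Term.Equal b.2 ⟨-1, 0, 1, (psiField .minus i).rescale (0, -1)⟩ →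
      pw P a.1 ^ (-(-m - 1) - 1) • a.2.mode P (-m - n - 1) +
        pw P b.1 ^ (-(-m - 1) - 1) • b.2.mode P (-m - n - 1) =
      (qpow P.ħ 1 - qpow P.ħ (-1))⁻¹ •
        (qpow P.ħ ((m - n : ℤ) * (P.α / 2)) • (psiField .plus i).mode P (-(m + n)) -
          qpow P.ħ ((-(m - n) : ℤ) * (P.α / 2)) • (psiField .minus i).mode P (-(m + n))) := by
    intro a b h1 h2 h3 h4
    have hsub : ∀ (c : ℂ) (A B : Module.End ℂ Fock), c • (A - B) = c • A + (-c) • B :=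
      fun c A B => by rw [smul_sub, neg_smul, sub_eq_add_neg]
    rw [h1, h3, h2.mode_eq, h4.mode_eq, Term.mode, Term.mode, coef, coef, mode_rescale,
      mode_rescale, hsub, ← k1, ← k2, hT]
    simp only [smul_smul]
    have hz : pw P 0 = 1 := pw_zero P
    rw [hz]
    push_cast
    congr 2 <;> ring
  match l, h with
  | [a, b], ⟨h1, h2, h3, h4⟩ =>
    simp only [deltaSum, List.map_cons, List.map_nil, List.sum_cons, List.sum_nil, add_zero]
    exact main a b h1 h2 h3 h4
  | [a, r, b, r'], ⟨⟨h1, h2, h3, h4⟩, h5, h6⟩ =>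
    simp only [deltaSum, List.map_cons, List.map_nil, List.sum_cons, List.sum_nil, add_zero]
    rw [← main a b h1 h2 h3 h4, h5, ← add_assoc, ← add_assoc, add_right_comm _ _ (pw P b.1 ^ _ • _),
      add_assoc, ← smul_add, h6.mode_add, smul_zero, add_zero]

/-- The commutator of `X^{+,i}` and `X^{-,j}`: the residues give `ψ^{±,i}` for `i = j`, and cancel
otherwise. -/
theorem current_commutator {P : Params} (hP : P.Generic) (i j : Fin 2) (m n : ℤ) :
    qbracket (nodeParity i) (nodeParity j) 1 (current P .plus i m) (current P .minus j n) =
      deltaSum P (singularParts (currentTerms .plus i) (currentTerms .minus j)) (-m - 1)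
        (-m - n - 1) := by
  have h := modes_commutator hP (local_plus_minus i j) (-m - 1) (-n - 1)
  rw [zpow_natCast, show -m - 1 + (-n - 1) + 1 = -m - n - 1 by ring] at h
  rw [qbracket, current_eq_modes hP, current_eq_modes hP, mul_one, h]

theorem qbracket_exchange {A : Type*} [Ring A] [Algebra ℂ A] {p r : ℕ} (h : p * r = 0) (ξ : ℂ)
    (x y : A) : qbracket p r ξ x y = x * y - ξ • (y * x) := by
  rw [qbracket, h, pow_zero, one_mul]

theorem qbracket_qbracket_symm {A : Type*} [Ring A] [Algebra ℂ A] (t : ℂ) (ht : t ≠ 0) (x y z : A) :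
    qbracket 0 1 t x (qbracket 0 1 t⁻¹ y z) + qbracket 0 1 t y (qbracket 0 1 t⁻¹ x z) =
      t⁻¹ • (serreHalf t x y z + serreHalf t y x z) := by
  rw [qbracket_exchange (zero_mul 1), qbracket_exchange (zero_mul 1),
    qbracket_exchange (zero_mul 1), qbracket_exchange (zero_mul 1), serreHalf, serreHalf]
  have h : t⁻¹ * t = 1 := inv_mul_cancel₀ ht
  have h' : t * t⁻¹ = 1 := mul_inv_cancel₀ ht
  have h2 : t⁻¹ * (t * t + 1) = t + t⁻¹ := by field_simp
  simp only [mul_sub, sub_mul, smul_sub, smul_add, mul_smul_comm, smul_mul_assoc, smul_smul,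
    ← mul_assoc, h, h', one_smul, one_mul, add_smul]
  abel

theorem serreHalf_inv {A : Type*} [Ring A] [Algebra ℂ A] {t : ℂ} (ht : t ≠ 0) (x y z : A) :
    serreHalf t⁻¹ x y z = (t⁻¹ * t⁻¹) • serreHalf t x y z := by
  have h1 : t⁻¹ * t⁻¹ * t = t⁻¹ := by field_simp
  have h2 : t⁻¹ * t⁻¹ * (t * t + 1) = t⁻¹ * t⁻¹ + 1 := by field_simp; ring
  rw [serreHalf, serreHalf]
  simp only [smul_sub, smul_add, smul_smul, h1, h2]

theorem qpow_one_eq (P : Params) : qpow P.ħ 1 = pw P (2, 0) := by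
  rw [pw]; congr 1; simp [Exponent.val]

theorem serre_current {P : Params} (hP : P.Generic) (s : Sgn) (n₁ n₂ m : ℤ) :
    serreHalf (qpow P.ħ 1) (current P s 0 n₁) (current P s 0 n₂) (current P s 1 m) +
      serreHalf (qpow P.ħ 1) (current P s 0 n₂) (current P s 0 n₁) (current P s 1 m) = 0 := by
  simp only [current_eq_modes hP, qpow_one_eq]
  cases s
  · have h := serre_plus hP (-n₁ - 1) (-n₂ - 1) (-m - 1)
    have h2 : pw P (-2, 0) = (pw P (2, 0))⁻¹ :=
      (congrArg (pw P) (by decide)).trans (pw_neg P (2, 0))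
    have h0 := inv_ne_zero (pw_ne_zero P (2, 0))
    rw [h2, serreHalf_inv (pw_ne_zero P _), serreHalf_inv (pw_ne_zero P _), ← smul_add] at h
    exact (smul_eq_zero.1 h).resolve_left (mul_ne_zero h0 h0)
  · exact serre_minus hP (-n₁ - 1) (-n₂ - 1) (-m - 1)

theorem qpow_eq_pw (P : Params) (a b : ℤ) (h : a = 2 * b) : qpow P.ħ b = pw P (a, 0) := by
  rw [pw, Exponent.val, h]
  congr 1
  push_cast
  ring

theorem exchange_current {P : Params} (hP : P.Generic) (s : Sgn) (i j : Fin 2) (m n : ℤ)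
    (hij : cartan i j ≠ 0) :
    current P s i (m + 1) * current P s j n -
        qpow P.ħ (s.val * cartan i j) • (current P s j n * current P s i (m + 1)) +
      (current P s j (n + 1) * current P s i m -
        qpow P.ħ (s.val * cartan i j) • (current P s i m * current P s j (n + 1))) = 0 := by
  have e : ∀ k : ℤ, -(k + 1) - 1 = -k - 1 - 1 := fun k => by ring
  have hc : (s.val * cartan i j : ℂ) = (s.val * cartan i j : ℤ) := by push_cast; rfl
  have h1 := coeffExchange_self hP s (-m - 1) (-n - 1)
  have h2 := coeffExchange_mixed hP s (-m - 1) (-n - 1)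
  have h3 := coeffExchange_mixed hP s (-n - 1) (-m - 1)
  simp only [current_eq_modes hP, e, hc]
  fin_cases i <;> fin_cases j
  · rw [qpow_eq_pw P (4 * s.val) _ (by simp [cartan]; ring)]
    exact h1
  · rw [qpow_eq_pw P (-2 * s.val) _ (by simp [cartan])]
    exact h2
  · rw [qpow_eq_pw P (-2 * s.val) _ (by simp [cartan]), add_comm]
    exact h3
  · exact absurd rfl hij

/-- The operators of the realization satisfy the defining relations. -/
theorem realizeHom_rel {P : Params} (hP : P.Generic) {a b : Words} (h : Rel P.ħ a b) :
    realizeHom P a = realizeHom P b := by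
  have hsub : ∀ x y : Words, realizeHom P (x - y) = realizeHom P x - realizeHom P y :=
    map_sub (realizeHom P)
  have hC : ∀ (x : ℂ) (A : Module.End ℂ Fock), x • (1 : Module.End ℂ Fock) * A = A * x • 1 :=
    fun x A => by rw [smul_mul_assoc, one_mul, mul_smul_comm, mul_one]
  have hsub_eq : ∀ {A B C : Module.End ℂ Fock}, A = B + C → A - B = C := fun h =>
    sub_eq_of_eq_add' h
  induction h with
  | C_central s g =>
    rw [map_mul, map_mul, realizeHom_ι, realize, hC]
  | C_inv =>
    rw [map_mul, map_one, realizeHom_ι, realizeHom_ι, realize, realize, smul_mul_smul_comm,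
      ← qpow_add, one_mul]
    have : ((Sgn.plus.val : ℤ) : ℂ) * (P.α / 2) + ((Sgn.minus.val : ℤ) : ℂ) * (P.α / 2) = 0 := by
      simp [Sgn.val]
    rw [this, qpow_zero, one_smul]
  | K_inv i =>
    rw [map_mul, map_one, realizeHom_K, realizeHom_K, diagonal_mul, ← diagonal_one]
    congr 1
    funext m
    rw [← qpow_add, ← qpow_zero P.ħ]
    congr 1
    simp [Sgn.val]
  | K_inv' i =>
    rw [map_mul, map_one, realizeHom_K, realizeHom_K, diagonal_mul, ← diagonal_one]
    congr 1
    funext m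
    rw [← qpow_add, ← qpow_zero P.ħ]
    congr 1
    simp [Sgn.val]
  | K_K i j s t =>
    rw [map_mul, map_mul, realizeHom_K, realizeHom_K, diagonal_mul, diagonal_mul]
    congr 1
    funext m
    exact mul_comm _ _
  | K_h i j s m hm =>
    rw [map_mul, map_mul, realizeHom_K, realizeHom_h P j hm, diagonal_hMode hP _ j hm]
  | d_K i s => rw [map_mul, map_mul, realizeHom_K, realizeHom_d, dOp_diagonal]
  | d_h j m hm =>
    rw [hsub, map_mul, map_mul, map_smul, realizeHom_h P j hm, realizeHom_d]
    exact hsub_eq (dOp_hMode hP j hm)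
  | d_X s j m =>
    rw [hsub, map_mul, map_mul, map_smul, realizeHom_X, realizeHom_d]
    exact hsub_eq (dOp_current hP s j m)
  | h_h i j m n hm hn =>
    rw [hsub, map_mul, map_mul, realizeHom_h P i hm, realizeHom_h P j hn]
    refine hsub_eq ((hMode_commutator hP i j hm hn).trans ?_)
    congr 1
    split_ifs
    · rw [map_smul, map_smul, hsub, realizeHom_C, realizeHom_C]
      have e1 : ((2 * m : ℤ) : ℂ) * (P.α / 2) = m * P.α := by push_cast; ring
      have e2 : ((-(2 * m) : ℤ) : ℂ) * (P.α / 2) = -(m * P.α) := by push_cast; ring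
      rw [e1, e2]
      have : ∀ x y : ℂ, x • (1 : Module.End ℂ Fock) - y • 1 = (x - y) • 1 := fun x y =>
        (sub_smul x y _).symm
      rw [this, smul_smul, smul_smul, mul_assoc]
    · rw [zero_smul, map_zero]
  | K_X i s j m =>
    rw [map_mul, map_mul, map_smul, realizeHom_K, realizeHom_K, realizeHom_X]
    have e : (fun m => qpow P.ħ ((Sgn.plus.val : ℤ) * hZero P m i)) =
        fun m => qpow P.ħ (hZero P m i) := by
      funext m; rw [Sgn.val, Int.cast_one, one_mul]
    rw [e, diagonal_hZero_current hP, smul_mul_assoc, mul_assoc, diagonal_mul]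
    congr 1
    have : (fun m => qpow P.ħ (hZero P m i) * qpow P.ħ ((Sgn.minus.val : ℤ) * hZero P m i)) =
        fun _ => 1 := by
      funext m
      rw [← qpow_add, ← qpow_zero P.ħ]
      congr 1
      simp [Sgn.val]
    rw [this, diagonal_one, mul_one]
  | h_X i m hm s j n =>
    rw [hsub, map_mul, map_mul, map_smul, map_mul, realizeHom_C, realizeHom_X, realizeHom_X,
      realizeHom_h P i hm, hMode_commutator_current hP i hm, smul_mul_assoc, one_mul]
  | X_X i j m n =>
    rw [map_qbracket, realizeHom_X, realizeHom_X, current_commutator hP]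
    split_ifs with hij
    · subst hij
      rw [deltaSum_of_isPsi (isPsi i), map_smul, hsub, map_mul, map_mul, realizeHom_C,
        realizeHom_C, realizeHom_psi hP, realizeHom_psi hP, smul_mul_assoc, smul_mul_assoc,
        one_mul, one_mul]
    · rw [(cancels_of_ne i j hij).deltaSum_eq, map_zero]
  | X2_X2 s m n =>
    rw [map_qbracket, map_zero, realizeHom_X, realizeHom_X, qbracket, current_eq_modes hP,
      current_eq_modes hP, ← anticommute_odd hP s (-m - 1) (-n - 1)]
    norm_num
  | exch s i j m n hij =>
    have hp : nodeParity i * nodeParity j = 0 := by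
      fin_cases i <;> fin_cases j
      · rfl
      · rfl
      · rfl
      · exact absurd rfl hij
    rw [map_add, map_qbracket, map_qbracket, map_zero, qbracket_exchange hp,
      qbracket_exchange ((mul_comm _ _).trans hp)]
    simp only [realizeHom_X]
    exact exchange_current hP s i j m n hij
  | serre_rel s n₁ n₂ m =>
    rw [map_add, map_zero, Words.serre, Words.serre]
    simp only [map_qbracket, realizeHom_X, qpow_neg]
    rw [qbracket_qbracket_symm _ (qpow_ne_zero _ _), serre_current hP, smul_zero]

end QSl21

namespace QSl21

open SymField Term

/-! ### The ghost system and the restricted Fock space -/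

/-- The current `η(z)`. -/
def etaTerm : Term := ⟨1, 0, 0, SymField.full .c 0 0⟩

/-- The current `ξ(z)`. -/
def xiTerm : Term := ⟨1, 0, 0, -SymField.full .c 0 0⟩

theorem mode_of_trivial_coef (P : Params) (s : SymField) (N : ℤ) :
    Term.mode P ⟨1, 0, 0, s⟩ N = expMode P (s.toField P) N := by
  rw [Term.mode, coef, pw_zero, pow_zero, inv_one, Int.cast_one, one_mul, one_mul, one_smul,
    Nat.cast_zero, add_zero]
  rfl

theorem eta_eq (P : Params) (n : ℤ) : eta P n = etaTerm.mode P (-n - 1) := by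
  have h0 : Exponent.val P 0 = 0 := by simp [Exponent.val]
  rw [etaTerm, mode_of_trivial_coef, toField_full, h0, eta]

theorem xi_eq (P : Params) (n : ℤ) : xi P n = xiTerm.mode P (-n) := by
  have h0 : Exponent.val P 0 = 0 := by simp [Exponent.val]
  rw [xiTerm, mode_of_trivial_coef, toField_neg, toField_full, h0, xi]

theorem expMode_zero (P : Params) : expMode P 0 0 = 1 := by
  rw [expMode_of_cre_eq_zero P rfl rfl, if_pos le_rfl]
  have h : (fun m => qpow P.ħ (constTerm P 0 m)) = fun _ => 1 := by
    funext m
    rw [constTerm, Finset.sum_eq_zero, qpow_zero]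
    intro B _
    exact zero_mul _
  rw [h, diagonal_one, one_mul]
  change sectorEnd (expCoeff _ 0) = 1
  rw [expCoeff_zero, map_one]

/-- The only pole of `η(z) ξ(w)` is at `z = w`, and its residue is `1`. -/
theorem eta_xi_anticommutator {P : Params} (hP : P.Generic) :
    eta P 0 * xi P 0 + xi P 0 * eta P 0 = 1 := by
  have h1 : Local 1 etaTerm xiTerm := by decide +kernel
  have h2 : (singular etaTerm xiTerm).map Prod.fst = [(0, 0)] := by decide +kernel
  have h3 : ∀ x ∈ singular etaTerm xiTerm,
      Term.Equal x.2 ⟨1, 0, 0, ⟨fun _ => [], fun _ => [], fun _ => 0, fun _ => 0, fun _ => 0⟩⟩ := by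
    decide +kernel
  obtain ⟨⟨_, r⟩, hr, rfl⟩ := List.map_eq_singleton_iff.1 h2
  have hr' := h3 (_, r) (hr ▸ List.mem_singleton_self _)
  have h := h1.commutator hP (-0 - 1) (-0)
  have hz : (⟨fun _ => [], fun _ => [], fun _ => 0, fun _ => 0, fun _ => 0⟩ : SymField).toField P
      = 0 := by
    refine Field.ext' ?_ ?_ rfl ?_
    · funext B n; exact mul_zero _
    · funext B n; exact mul_zero _
    · funext B
      change _ = (0 : ℂ)
      cases B <;> simp [toField, Exponent.val]
  rw [← eta_eq, ← xi_eq, hr, deltaSum, List.map_singleton, List.sum_singleton, hr'.mode_eq,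
    mode_of_trivial_coef, hz, neg_zero, zero_sub, neg_neg, sub_self, zpow_zero, one_smul,
    add_zero, neg_add_cancel, expMode_zero, zpow_one, neg_one_smul] at h
  rw [← h]
  exact (sub_neg_eq_add _ _).symm

theorem eta_sq {P : Params} (hP : P.Generic) : eta P 0 * eta P 0 = 0 := by
  have h1 : Local 1 etaTerm etaTerm := by decide +kernel
  have h2 : singular etaTerm etaTerm = [] := by decide +kernel
  have h := h1.commutator hP (-0 - 1) (-0 - 1)
  rw [← eta_eq, h2, zpow_one, neg_one_smul] at h
  have h3 : eta P 0 * eta P 0 + eta P 0 * eta P 0 = 0 := (sub_neg_eq_add _ _).symm.trans h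
  rw [← two_smul ℂ] at h3
  exact (smul_eq_zero.1 h3).resolve_left two_ne_zero

/-- There are no residues, or two residues with opposite signs, wherever the poles are. -/
def ResiduesCancel : List (Exponent × Term) → Prop
  | [] => True
  | [a, b] => Opposite a.2 b.2
  | _ => False

instance (l : List (Exponent × Term)) : Decidable (ResiduesCancel l) := by
  unfold ResiduesCancel; split <;> infer_instance

/-- In the commutator with the zero mode of a current, the position of a pole does not matter. -/
theorem ResiduesCancel.deltaSum_eq {l : List (Exponent × Term)} (h : ResiduesCancel l)
    (P : Params) (T : ℤ) : deltaSum P l (-1) T = 0 := by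
  match l, h with
  | [], _ => rfl
  | [a, b], h =>
    simp only [deltaSum, List.map_cons, List.map_nil, List.sum_cons, List.sum_nil, add_zero,
      neg_neg, sub_self, zpow_zero, one_smul]
    exact h.mode_add P T

/-- `η(z)` commutes with the terms of `X^{±,1}` and anticommutes with those of `X^{±,2}`, up to
delta functions. -/
theorem local_eta (s : Sgn) : ∀ i : Fin 2, ∀ t ∈ [etaTerm], ∀ u ∈ currentTerms s i,
    Local (nodeParity i : ℕ) t u := by cases s <;> decide +kernel

theorem residuesCancel_eta (s : Sgn) : ∀ i : Fin 2,
    ResiduesCancel (singularParts [etaTerm] (currentTerms s i)) := by cases s <;> decide +kernel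

theorem eta_current {P : Params} (hP : P.Generic) (s : Sgn) (i : Fin 2) (n : ℤ) :
    eta P 0 * current P s i n = (-1 : ℂ) ^ nodeParity i • (current P s i n * eta P 0) := by
  have h := modes_commutator hP (local_eta s i) (-0 - 1) (-n - 1)
  have h1 : modes P [etaTerm] (-0 - 1) = eta P 0 := by
    rw [modes_cons, modes_nil, add_zero, eta_eq]
  rw [← current_eq_modes hP, h1, zpow_natCast, neg_zero, zero_sub,
    (residuesCancel_eta s i).deltaSum_eq] at h
  exact sub_eq_zero.1 h

theorem eta_hMode {P : Params} (hP : P.Generic) (i : Fin 2) {m : ℤ} (hm : m ≠ 0) :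
    eta P 0 * hMode P i m = hMode P i m * eta P 0 := by
  obtain ⟨s, r, rfl⟩ := exists_sgn_mul hm
  have h1 : ∀ i, FormalSum.Equal (contraction (psiField .plus i) etaTerm.field) [] := by
    decide +kernel
  have h2 : ∀ i, FormalSum.Equal (contraction etaTerm.field (psiField .minus i)) [] := by
    decide +kernel
  rw [hMode_eq hP, mul_smul_comm, smul_mul_assoc]
  congr 1
  rw [eta_eq, etaTerm, mode_of_trivial_coef]
  cases s
  · have := sectorEnd_annDer_expMode P ((psiField .plus i).toField P) (etaTerm.field.toField P) r
      (-0 - 1)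
    rw [ctr_toField hP, (h1 i).eval_eq, FormalSum.eval_nil, Pi.zero_apply, zero_smul,
      add_zero] at this
    exact this.symm
  · have := sectorEnd_crePoly_expMode P ((psiField .minus i).toField P) (etaTerm.field.toField P) r
      (-0 - 1)
    rw [ctr_toField hP, (h2 i).eval_eq, FormalSum.eval_nil, Pi.zero_apply, zero_smul,
      add_zero] at this
    exact this

/-- Functions of the momenta pass the exponentials up to the shift of the momenta. -/
theorem diagonal_expMode_shift (P : Params) (E : Field) (e : (Ghost → ℤ) → ℂ) (N : ℤ) :
    diagonal e * expMode P E N = expMode P E N * diagonal fun m => e (m + E.charge) := by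
  refine Finsupp.lhom_ext fun m f => ?_
  rw [Module.End.mul_apply, Module.End.mul_apply, diagonal_single, expMode_single, diagonal_single,
    expMode_single, map_smul, smul_comm]

theorem diagonal_smul (x : ℂ) (e : (Ghost → ℤ) → ℂ) :
    diagonal (fun m => x * e m) = x • diagonal e := by
  refine Finsupp.lhom_ext fun m f => ?_
  rw [LinearMap.smul_apply, diagonal_single, diagonal_single, Finsupp.smul_single, smul_smul]

theorem eta_diagonal (P : Params) {e : (Ghost → ℤ) → ℂ}
    (h : ∀ m, e (m + Pi.single .c 1) = e m) : eta P 0 * diagonal e = diagonal e * eta P 0 := by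
  have := diagonal_expMode_shift P (QSl21.full P.ħ .c 0 0) e (-0 - 1)
  rw [show (fun m => e (m + (QSl21.full P.ħ .c 0 0).charge)) = e from funext h] at this
  exact this.symm

theorem eta_dOp (P : Params) : eta P 0 * dOp P = (dOp P - (2⁻¹ : ℂ) • 1) * eta P 0 := by
  have h := dOp_expMode P ((SymField.full .c 0 0).toField P)
    (x := ((weightDefect (SymField.full .c 0 0) : ℤ) : ℂ) / 2) (weight_toField P _) (-0 - 1)
  have hw : weightDefect (SymField.full .c 0 0) = -1 := by decide +kernel
  have he : eta P 0 = expMode P ((SymField.full .c 0 0).toField P) (-0 - 1) := by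
    rw [eta_eq, etaTerm, mode_of_trivial_coef]
  rw [← he, hw] at h
  have h2 : (((-1 : ℤ) : ℂ) / 2 - ((-0 - 1 : ℤ) : ℂ)) = 2⁻¹ := by norm_num
  rw [h2] at h
  have hsub : ∀ A B C : Module.End ℂ Fock, (A - B) * C = A * C - B * C := sub_mul
  rw [hsub, h, smul_mul_assoc, one_mul]
  exact (add_sub_cancel_right _ _).symm

theorem hZero_add_c (P : Params) (m : Ghost → ℤ) (i : Fin 2) :
    hZero P (m + Pi.single .c 1) i = hZero P m i := by
  have ha : ∀ j, zeroMode P (m + Pi.single .c 1) (.a j) = zeroMode P m (.a j) := fun j => rfl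
  have hb : ∀ g, g ≠ .c → zeroMode P (m + Pi.single .c 1) (.b g) = zeroMode P m (.b g) :=
    fun g hg => by simp only [zeroMode, Pi.add_apply, Pi.single_eq_of_ne hg, add_zero]
  rw [hZero, hZero, ha, ha, hb _ (by decide), hb _ (by decide), hb _ (by decide)]

/-- The operator `B` is that of the same generator up to a sign, or up to a constant in the case of
`d`. All that matters is that the kernel of `η_0` is preserved. -/
theorem exists_eta_mul_realize {P : Params} (hP : P.Generic) (g : Gen) :
    ∃ B : Module.End ℂ Fock, eta P 0 * realize P g = B * eta P 0 := by
  cases g with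
  | X s i n => exact ⟨(-1 : ℂ) ^ nodeParity i • current P s i n, by
      rw [smul_mul_assoc]; exact eta_current hP s i n⟩
  | h i n hn => exact ⟨_, eta_hMode hP i hn⟩
  | K i s => exact ⟨_, eta_diagonal P fun m => by rw [hZero_add_c]⟩
  | C s => exact ⟨qpow P.ħ (s.val * (P.α / 2)) • 1, by
      rw [realize, mul_smul_comm, smul_mul_assoc, one_mul, mul_one]⟩
  | d => exact ⟨_, eta_dOp P⟩

theorem mem_momenta {m : Ghost → ℤ} : m ∈ momenta ↔ m .b12 = m .c := by
  constructor
  · rintro ⟨i, j, l, h1, -, -, h4⟩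
    rw [h1, h4]
  · intro h
    exact ⟨m .b12 - m .b13, m .b13, m .b23, by ring, rfl, rfl, by rw [← h]; ring⟩

/-- The difference of the momenta of `b^{12}` and `c`; the space `F_{(β,γ)}` is the sum of the
sectors where it vanishes. -/
def imbalance (m : Ghost → ℤ) : ℂ := (m .b12 - m .c : ℤ)

theorem diagonal_apply (e : (Ghost → ℤ) → ℂ) (v : Fock) (m : Ghost → ℤ) :
    diagonal e v m = e m • v m := by
  have h : Finsupp.lapply (R := ℂ) m ∘ₗ diagonal e = e m • Finsupp.lapply m := by
    refine Finsupp.lhom_ext fun m' f => ?_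
    rw [LinearMap.comp_apply, diagonal_single, LinearMap.smul_apply, Finsupp.lapply_apply,
      Finsupp.lapply_apply]
    by_cases hm : m' = m
    · rw [hm, Finsupp.single_eq_same, Finsupp.single_eq_same]
    · rw [Finsupp.single_eq_of_ne' hm, Finsupp.single_eq_of_ne' hm, smul_zero]
  exact LinearMap.congr_fun h v

/-- The momenta `(i + j, j, l, i + j)` are those where the first component equals the last. -/
theorem mem_fockSpace {v : Fock} : v ∈ fockSpace ↔ diagonal imbalance v = 0 := by
  rw [fockSpace, Finsupp.mem_supported']
  refine ⟨fun h => Finsupp.ext fun m => ?_, fun h m hm => ?_⟩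
  · rw [diagonal_apply, Finsupp.zero_apply]
    by_cases hm : m ∈ momenta
    · rw [imbalance, mem_momenta.1 hm, sub_self, Int.cast_zero, zero_smul]
    · rw [h m hm, smul_zero]
  · have := diagonal_apply imbalance v m
    rw [h, Finsupp.zero_apply] at this
    refine (smul_eq_zero.1 this.symm).resolve_left fun h0 => hm (mem_momenta.2 ?_)
    exact sub_eq_zero.1 (Int.cast_eq_zero.1 h0)

theorem mem_fockSpace_of_commute {T : Module.End ℂ Fock}
    (h : diagonal imbalance * T = T * diagonal imbalance) {v : Fock} (hv : v ∈ fockSpace) :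
    T v ∈ fockSpace := by
  have h1 := LinearMap.congr_fun h v
  rw [Module.End.mul_apply, Module.End.mul_apply, mem_fockSpace.1 hv, map_zero] at h1
  exact mem_fockSpace.2 h1

theorem diagonal_comm (e f : (Ghost → ℤ) → ℂ) :
    diagonal e * diagonal f = diagonal f * diagonal e := by
  rw [diagonal_mul, diagonal_mul]
  congr 1
  funext m
  exact mul_comm _ _

/-- A function of the momenta that is multiplied by `x` under the shifts by the charges of the terms
of a current commutes with the current up to the factor `x`. -/
theorem diagonal_modes (P : Params) {e : (Ghost → ℤ) → ℂ} {x : ℂ} {X : List Term}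
    (h : ∀ t ∈ X, ∀ m, e (m + t.field.charge) = x * e m) (N : ℤ) :
    diagonal e * modes P X N = x • (modes P X N * diagonal e) := by
  induction X with
  | nil => rw [modes_nil, mul_zero, zero_mul, smul_zero]
  | cons t X ih =>
    rw [modes_cons, mul_add, ih fun u hu => h u (List.mem_cons_of_mem _ hu), add_mul, smul_add,
      Term.mode, SymField.mode, mul_smul_comm, diagonal_expMode_shift,
      show (fun m => e (m + (t.field.toField P).charge)) = fun m => x * e m from
        funext (h t List.mem_cons_self), diagonal_smul, mul_smul_comm, smul_mul_assoc, smul_comm]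

/-- The operators of the realization commute with a function of the momenta, up to the factors by
which the shifts of the momenta change it. -/
theorem diagonal_realize {P : Params} (hP : P.Generic) {e : (Ghost → ℤ) → ℂ} {x : ℂ}
    (h : ∀ s i, ∀ t ∈ currentTerms s i, ∀ m, e (m + t.field.charge) = x ^ nodeParity i * e m)
    (g : Gen) : diagonal e * realize P g = x ^ g.parity • (realize P g * diagonal e) := by
  have h0 : ∀ A B : Module.End ℂ Fock, A = B → A = x ^ 0 • B := fun A B hAB => by
    rw [pow_zero, one_smul, hAB]
  cases g with
  | X s i n =>
    rw [realize, current_eq_modes hP]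
    exact diagonal_modes P (h s i) _
  | h i n hn => exact h0 _ _ (diagonal_hMode hP e i hn)
  | K i s => exact h0 _ _ (diagonal_comm _ _)
  | C s => exact h0 _ _ (by rw [realize, mul_smul_comm, smul_mul_assoc, one_mul, mul_one])
  | d => exact h0 _ _ (dOp_diagonal P e).symm

/-- The charges preserve `momenta`, and the charge of `b^{13} + b^{23}` has the parity of the
current. -/
theorem charge_currentTerms (s : Sgn) : ∀ i, ∀ t ∈ currentTerms s i,
    t.field.charge .b12 = t.field.charge .c ∧
      (t.field.charge .b13 + t.field.charge .b23) % 2 = nodeParity i := by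
  cases s <;> decide +kernel

theorem realize_mem_fockSpace {P : Params} (hP : P.Generic) (g : Gen) {v : Fock}
    (hv : v ∈ fockSpace) : realize P g v ∈ fockSpace := by
  refine mem_fockSpace_of_commute ?_ hv
  have := diagonal_realize hP (e := imbalance) (x := 1) (fun s i t ht m => ?_) g
  · rwa [one_pow, one_smul] at this
  · rw [one_pow, one_mul, imbalance, imbalance, Pi.add_apply, Pi.add_apply,
      (charge_currentTerms s i t ht).1]
    congr 1
    ring

theorem realize_mem_fockWakimoto {P : Params} (hP : P.Generic) (g : Gen) {v : Fock}
    (hv : v ∈ fockWakimoto P) : realize P g v ∈ fockWakimoto P := by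
  refine ⟨realize_mem_fockSpace hP g hv.1, ?_⟩
  obtain ⟨B, hB⟩ := exists_eta_mul_realize hP g
  have h := LinearMap.congr_fun hB v
  rw [Module.End.mul_apply, Module.End.mul_apply, LinearMap.mem_ker.1 hv.2, map_zero] at h
  exact LinearMap.mem_ker.2 h

theorem eta_xi_mem_fockSpace (P : Params) {v : Fock} (hv : v ∈ fockSpace) :
    (eta P 0 * xi P 0) v ∈ fockSpace := by
  refine mem_fockSpace_of_commute ?_ hv
  rw [eta, xi, ← mul_assoc, diagonal_expMode_shift, mul_assoc, diagonal_expMode_shift, ← mul_assoc]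
  congr 2
  funext m
  congr 1
  rw [add_assoc]
  change m + (-Pi.single Ghost.c 1 + Pi.single Ghost.c 1) = m
  rw [neg_add_cancel, add_zero]

/-- The restricted Fock space as an image: `η_0 ξ_0` is the identity on the kernel of `η_0`, since
`η_0 ξ_0 + ξ_0 η_0 = 1`. -/
theorem fockWakimoto_eq {P : Params} (hP : P.Generic) :
    fockWakimoto P = fockSpace.map (eta P 0 * xi P 0) := by
  ext v
  constructor
  · rintro ⟨h1, h2⟩
    have h := LinearMap.congr_fun (eta_xi_anticommutator hP) v
    rw [LinearMap.add_apply, Module.End.mul_apply (xi P 0), LinearMap.mem_ker.1 h2, map_zero,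
      add_zero] at h
    exact ⟨v, h1, h⟩
  · rintro ⟨u, hu, rfl⟩
    refine ⟨eta_xi_mem_fockSpace P hu, LinearMap.mem_ker.2 ?_⟩
    rw [← Module.End.mul_apply, ← mul_assoc, eta_sq hP, zero_mul, LinearMap.zero_apply]

theorem parityOp_mem_fockWakimoto (P : Params) {v : Fock} (hv : v ∈ fockWakimoto P) :
    parityOp v ∈ fockWakimoto P := by
  refine ⟨mem_fockSpace_of_commute (diagonal_comm _ _) hv.1, LinearMap.mem_ker.2 ?_⟩
  have h : eta P 0 * parityOp = parityOp * eta P 0 := by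
    refine eta_diagonal P fun m => ?_
    rw [Pi.add_apply, Pi.add_apply, Pi.single_eq_of_ne (by decide), Pi.single_eq_of_ne (by decide),
      add_zero, add_zero]
  rw [← Module.End.mul_apply, h, Module.End.mul_apply, LinearMap.mem_ker.1 hv.2, map_zero]

theorem neg_one_zpow_of_emod {n : ℤ} {p : ℕ} (h : n % 2 = p) : (-1 : ℂ) ^ n = (-1) ^ p := by
  rw [← Int.emod_add_mul_ediv n 2, zpow_add₀ (by norm_num), zpow_mul, h, zpow_natCast]
  norm_num

theorem realize_parityOp {P : Params} (hP : P.Generic) (g : Gen) (v : Fock) :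
    realize P g (parityOp v) = (-1 : ℂ) ^ g.parity • parityOp (realize P g v) := by
  have h := diagonal_realize hP (e := fun m => (-1) ^ (m .b13 + m .b23)) (x := -1)
    (fun s i t ht m => ?_) g
  · have h1 := LinearMap.congr_fun h v
    rw [LinearMap.smul_apply, Module.End.mul_apply, Module.End.mul_apply] at h1
    change parityOp _ = _ • realize P g (parityOp v) at h1
    rw [h1, smul_smul, ← mul_pow, neg_one_mul, neg_neg, one_pow, one_smul]
  · rw [Pi.add_apply, Pi.add_apply, ← neg_one_zpow_of_emod (charge_currentTerms s i t ht).2,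
      ← zpow_add₀ (by norm_num)]
    congr 1
    ring

/-! ### The representation -/

/-- The action of the words in the generators on the restricted Fock space. -/
def wordAction {P : Params} (hP : P.Generic) : Words →ₐ[ℂ] Module.End ℂ (fockWakimoto P) :=
  FreeAlgebra.lift ℂ fun g =>
    (realize P g).restrict fun _ hv => realize_mem_fockWakimoto hP g hv

/-- The action on the restricted Fock space is the restriction of the action on the Fock space. -/
theorem coe_wordAction {P : Params} (hP : P.Generic) (w : Words) (v : fockWakimoto P) :
    (wordAction hP w v : Fock) = realizeHom P w v := by
  induction w using FreeAlgebra.induction generalizing v with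
  | grade0 r =>
    rw [AlgHom.commutes, AlgHom.commutes]; rfl
  | grade1 g =>
    rw [realizeHom_ι, wordAction, FreeAlgebra.lift_ι_apply, LinearMap.coe_restrict_apply]
  | mul a b ha hb =>
    rw [map_mul, map_mul, Module.End.mul_apply, Module.End.mul_apply, ha, hb]
  | add a b ha hb =>
    rw [map_add, map_add, LinearMap.add_apply, LinearMap.add_apply, Submodule.coe_add, ha, hb]

theorem wordAction_rel {P : Params} (hP : P.Generic) {a b : Words} (h : Rel P.ħ a b) :
    wordAction hP a = wordAction hP b := by
  refine LinearMap.ext fun v => Subtype.ext ?_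
  rw [coe_wordAction, coe_wordAction, realizeHom_rel hP h]

theorem existsUnique_representation {P : Params} (hP : P.Generic) :
    ∃! ρ : Uq P.ħ →ₐ[ℂ] Module.End ℂ (fockWakimoto P),
      ∀ (g : Gen) (v : fockWakimoto P), (ρ (Uq.gen P.ħ g) v : Fock) = realize P g v := by
  have hlift : ∃ ρ : Uq P.ħ →ₐ[ℂ] Module.End ℂ (fockWakimoto P),
      ∀ w, ρ (RingQuot.mkAlgHom ℂ (Rel P.ħ) w) = wordAction hP w :=
    ⟨RingQuot.liftAlgHom ℂ ⟨wordAction hP, fun _ _ h => wordAction_rel hP h⟩,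
      fun w => RingQuot.liftAlgHom_mkAlgHom_apply ..⟩
  obtain ⟨ρ, hρ⟩ := hlift
  have hgen : ∀ (g : Gen) (v : fockWakimoto P), (ρ (Uq.gen P.ħ g) v : Fock) = realize P g v :=
    fun g v => by rw [Uq.gen, hρ, coe_wordAction, realizeHom_ι]
  refine ⟨ρ, hgen, fun ρ' hρ' => RingQuot.ringQuot_ext' _ _ _ (FreeAlgebra.hom_ext ?_)⟩
  exact funext fun g => LinearMap.ext fun v => Subtype.ext ((hρ' g v).trans (hgen g v).symm)

end QSl21

end

open QSl21 in
theorem proposition5 (ħ α β γ : ℂ)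
    (hq : ∀ n : ℕ, 0 < n → Complex.exp ħ ^ n ≠ 1) (hα0 : α ≠ 0) (hα1 : α ≠ -1) :
    fockWakimoto ⟨ħ, α, β, γ⟩ =
        fockSpace.map (eta ⟨ħ, α, β, γ⟩ 0 * xi ⟨ħ, α, β, γ⟩ 0) ∧
      (∃! ρ : Uq ħ →ₐ[ℂ] Module.End ℂ (fockWakimoto ⟨ħ, α, β, γ⟩),
        ∀ (g : Gen) (v : fockWakimoto ⟨ħ, α, β, γ⟩),
          ((ρ (Uq.gen ħ g) v : fockWakimoto ⟨ħ, α, β, γ⟩) : Fock) =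
            realize ⟨ħ, α, β, γ⟩ g v) ∧
      (∀ v ∈ fockWakimoto ⟨ħ, α, β, γ⟩, parityOp v ∈ fockWakimoto ⟨ħ, α, β, γ⟩ ∧
        ∀ g : Gen, realize ⟨ħ, α, β, γ⟩ g (parityOp v) =
          (-1 : ℂ) ^ g.parity • parityOp (realize ⟨ħ, α, β, γ⟩ g v)) := by
  have hP : Params.Generic ⟨ħ, α, β, γ⟩ := hq
  exact ⟨fockWakimoto_eq hP, existsUnique_representation hP, fun v hv =>
    ⟨parityOp_mem_fockWakimoto _ hv, fun g => realize_parityOp hP g v⟩⟩
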